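/- Write $S^1=\mathbb R/2\pi\mathbb Z$ and $\langle r\rangle=(1+r^2)^{1/2}$. For every $\delta_0>0$ and $n\in\mathbb Z$ there is a constant $C=C(\delta_0,n)>0$ such that the following holds. Let $h,m\in C^\infty(S^1;\mathbb C)$ with $\operatorname{Im}h\ge 0$ (for example $h$ real-valued), and put $\gamma(\theta)=-e^{-i\theta}h(\theta)$. Assume that $|\gamma'(\theta)|\ge\delta_0$ for all $\theta$, that $\gamma'$ has winding number $n$ about the origin, and that $W(\theta)=\operatorname{Arg}(\gamma'(\theta))$ (a continuous determination of the argument) is $|n|$-to-1 as a map from $S^1$ to $\mathbb R/2\pi\mathbb Z$. Let $\beta>\frac12$ and define $$\kappa^{(\infty)}=\left\|\frac1{|\gamma'|^{\beta}}\left(1+\frac{|\gamma''|}{|\gamma'|}\right)\left|\frac{m}{W'}\right|\right\|_{L^\infty(S^1)},\qquad \kappa^{(1)}=\left\|\frac1{|\gamma'|}\left(\left(1+\frac{|\gamma''|}{|\gamma'|}\right)m+m'\right)\right\|_{L^1(S^1)},$$ $$\kappa^{(\$)}=\|m'\|_{L^1(S^1)}+\|\gamma'\|_{L^\infty(S^1)},$$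 where $|m/W'|\in[0,\infty]$ is read as $\infty$ where $W'=0\ne m$ and as $0$ where $m=0$; thus $\kappa^{(\infty)}$ may be $\infty$. Let $v\in C^1((0,\infty)\times S^1;\mathbb C)$, $\rho>0$, $\alpha\in\mathbb R$, and set $$I(\rho,\alpha)=\int_{S^1}\int_0^\infty e^{i\left(\rho r\sin(\theta+\alpha)+h(\theta)/r\right)}\,v(r,\theta)\,m(\theta)\,dr\,d\theta,\qquad \|v\|_\beta=\big\|\langle r\rangle^{2\beta+1}v\big\|_{L^\infty}+\big\|\langle r\rangle^{2\beta+2}\big(v_r,\tfrac1rv_\theta\big)\big\|_{L^\infty}.$$ If $\|v\|_\beta<\infty$, the integrand is absolutely integrable on $(0,\infty)\times S^1$; and $$|I(\rho,\alpha)|\le C\Big[\big(\rho^{\beta-1}(1+\rho^{-1})\kappa^{(\infty)}+\kappa^{(1)}\big)\log(\rho+2)+\kappa^{(1)}\big(\log(\rho^{-1}+2)+\log(2+\kappa^{(\$)})\big)\Big]\,\|v\|_\beta ,$$ the right-hand side being taken in $[0,\infty]$ with $0\cdot\infty=0$. -/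

import Mathlib

open MeasureTheory Set
open scoped ENNReal ContDiff

noncomputable section

/-- Smooth complex functions on the circle `S¹ = ℝ / 2πℤ`, as `2π`-periodic functions on `ℝ`. -/
def SmoothOnCircle (f : ℝ → ℂ) : Prop :=
  ContDiff ℝ ∞ f ∧ Function.Periodic f (2 * Real.pi)

/-- The class `C¹((0,∞) × S¹; ℂ)`, as functions of `(r, θ)` that are `2π`-periodic in `θ`.
The values at `r ≤ 0` are irrelevant. -/
def C1OnHalfLineCircle (v : ℝ → ℝ → ℂ) : Prop :=
  ContDiffOn ℝ 1 (fun p : ℝ × ℝ => v p.1 p.2) (Ioi 0 ×ˢ univ) ∧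
    ∀ r, 0 < r → Function.Periodic (v r) (2 * Real.pi)

/-- Lebesgue measure `dθ` on one period of the circle. -/
def circleMeasure : Measure ℝ := volume.restrict (Ioc 0 (2 * Real.pi))

/-- The measure `dr dθ` on `(0,∞) × S¹`. -/
def polarMeasure : Measure (ℝ × ℝ) := (volume.restrict (Ioi (0 : ℝ))).prod circleMeasure

/-- The curve `γ(θ) = -e^{-iθ} h(θ)`. -/
def gammaCurve (h : ℝ → ℂ) (θ : ℝ) : ℂ := -Complex.exp (-(Complex.I * θ)) * h θ

/-- `W` is a continuous determination of the argument of `g`: `g = |g| e^{iW}`. -/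
def IsContinuousArg (g : ℝ → ℂ) (W : ℝ → ℝ) : Prop :=
  Continuous W ∧ ∀ θ, g θ = (‖g θ‖ : ℂ) * Complex.exp (Complex.I * W θ)

/-- The phase `Ψ(r,θ) = ρ r sin(θ + α) + h(θ)/r`. -/
def phase (h : ℝ → ℂ) (ρ α r θ : ℝ) : ℂ := ((ρ * r * Real.sin (θ + α) : ℝ) : ℂ) + h θ / r

/-- The integrand `e^{iΨ(r,θ)} v(r,θ) m(θ)`. -/
def oscIntegrand (h m : ℝ → ℂ) (v : ℝ → ℝ → ℂ) (ρ α r θ : ℝ) : ℂ :=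
  Complex.exp (Complex.I * phase h ρ α r θ) * v r θ * m θ

/-- `I(ρ,α) = ∫_{S¹} ∫_0^∞ e^{iΨ(r,θ)} v(r,θ) m(θ) dr dθ`. -/
def oscIntegral (h m : ℝ → ℂ) (v : ℝ → ℝ → ℂ) (ρ α : ℝ) : ℂ :=
  ∫ θ, (∫ r in Ioi (0 : ℝ), oscIntegrand h m v ρ α r θ) ∂circleMeasure

/-- `κ^{(∞)}`. The quotient `|m / W'|` is taken in `[0,∞]`: it is `∞` where `W' = 0 ≠ m`, and `0`
where `m = 0`. -/
def kappaInf (h m : ℝ → ℂ) (W : ℝ → ℝ) (β : ℝ) : ℝ≥0∞ :=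
  eLpNorm (fun θ =>
    ENNReal.ofReal ((1 / ‖deriv (gammaCurve h) θ‖ ^ β) *
        (1 + ‖deriv (deriv (gammaCurve h)) θ‖ / ‖deriv (gammaCurve h) θ‖)) *
      (‖m θ‖ₑ / ‖deriv W θ‖ₑ)) ⊤ circleMeasure

/-- `κ^{(1)}`. -/
def kappaOne (h m : ℝ → ℂ) : ℝ≥0∞ :=
  eLpNorm (fun θ =>
    ((1 / ‖deriv (gammaCurve h) θ‖ : ℝ) : ℂ) *
      (((1 + ‖deriv (deriv (gammaCurve h)) θ‖ / ‖deriv (gammaCurve h) θ‖ : ℝ) : ℂ) * m θ +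
        deriv m θ)) 1 circleMeasure

/-- `κ^{($)}` (finite for smooth `h` and `m`). -/
def kappaDollar (h m : ℝ → ℂ) : ℝ≥0∞ :=
  eLpNorm (deriv m) 1 circleMeasure + eLpNorm (deriv (gammaCurve h)) ⊤ circleMeasure

/-- `⟨r⟩ = (1 + r²)^{1/2}`. -/
def japaneseBracket (r : ℝ) : ℝ := Real.sqrt (1 + r ^ 2)

/-- `‖⟨r⟩^{2β+1} v‖_{L^∞} + ‖⟨r⟩^{2β+2} (v_r, v_θ / r)‖_{L^∞}`; the norm of a pair is the maximum
of the moduli. -/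
def weightedNorm (v : ℝ → ℝ → ℂ) (β : ℝ) : ℝ≥0∞ :=
  eLpNorm (fun p : ℝ × ℝ => japaneseBracket p.1 ^ (2 * β + 1) • v p.1 p.2) ⊤ polarMeasure +
  eLpNorm (fun p : ℝ × ℝ => japaneseBracket p.1 ^ (2 * β + 2) •
    ((deriv (fun s => v s p.2) p.1, (1 / p.1) • deriv (fun t => v p.1 t) p.2) : ℂ × ℂ))
    ⊤ polarMeasure

end

/-! Write `g = γ'`, `ν = m / g`, `z = γ'' / γ'`, `q = ρ e^{iα} r² / g` and `Ψ` for the phase. The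
operator `(1/r)∂_θ + i∂_r` sends `Ψ` to `-(e^{iθ} g / r²)(1 - q)`, so the only obstruction to
integrating by parts is the set `q = 1`. The measure is `dr dθ`, hence both components of the
operator integrate to zero with no density correction. One integration by parts is made, with
`1/(1-q)` replaced by a `C¹` function `regInv` that agrees with it where `|1-q|² ≥ 1/lam`, for `lam
= max ρ 16`. What remains (`enorm_oscIntegral_le_lintegral`) consists of derivatives of the
amplitude and of a bump living on `|1-q|² < 1/lam`. The oscillation is then discarded: `Im h ≥ 0`
gives `|e^{iΨ}| ≤ 1`.

For fixed `θ`, with `R = (|g|/ρ)^{1/2}`, one has `q = (r/R)² e^{i(α-W)}`, so `|1-q|²` is explicit in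
`r/R` and `sin((α-W)/2)`. Terms with an undifferentiated `regInv` cost logarithms in `r`
(`lintegral_sqrt_regSqInv_le`). Terms with its derivative, and the bump, behave like `|1-q|⁻²` and
cost a constant plus `R^{2-2β} (sin²((α-W)/2) + 1/lam)^{-1/2}` (`lintegral_regSqInv_le`). The
constants do not depend on `β`; this rests on `japaneseBracket_rpow_mul_le`.

In `θ` the singular weight is a function of `W` alone. The quantity `κ^{(∞)}` exchanges its
coefficient for `|W'|` times powers of `|g|` and `ρ` that cancel `R^{2-2β}` down to `ρ^{β-1}`. Being
`|n|`-to-1 forces `W` to be injective on a period, so the substitution `w = W(θ)` bounds the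
integral by `|n|` periods of the weight, that is by `log(ρ+2)` (`lintegral_abs_deriv_mul_comp_le`,
`integral_angularWeight_le`).

The other coefficients involve the `L¹` norms of `ν`, `ν'` and `|z||ν|`, whereas `κ^{(1)}` is only
the `L¹` norm of the sum `ν' + (1+|z|+z)ν`, in which cancellation could occur. The separate norms
are recovered from periodicity. The derivative of `|ν|` has mean zero and does not see `Im z`, which
controls `(1+|z|+Re z)|ν|`. Next, `Re z` is the derivative of `log|g|`, and an integration by parts
controls `|z||ν|` at the price of `sup |log|g||`; hence the dependence on `δ₀` and the term
`log(2+κ^{($)})`. Finally `Im z = W'` has total variation at most `2π|n|`, which controls `ν'`. -/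

/-! ### First order equations on a period -/

/-- The regularised modulus `(|z|² + ε²)^{1/2}`. -/
noncomputable def regMod (ε : ℝ) (z : ℂ) : ℝ := Real.sqrt (‖z‖ ^ 2 + ε ^ 2)

theorem regMod_pos {ε : ℝ} (hε : 0 < ε) (z : ℂ) : 0 < regMod ε z :=
  Real.sqrt_pos.2 (by positivity)

theorem norm_le_regMod (ε : ℝ) (z : ℂ) : ‖z‖ ≤ regMod ε z :=
  Real.le_sqrt_of_sq_le (by nlinarith [sq_nonneg ε])

theorem regMod_le {ε : ℝ} (hε : 0 < ε) (z : ℂ) : regMod ε z ≤ ‖z‖ + ε := by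
  refine Real.sqrt_le_iff.2 ⟨by positivity, ?_⟩
  nlinarith [norm_nonneg z]

theorem norm_sub_le_sq_div_regMod {ε : ℝ} (hε : 0 < ε) (z : ℂ) :
    ‖z‖ - ε ≤ ‖z‖ ^ 2 / regMod ε z := by
  rw [le_div_iff₀ (regMod_pos hε z)]
  have h1 := regMod_le hε z
  have h2 := norm_le_regMod ε z
  rcases le_total ε ‖z‖ with h | h
  · nlinarith [norm_nonneg z]
  · nlinarith [norm_nonneg z, regMod_pos hε z, sq_nonneg ‖z‖]

theorem hasDerivAt_regMod {ε : ℝ} (hε : 0 < ε) {f : ℝ → ℂ} {f' : ℂ} {x : ℝ}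
    (hf : HasDerivAt f f' x) :
    HasDerivAt (fun y => regMod ε (f y)) (inner ℝ (f x) f' / regMod ε (f x)) x := by
  have h := ((hf.norm_sq).add_const (ε ^ 2)).sqrt (by positivity)
  rw [mul_div_mul_left _ _ two_ne_zero] at h
  exact h

theorem inner_self_I_mul (y : ℝ) (z : ℂ) : inner ℝ z (Complex.I * y * z) = 0 := by
  simp [Complex.inner, Complex.mul_re, Complex.mul_im]
  ring

theorem inner_real_mul (y : ℝ) (z : ℂ) : inner ℝ z ((y : ℂ) * z) = y * ‖z‖ ^ 2 := by
  rw [← Complex.real_smul, real_inner_smul_right, real_inner_self_eq_norm_sq]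

theorem regMod_continuous (ε : ℝ) : Continuous (regMod ε) := by
  unfold regMod; fun_prop

section Period

variable {L : ℝ} {ν ν' z : ℝ → ℂ}

/-- The derivative of `|ν|` is the component of `ν'` along `ν`, and its integral over a period
vanishes. The part `i Im z` acts orthogonally to `ν` and drops out, leaving the nonnegative weight
`1 + |z| + Re z` as a damping coefficient. Since `|ν|` need not be differentiable at zeros of `ν`,
the argument runs with `regMod ε` and lets `ε` tend to zero. -/
theorem integral_weighted_le (hL : 0 < L) (hν : ∀ x, HasDerivAt ν (ν' x) x)
    (hν' : Continuous ν') (hz : Continuous z) (hper : ν L = ν 0) :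
    ∫ x in 0..L, (1 + (‖z x‖ + (z x).re)) * ‖ν x‖ ≤
      ∫ x in 0..L, ‖ν' x + (1 + ‖z x‖ + z x) * ν x‖ := by
  have cν : Continuous ν := continuous_iff_continuousAt.2 fun x => (hν x).continuousAt
  have cre : Continuous fun x => (z x).re := Complex.continuous_re.comp hz
  set A := ∫ x in 0..L, (1 + (‖z x‖ + (z x).re))
  have hA : 0 ≤ A := intervalIntegral.integral_nonneg hL.le fun x _ => by
    have := (abs_le.1 (Complex.abs_re_le_norm (z x))).1; linarith
  have key : ∀ ε > 0, ∫ x in 0..L, (1 + (‖z x‖ + (z x).re)) * ‖ν x‖ ≤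
      (∫ x in 0..L, ‖ν' x + (1 + ‖z x‖ + z x) * ν x‖) + ε * A := by
    intro ε hε
    have hd : ∀ x, HasDerivAt (fun y => regMod ε (ν y))
        (inner ℝ (ν x) (ν' x) / regMod ε (ν x)) x := fun x => hasDerivAt_regMod hε (hν x)
    have cm : Continuous fun x => regMod ε (ν x) := (regMod_continuous ε).comp cν
    have cd : Continuous fun x => inner ℝ (ν x) (ν' x) / regMod ε (ν x) :=
      (cν.inner hν').div cm fun x => (regMod_pos hε _).ne'
    have h0 : ∫ x in 0..L, inner ℝ (ν x) (ν' x) / regMod ε (ν x) = 0 := by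
      rw [intervalIntegral.integral_eq_sub_of_hasDerivAt (fun x _ => hd x)
        (cd.intervalIntegrable _ _), hper, sub_self]
    have hle : ∀ x, inner ℝ (ν x) (ν' x) / regMod ε (ν x) ≤
        ‖ν' x + (1 + ‖z x‖ + z x) * ν x‖ - (1 + (‖z x‖ + (z x).re)) * ‖ν x‖
          + ε * (1 + (‖z x‖ + (z x).re)) := by
      intro x
      have hc : 0 ≤ 1 + (‖z x‖ + (z x).re) := by
        have := (abs_le.1 (Complex.abs_re_le_norm (z x))).1; linarith
      set k := ν' x + (1 + ‖z x‖ + z x) * ν x with hk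
      -- Separating the real and imaginary parts of `z` isolates the term orthogonal to `ν`.
      have e : ν' x = k - ((1 + (‖z x‖ + (z x).re) : ℝ) : ℂ) * ν x
          - Complex.I * (z x).im * ν x := by
        have : z x = (z x).re + (z x).im * Complex.I := (Complex.re_add_im _).symm
        rw [hk]; push_cast
        linear_combination (-ν x) * this
      have e2 : inner ℝ (ν x) (ν' x) =
          inner ℝ (ν x) k - (1 + (‖z x‖ + (z x).re)) * ‖ν x‖ ^ 2 := by
        rw [e, inner_sub_right, inner_sub_right, inner_self_I_mul, inner_real_mul, sub_zero]
      have e3 : inner ℝ (ν x) k / regMod ε (ν x) ≤ ‖k‖ := by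
        rw [div_le_iff₀ (regMod_pos hε _)]
        have h1 := real_inner_le_norm (ν x) k
        have h2 := norm_le_regMod ε (ν x)
        nlinarith [norm_nonneg k]
      have e4 := mul_le_mul_of_nonneg_left (norm_sub_le_sq_div_regMod hε (ν x)) hc
      rw [e2, sub_div, mul_div_assoc]
      linarith
    have hint := intervalIntegral.integral_mono_on (μ := volume) hL.le (cd.intervalIntegrable 0 L)
      ((by fun_prop : Continuous fun x => ‖ν' x + (1 + ‖z x‖ + z x) * ν x‖
        - (1 + (‖z x‖ + (z x).re)) * ‖ν x‖
          + ε * (1 + (‖z x‖ + (z x).re))).intervalIntegrable 0 L) fun x _ => hle x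
    rw [h0, intervalIntegral.integral_add, intervalIntegral.integral_sub,
      intervalIntegral.integral_const_mul] at hint
    · linarith
    all_goals exact Continuous.intervalIntegrable (by fun_prop) _ _
  refine le_of_forall_pos_le_add fun ε hε => ?_
  have h := key (ε / (A + 1)) (by positivity)
  have : ε / (A + 1) * A ≤ ε := by
    rw [div_mul_eq_mul_div, div_le_iff₀ (by positivity)]; nlinarith
  linarith

theorem integral_norm_le (hL : 0 < L) (hν : ∀ x, HasDerivAt ν (ν' x) x)
    (hν' : Continuous ν') (hz : Continuous z) (hper : ν L = ν 0) :
    ∫ x in 0..L, ‖ν x‖ ≤ ∫ x in 0..L, ‖ν' x + (1 + ‖z x‖ + z x) * ν x‖ := by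
  have cν : Continuous ν := continuous_iff_continuousAt.2 fun x => (hν x).continuousAt
  have cre : Continuous fun x => (z x).re := Complex.continuous_re.comp hz
  refine le_trans (intervalIntegral.integral_mono_on hL.le
    (Continuous.intervalIntegrable (by fun_prop) _ _)
    (Continuous.intervalIntegrable (by fun_prop) _ _) fun x _ => ?_)
    (integral_weighted_le hL hν hν' hz hper)
  have := (abs_le.1 (Complex.abs_re_le_norm (z x))).1
  nlinarith [norm_nonneg (ν x)]

/-- The two integrands differ by `(1 + |z| + Re z) ν`, which `integral_weighted_le` controls. When
`Im z = W'`, the left integrand is the modulus of the derivative of `e^{iW} ν`. -/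
theorem integral_twisted_deriv_le (hL : 0 < L) (hν : ∀ x, HasDerivAt ν (ν' x) x)
    (hν' : Continuous ν') (hz : Continuous z) (hper : ν L = ν 0) :
    ∫ x in 0..L, ‖ν' x + Complex.I * (z x).im * ν x‖ ≤
      2 * ∫ x in 0..L, ‖ν' x + (1 + ‖z x‖ + z x) * ν x‖ := by
  have cν : Continuous ν := continuous_iff_continuousAt.2 fun x => (hν x).continuousAt
  have cre : Continuous fun x => (z x).re := Complex.continuous_re.comp hz
  have cim : Continuous fun x => (z x).im := Complex.continuous_im.comp hz
  have h1 := integral_weighted_le hL hν hν' hz hper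
  have h2 := intervalIntegral.integral_mono_on (a := 0) (b := L) (μ := volume)
    (f := fun x => ‖ν' x + Complex.I * (z x).im * ν x‖)
    (g := fun x => ‖ν' x + (1 + ‖z x‖ + z x) * ν x‖ + (1 + (‖z x‖ + (z x).re)) * ‖ν x‖)
    hL.le (Continuous.intervalIntegrable (by fun_prop) _ _)
    (Continuous.intervalIntegrable (by fun_prop) _ _) fun x _ => by
      have hc : 0 ≤ 1 + (‖z x‖ + (z x).re) := by
        have := (abs_le.1 (Complex.abs_re_le_norm (z x))).1; linarith
      have e : ν' x + Complex.I * (z x).im * ν x = (ν' x + (1 + ‖z x‖ + z x) * ν x)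
          - ((1 + (‖z x‖ + (z x).re) : ℝ) : ℂ) * ν x := by
        have : z x = (z x).re + (z x).im * Complex.I := (Complex.re_add_im _).symm
        push_cast
        linear_combination (-ν x) * this
      rw [e]
      refine (norm_sub_le _ _).trans_eq ?_
      rw [norm_mul, Complex.norm_real, Real.norm_of_nonneg hc]
  rw [intervalIntegral.integral_add] at h2
  · linarith
  all_goals exact Continuous.intervalIntegrable (by fun_prop) _ _

/-- Adding `i y a` to `b` does not change the component along `a`, so the derivative of the modulus
is bounded by any such twisted derivative. -/
theorem abs_inner_div_regMod_le {ε : ℝ} (hε : 0 < ε) (a b : ℂ) (y : ℝ) :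
    |inner ℝ a b / regMod ε a| ≤ ‖b + Complex.I * y * a‖ := by
  have e : inner ℝ a b = inner ℝ a (b + Complex.I * y * a) := by
    rw [inner_add_right, inner_self_I_mul, add_zero]
  rw [e, abs_div, abs_of_pos (regMod_pos hε a), div_le_iff₀ (regMod_pos hε _)]
  have h1 := abs_real_inner_le_norm a (b + Complex.I * y * a)
  have h2 := norm_le_regMod ε a
  nlinarith [norm_nonneg (b + Complex.I * y * a)]

/-- The modulus `|ν|` varies by at most the integral of the twisted derivative between two points;
averaging over the second point gives the bound. -/
theorem norm_le_of_twisted (hL : 0 < L) (hν : ∀ x, HasDerivAt ν (ν' x) x)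
    (hν' : Continuous ν') (hz : Continuous z) {x : ℝ} (hx : x ∈ Icc 0 L) :
    L * ‖ν x‖ ≤ (∫ y in 0..L, ‖ν y‖) + L * ∫ y in 0..L, ‖ν' y + Complex.I * (z y).im * ν y‖ := by
  have cν : Continuous ν := continuous_iff_continuousAt.2 fun x => (hν x).continuousAt
  have cim : Continuous fun x => (z x).im := Complex.continuous_im.comp hz
  set T := ∫ y in 0..L, ‖ν' y + Complex.I * (z y).im * ν y‖ with hT
  have cT : Continuous fun y => ‖ν' y + Complex.I * (z y).im * ν y‖ := by fun_prop
  have key : ∀ ε > 0, L * ‖ν x‖ ≤ ((∫ y in 0..L, ‖ν y‖) + L * T) + ε * L := by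
    intro ε hε
    have cm : Continuous fun x => regMod ε (ν x) := (regMod_continuous ε).comp cν
    have cd : Continuous fun x => inner ℝ (ν x) (ν' x) / regMod ε (ν x) :=
      (cν.inner hν').div cm fun x => (regMod_pos hε _).ne'
    have h1 : ∀ y ∈ Icc 0 L, ‖ν x‖ ≤ ‖ν y‖ + (ε + T) := by
      intro y hy
      have h0 : ∫ s in y..x, inner ℝ (ν s) (ν' s) / regMod ε (ν s) =
          regMod ε (ν x) - regMod ε (ν y) :=
        intervalIntegral.integral_eq_sub_of_hasDerivAt
          (fun s _ => hasDerivAt_regMod hε (hν s)) (cd.intervalIntegrable _ _)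
      have h2 : |∫ s in y..x, inner ℝ (ν s) (ν' s) / regMod ε (ν s)| ≤ T := by
        have h3 : ‖∫ s in y..x, inner ℝ (ν s) (ν' s) / regMod ε (ν s)‖ ≤
            |∫ s in y..x, ‖ν' s + Complex.I * (z s).im * ν s‖| :=
          intervalIntegral.norm_integral_le_abs_of_norm_le
            (Filter.Eventually.of_forall fun s => abs_inner_div_regMod_le hε _ _ _)
            (cT.intervalIntegrable _ _)
        refine (Real.norm_eq_abs _ ▸ h3).trans ?_
        have h4 := intervalIntegral.abs_integral_mono_interval (μ := volume)
          (f := fun y => ‖ν' y + Complex.I * (z y).im * ν y‖) (a := y) (b := x) (c := 0) (d := L)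
          (by
            rw [uIoc_of_le hL.le]
            intro s hs
            rw [mem_uIoc] at hs
            constructor <;> rcases hs with hs | hs <;> linarith [hs.1, hs.2, hx.1, hx.2, hy.1, hy.2])
          (Filter.Eventually.of_forall fun s => norm_nonneg _) (cT.intervalIntegrable _ _)
        refine h4.trans_eq (abs_of_nonneg ?_)
        exact intervalIntegral.integral_nonneg hL.le fun s _ => norm_nonneg _
      have h5 := regMod_le hε (ν y)
      have h6 := norm_le_regMod ε (ν x)
      have h7 := (abs_le.1 (h0 ▸ h2)).2
      linarith
    have h2 := intervalIntegral.integral_mono_on (a := 0) (b := L) (μ := volume)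
      (f := fun _ => ‖ν x‖) (g := fun y => ‖ν y‖ + (ε + T)) hL.le
      (Continuous.intervalIntegrable (by fun_prop) _ _)
      (Continuous.intervalIntegrable (by fun_prop) _ _) h1
    rw [intervalIntegral.integral_add (Continuous.intervalIntegrable (by fun_prop) _ _)
      (Continuous.intervalIntegrable (by fun_prop) _ _)] at h2
    simp only [intervalIntegral.integral_const, sub_zero, smul_eq_mul] at h2
    nlinarith
  refine le_of_forall_pos_le_add fun ε hε => ?_
  have h := key (ε / L) (by positivity)
  rwa [div_mul_cancel₀ _ hL.ne'] at h

/-- The weight `1 + |z| + Re z` dominates `|z|` except where `Re z` is negative. That loss is `-∫ Re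
z |ν|`, and since `Re z = S'` with `S` periodic, the derivative moves onto `|ν|`, whose variation
the twisted derivative controls. The intended `S` is `log|γ'|`, so the price is only logarithmic in
the size of `γ'`. -/
theorem integral_norm_mul_le {S : ℝ → ℝ} {D : ℝ} (hL : 0 < L)
    (hν : ∀ x, HasDerivAt ν (ν' x) x)
    (hν' : Continuous ν') (hz : Continuous z) (hper : ν L = ν 0)
    (hS : ∀ x, HasDerivAt S (z x).re x) (hSper : S L = S 0)
    (hSD : ∀ x ∈ Icc 0 L, |S x| ≤ D) :
    ∫ x in 0..L, ‖z x‖ * ‖ν x‖ ≤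
      (1 + 2 * D) * ∫ x in 0..L, ‖ν' x + (1 + ‖z x‖ + z x) * ν x‖ := by
  have cν : Continuous ν := continuous_iff_continuousAt.2 fun x => (hν x).continuousAt
  have cS : Continuous S := continuous_iff_continuousAt.2 fun x => (hS x).continuousAt
  have cre : Continuous fun x => (z x).re := Complex.continuous_re.comp hz
  have cim : Continuous fun x => (z x).im := Complex.continuous_im.comp hz
  set K := ∫ x in 0..L, ‖ν' x + (1 + ‖z x‖ + z x) * ν x‖ with hK
  have hw := integral_weighted_le hL hν hν' hz hper
  have ht := integral_twisted_deriv_le hL hν hν' hz hper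
  have cT : Continuous fun y => ‖ν' y + Complex.I * (z y).im * ν y‖ := by fun_prop
  have hD : 0 ≤ D := (abs_nonneg _).trans (hSD 0 ⟨le_rfl, hL.le⟩)
  set A := ∫ x in 0..L, |(z x).re|
  have hA : 0 ≤ A := intervalIntegral.integral_nonneg hL.le fun x _ => abs_nonneg _
  have key : ∀ ε > 0, -(∫ x in 0..L, (z x).re * ‖ν x‖) ≤ D * (2 * K) + ε * A := by
    intro ε hε
    have cm : Continuous fun x => regMod ε (ν x) := (regMod_continuous ε).comp cν
    have cd : Continuous fun x => inner ℝ (ν x) (ν' x) / regMod ε (ν x) :=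
      (cν.inner hν').div cm fun x => (regMod_pos hε _).ne'
    -- The product of `S` and the regularised modulus takes equal values at both ends.
    have h0 : ∫ x in 0..L, ((z x).re * regMod ε (ν x) +
        S x * (inner ℝ (ν x) (ν' x) / regMod ε (ν x))) = 0 := by
      rw [intervalIntegral.integral_eq_sub_of_hasDerivAt
        (fun x _ => (hS x).mul (hasDerivAt_regMod hε (hν x)))
        (Continuous.intervalIntegrable (by fun_prop) _ _)]
      simp [hper, hSper]
    have hle : ∀ x ∈ Icc 0 L, -((z x).re * ‖ν x‖) ≤
        -((z x).re * regMod ε (ν x) + S x * (inner ℝ (ν x) (ν' x) / regMod ε (ν x))) +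
          (D * ‖ν' x + Complex.I * (z x).im * ν x‖ + ε * |(z x).re|) := by
      intro x hx
      have h1 : |S x * (inner ℝ (ν x) (ν' x) / regMod ε (ν x))| ≤
          D * ‖ν' x + Complex.I * (z x).im * ν x‖ := by
        rw [abs_mul]
        exact mul_le_mul (hSD x hx) (abs_inner_div_regMod_le hε _ _ _) (abs_nonneg _) hD
      have h2 : (z x).re * (regMod ε (ν x) - ‖ν x‖) ≤ ε * |(z x).re| := by
        have h3 := regMod_le hε (ν x)
        have h4 := norm_le_regMod ε (ν x)
        have h5 := le_abs_self (z x).re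
        nlinarith [abs_nonneg (z x).re]
      have := (abs_le.1 h1).2
      linarith
    have hint := intervalIntegral.integral_mono_on (μ := volume) hL.le
      (Continuous.intervalIntegrable (by fun_prop) _ _)
      (Continuous.intervalIntegrable (by fun_prop) _ _) hle
    rw [intervalIntegral.integral_add, intervalIntegral.integral_neg,
      intervalIntegral.integral_neg, h0, intervalIntegral.integral_add,
      intervalIntegral.integral_const_mul, intervalIntegral.integral_const_mul] at hint
    · have := mul_le_mul_of_nonneg_left ht hD
      linarith
    all_goals exact Continuous.intervalIntegrable (by fun_prop) _ _
  have hfin : -(∫ x in 0..L, (z x).re * ‖ν x‖) ≤ D * (2 * K) := by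
    refine le_of_forall_pos_le_add fun ε hε => ?_
    have h := key (ε / (A + 1)) (by positivity)
    have : ε / (A + 1) * A ≤ ε := by
      rw [div_mul_eq_mul_div, div_le_iff₀ (by positivity)]; nlinarith
    linarith
  have hsplit : ∫ x in 0..L, (1 + (‖z x‖ + (z x).re)) * ‖ν x‖ =
      (∫ x in 0..L, ‖ν x‖) + ((∫ x in 0..L, ‖z x‖ * ‖ν x‖) + ∫ x in 0..L, (z x).re * ‖ν x‖) := by
    rw [← intervalIntegral.integral_add, ← intervalIntegral.integral_add]
    · congr 1; ext x; ring
    all_goals exact Continuous.intervalIntegrable (by fun_prop) _ _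
  have hpos : 0 ≤ ∫ x in 0..L, ‖ν x‖ :=
    intervalIntegral.integral_nonneg hL.le fun x _ => norm_nonneg _
  linarith

/-- Undoing the twist costs `|Im z||ν|`, which is the sup norm of `ν` times the total variation `V`.
-/
theorem integral_norm_deriv_le {V : ℝ} (hL : 1 ≤ L)
    (hν : ∀ x, HasDerivAt ν (ν' x) x)
    (hν' : Continuous ν') (hz : Continuous z) (hper : ν L = ν 0)
    (hV : ∫ x in 0..L, |(z x).im| ≤ V) :
    ∫ x in 0..L, ‖ν' x‖ ≤
      (2 + 3 * V) * ∫ x in 0..L, ‖ν' x + (1 + ‖z x‖ + z x) * ν x‖ := by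
  have hL0 : 0 < L := by linarith
  have cν : Continuous ν := continuous_iff_continuousAt.2 fun x => (hν x).continuousAt
  have cim : Continuous fun x => (z x).im := Complex.continuous_im.comp hz
  set K := ∫ x in 0..L, ‖ν' x + (1 + ‖z x‖ + z x) * ν x‖ with hK
  have hK0 : 0 ≤ K := intervalIntegral.integral_nonneg hL0.le fun x _ => norm_nonneg _
  have ht := integral_twisted_deriv_le hL0 hν hν' hz hper
  have hn := integral_norm_le hL0 hν hν' hz hper
  -- One `K` comes from the mean of `|ν|` (with `L ≥ 1`) and two from the twisted derivative.
  have hsup : ∀ x ∈ Icc 0 L, ‖ν x‖ ≤ 3 * K := by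
    intro x hx
    have h := norm_le_of_twisted hL0 hν hν' hz hx
    have h2 : L * ‖ν x‖ ≤ L * (3 * K) := by nlinarith
    exact le_of_mul_le_mul_left h2 hL0
  have hint := intervalIntegral.integral_mono_on (μ := volume) (a := 0) (b := L)
    (f := fun x => ‖ν' x‖)
    (g := fun x => ‖ν' x + Complex.I * (z x).im * ν x‖ + 3 * K * |(z x).im|) hL0.le
    (Continuous.intervalIntegrable (by fun_prop) _ _)
    (Continuous.intervalIntegrable (by fun_prop) _ _) fun x hx => by
      have e : ν' x = (ν' x + Complex.I * (z x).im * ν x) - Complex.I * (z x).im * ν x := by ring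
      have h1 : ‖Complex.I * (z x).im * ν x‖ ≤ 3 * K * |(z x).im| := by
        rw [norm_mul, norm_mul, Complex.norm_I, one_mul, Complex.norm_real, Real.norm_eq_abs,
          mul_comm]
        exact mul_le_mul_of_nonneg_right (hsup x hx) (abs_nonneg _)
      calc ‖ν' x‖ = ‖(ν' x + Complex.I * (z x).im * ν x) - Complex.I * (z x).im * ν x‖ := by
            rw [← e]
        _ ≤ _ := norm_sub_le _ _
        _ ≤ _ := by gcongr
  rw [intervalIntegral.integral_add, intervalIntegral.integral_const_mul] at hint
  · nlinarith
  all_goals exact Continuous.intervalIntegrable (by fun_prop) _ _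

end Period

/-! ### Continuous determinations of the argument -/

/-- Near `θ` the increment of `W` is the imaginary part of the principal logarithm of `g x / g θ`, a
quotient close to `1`. -/
theorem IsContinuousArg.hasDerivAt {g : ℝ → ℂ} {W : ℝ → ℝ} (hW : IsContinuousArg g W)
    {g' : ℂ} {θ : ℝ} (hg : HasDerivAt g g' θ) (h0 : g θ ≠ 0) :
    HasDerivAt W (g' / g θ).im θ := by
  have hq : HasDerivAt (fun x => g x / g θ) (g' / g θ) θ := hg.div_const _
  have h1 : g θ / g θ = 1 := div_self h0
  have hl := hq.clog_real (by rw [h1]; exact Complex.one_mem_slitPlane)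
  rw [h1, div_one] at hl
  have hi := (Complex.imCLM.hasFDerivAt.comp_hasDerivAt θ hl).const_add (W θ)
  refine hi.congr_of_eventuallyEq ?_
  -- An increment of size less than `π` is not altered by reduction to the principal branch.
  have hnear : ∀ᶠ x in nhds θ, |W x - W θ| < Real.pi := by
    have := (hW.1.continuousAt (x := θ)).eventually (Metric.ball_mem_nhds (W θ) Real.pi_pos)
    filter_upwards [this] with x hx
    rwa [Real.dist_eq] at hx
  have hne : ∀ᶠ x in nhds θ, g x ≠ 0 := hg.continuousAt.eventually_ne h0
  filter_upwards [hnear, hne] with x hx hx0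
  have e : g x / g θ = ((‖g x‖ / ‖g θ‖ : ℝ) : ℂ) * Complex.exp ((W x - W θ : ℝ) * Complex.I) := by
    have hn : (‖g θ‖ : ℂ) ≠ 0 := by exact_mod_cast norm_ne_zero_iff.2 h0
    have hx1 := hW.2 x
    have hx2 := hW.2 θ
    have : Complex.exp ((W x - W θ : ℝ) * Complex.I) =
        Complex.exp (Complex.I * W x) / Complex.exp (Complex.I * W θ) := by
      rw [← Complex.exp_sub]; congr 1; push_cast; ring
    rw [this]
    conv_lhs => rw [hx1, hx2]
    push_cast
    field_simp [Complex.exp_ne_zero]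
  have hpos : 0 < ‖g x‖ / ‖g θ‖ := div_pos (norm_pos_iff.2 hx0) (norm_pos_iff.2 h0)
  have : Complex.imCLM (Complex.log (g x / g θ)) = W x - W θ := by
    rw [Complex.imCLM_apply, Complex.log_im, e, Complex.arg_real_mul _ hpos,
      Complex.arg_exp_mul_I, toIocMod_eq_self]
    constructor <;> [skip; skip] <;> linarith [(abs_lt.1 hx).1, (abs_lt.1 hx).2]
  simp only [Function.comp] at this ⊢
  rw [this]; ring

/-- The intermediate value theorem already produces `N` points of the fibre, one for each lift `c +
2πk` in the range between the endpoint values of `W`. The count leaves room for no others. -/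
theorem fiber_eq_of_encard_eq {W : ℝ → ℝ} (hW : Continuous W) {N : ℕ}
    (hn : W (2 * Real.pi) - W 0 = 2 * Real.pi * N)
    (hc : ∀ w : Real.Angle,
      {θ : ℝ | θ ∈ Ico 0 (2 * Real.pi) ∧ (W θ : Real.Angle) = w}.encard = (N : ℕ∞)) (w : ℝ) :
    ∃ (c : ℝ) (x : Fin N → ℝ), (∀ k, W (x k) = c + 2 * Real.pi * k) ∧
      (∀ k, W (x k) ∈ Ico (W 0) (W (2 * Real.pi))) ∧
      {θ : ℝ | θ ∈ Ico 0 (2 * Real.pi) ∧ (W θ : Real.Angle) = w} = range x := by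
  have hpi := Real.two_pi_pos
  -- Taking the lift in the first period above `W 0` places all `N` translates below `W (2π)`.
  obtain ⟨c, hcmem, hcw⟩ : ∃ c, c ∈ Ico (W 0) (W 0 + 2 * Real.pi) ∧ (c : Real.Angle) = w := by
    refine ⟨toIcoMod hpi (W 0) w, toIcoMod_mem_Ico _ _ _, ?_⟩
    rw [Real.Angle.angle_eq_iff_two_pi_dvd_sub]
    refine ⟨-toIcoDiv hpi (W 0) w, ?_⟩
    rw [toIcoMod]; push_cast; rw [zsmul_eq_mul]; ring
  have hmem : ∀ k : Fin N, c + 2 * Real.pi * k ∈ Ico (W 0) (W (2 * Real.pi)) := by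
    intro k
    have hk0 : (0 : ℝ) ≤ k := Nat.cast_nonneg _
    have hk1 : (k : ℝ) + 1 ≤ N := by exact_mod_cast k.2
    constructor
    · nlinarith [hcmem.1]
    · have := hcmem.2
      nlinarith
  have hex : ∀ k : Fin N, ∃ x ∈ Ico 0 (2 * Real.pi), W x = c + 2 * Real.pi * k := fun k =>
    intermediate_value_Ico hpi.le hW.continuousOn (hmem k)
  choose x hx hWx using hex
  refine ⟨c, x, hWx, fun k => by rw [hWx]; exact hmem k, ?_⟩
  have hinj : Function.Injective x := by
    intro k l hkl
    have h := hWx k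
    rw [hkl, hWx l] at h
    have h2 : (k : ℝ) = l := by
      have : 2 * Real.pi * (k : ℝ) = 2 * Real.pi * l := by linarith
      exact mul_left_cancel₀ hpi.ne' this
    exact Fin.ext (by exact_mod_cast h2)
  have hsub : range x ⊆ {θ : ℝ | θ ∈ Ico 0 (2 * Real.pi) ∧ (W θ : Real.Angle) = w} := by
    rintro _ ⟨k, rfl⟩
    refine ⟨hx k, ?_⟩
    rw [hWx, ← hcw, Real.Angle.angle_eq_iff_two_pi_dvd_sub]
    exact ⟨k, by push_cast; ring⟩
  symm
  refine (finite_range x).eq_of_subset_of_encard_le hsub ?_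
  rw [hc w, ← image_univ, hinj.encard_image]
  simp

theorem injOn_of_encard_eq_nat {W : ℝ → ℝ} (hW : Continuous W) {N : ℕ}
    (hn : W (2 * Real.pi) - W 0 = 2 * Real.pi * N)
    (hc : ∀ w : Real.Angle,
      {θ : ℝ | θ ∈ Ico 0 (2 * Real.pi) ∧ (W θ : Real.Angle) = w}.encard = (N : ℕ∞)) :
    InjOn W (Ico 0 (2 * Real.pi)) ∧
      MapsTo W (Ico 0 (2 * Real.pi)) (uIcc (W 0) (W (2 * Real.pi))) := by
  have hpi := Real.two_pi_pos
  constructor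
  · intro a ha b hb hab
    obtain ⟨c, x, h1, -, h3⟩ := fiber_eq_of_encard_eq hW hn hc (W a)
    obtain ⟨k, rfl⟩ : a ∈ range x := h3 ▸ ⟨ha, rfl⟩
    obtain ⟨l, rfl⟩ : b ∈ range x := h3 ▸ ⟨hb, by rw [hab]⟩
    rw [h1, h1] at hab
    have h2 : (k : ℝ) = l := by
      have : 2 * Real.pi * (k : ℝ) = 2 * Real.pi * l := by linarith
      exact mul_left_cancel₀ hpi.ne' this
    have : k = l := Fin.ext (by exact_mod_cast h2)
    rw [this]
  · intro a ha
    obtain ⟨c, x, -, h2, h3⟩ := fiber_eq_of_encard_eq hW hn hc (W a)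
    obtain ⟨k, rfl⟩ : a ∈ range x := h3 ▸ ⟨ha, rfl⟩
    exact Icc_subset_uIcc (Ico_subset_Icc_self (h2 k))

/-- Negative winding reduces to the positive case for `-W`. Winding zero is impossible under the
count, since the fibre through `W 0` is never empty. -/
theorem injOn_of_encard_eq {W : ℝ → ℝ} (hW : Continuous W) {n : ℤ}
    (hn : W (2 * Real.pi) - W 0 = 2 * Real.pi * n)
    (hc : ∀ w : Real.Angle,
      {θ : ℝ | θ ∈ Ico 0 (2 * Real.pi) ∧ (W θ : Real.Angle) = w}.encard = (n.natAbs : ℕ∞)) :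
    InjOn W (Ico 0 (2 * Real.pi)) ∧
      MapsTo W (Ico 0 (2 * Real.pi)) (uIcc (W 0) (W (2 * Real.pi))) := by
  rcases le_total 0 n with h | h
  · refine injOn_of_encard_eq_nat hW (N := n.natAbs) ?_ hc
    rw [hn, Nat.cast_natAbs, abs_of_nonneg h]
  · have := injOn_of_encard_eq_nat (W := fun x => -W x) hW.neg (N := n.natAbs) ?_ ?_
    · refine ⟨fun a ha b hb hab => this.1 ha hb (by simp [hab]), fun a ha => ?_⟩
      have h2 := this.2 ha
      rw [mem_uIcc] at h2 ⊢
      rcases h2 with h2 | h2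
      · right; constructor <;> linarith [h2.1, h2.2]
      · left; constructor <;> linarith [h2.1, h2.2]
    · rw [Nat.cast_natAbs, abs_of_nonpos h]; push_cast; linarith
    · intro w
      rw [← hc (-w)]
      congr 1; ext θ
      simp only [mem_ofPred_eq, Real.Angle.coe_neg, neg_eq_iff_eq_neg]

/-- This is the change of variables `w = W(θ)`, legitimate because `W` is injective on the period.
The image lies between `W 0` and `W (2π)`, an interval of `|n|` full periods, and by periodicity
each period may start at any `a`. -/
theorem lintegral_abs_deriv_mul_comp_le {W W' F : ℝ → ℝ} {n : ℤ}
    (hW : ∀ θ, HasDerivAt W (W' θ) θ)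
    (hn : W (2 * Real.pi) - W 0 = 2 * Real.pi * n)
    (hinj : InjOn W (Ico 0 (2 * Real.pi)))
    (hmaps : MapsTo W (Ico 0 (2 * Real.pi)) (uIcc (W 0) (W (2 * Real.pi))))
    (hF : Continuous F) (hF0 : ∀ x, 0 ≤ F x) (hper : Function.Periodic F (2 * Real.pi)) (a : ℝ) :
    ∫⁻ θ, ENNReal.ofReal (|W' θ| * F (W θ)) ∂circleMeasure ≤
      ENNReal.ofReal (|(n : ℝ)| * ∫ x in a..a + 2 * Real.pi, F x) := by
  have h1 : ∫⁻ θ, ENNReal.ofReal (|W' θ| * F (W θ)) ∂circleMeasure =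
      ∫⁻ x in W '' Ico 0 (2 * Real.pi), ENNReal.ofReal (F x) := by
    rw [lintegral_image_eq_lintegral_abs_deriv_mul measurableSet_Ico
      (fun x _ => (hW x).hasDerivWithinAt) hinj, circleMeasure,
      setLIntegral_congr (Ico_ae_eq_Ioc (μ := volume)).symm]
    simp only [ENNReal.ofReal_mul (abs_nonneg _)]
  rw [h1]
  refine (lintegral_mono_set hmaps.image_subset).trans ?_
  have h2 : ∫⁻ x in uIcc (W 0) (W (2 * Real.pi)), ENNReal.ofReal (F x) =
      ENNReal.ofReal (∫ x in uIoc (W 0) (W (2 * Real.pi)), F x) := by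
    rw [uIcc, setLIntegral_congr (Ioc_ae_eq_Icc (μ := volume)).symm,
      ← ofReal_integral_eq_lintegral_ofReal]
    · rfl
    · exact (hF.integrableOn_Icc).mono_set Ioc_subset_Icc_self
    · exact Filter.Eventually.of_forall hF0
  have h3 : ∫ x in W 0..W (2 * Real.pi), F x = n • ∫ x in W 0..W 0 + 2 * Real.pi, F x := by
    have : W (2 * Real.pi) = W 0 + n • (2 * Real.pi) := by rw [zsmul_eq_mul]; linarith
    rw [this]
    exact hper.intervalIntegral_add_zsmul_eq n _ fun _ _ => hF.intervalIntegrable _ _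
  have h4 : ∫ x in uIoc (W 0) (W (2 * Real.pi)), F x = |∫ x in W 0..W (2 * Real.pi), F x| := by
    rw [intervalIntegral.abs_intervalIntegral_eq, abs_of_nonneg]
    exact setIntegral_nonneg measurableSet_uIoc fun x _ => hF0 x
  rw [h2, h4, h3, zsmul_eq_mul, abs_mul, hper.intervalIntegral_add_eq (W 0) a, abs_of_nonneg
    (intervalIntegral.integral_nonneg (by linarith [Real.two_pi_pos]) fun x _ => hF0 x)]

/-- A periodic weight of size `1 / (|α - w| + ε)` for `w` close to `α`. -/
noncomputable def angularWeight (ε α w : ℝ) : ℝ :=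
  (Real.sqrt (Real.sin ((α - w) / 2) ^ 2 + ε ^ 2))⁻¹

theorem angularWeight_nonneg (ε α w : ℝ) : 0 ≤ angularWeight ε α w := by
  unfold angularWeight; positivity

theorem angularWeight_continuous {ε : ℝ} (hε : 0 < ε) (α : ℝ) : Continuous (angularWeight ε α) := by
  unfold angularWeight
  refine Continuous.inv₀ (by fun_prop) fun w => ?_
  positivity

theorem angularWeight_periodic (ε α : ℝ) :
    Function.Periodic (angularWeight ε α) (2 * Real.pi) := by
  intro w
  unfold angularWeight
  have : (α - (w + 2 * Real.pi)) / 2 = (α - w) / 2 - Real.pi := by ring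
  rw [this, Real.sin_sub_pi, neg_sq]

/-- On the period centred at `α` the chord bound `|sin(φ/2)| ≥ |φ|/π` reduces the weight to one with
an explicit `arsinh` primitive. -/
theorem integral_angularWeight_le {ε : ℝ} (hε : 0 < ε) (α : ℝ) :
    ∫ w in (α - Real.pi)..(α - Real.pi + 2 * Real.pi), angularWeight ε α w ≤
      2 * Real.pi * Real.arsinh (1 / ε) := by
  have hpi := Real.pi_pos
  have hd : ∀ w, HasDerivAt (fun w => Real.pi * Real.arsinh ((w - α) / (Real.pi * ε)))
      ((Real.sqrt (((w - α) / Real.pi) ^ 2 + ε ^ 2))⁻¹) w := by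
    intro w
    have h := (((hasDerivAt_id w).sub_const α).div_const (Real.pi * ε)).arsinh.const_mul Real.pi
    refine h.congr_deriv ?_
    have e : Real.sqrt (((w - α) / Real.pi) ^ 2 + ε ^ 2) =
        ε * Real.sqrt (1 + ((w - α) / (Real.pi * ε)) ^ 2) := by
      rw [← Real.sqrt_sq hε.le, ← Real.sqrt_mul (by positivity), Real.sqrt_sq hε.le]
      congr 1; field_simp; ring
    have : 0 < Real.sqrt (1 + ((w - α) / (Real.pi * ε)) ^ 2) := by positivity
    simp only [id, smul_eq_mul]
    rw [e]; field_simp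
  have hc : Continuous fun w => (Real.sqrt (((w - α) / Real.pi) ^ 2 + ε ^ 2))⁻¹ :=
    Continuous.inv₀ (by fun_prop) fun w => by positivity
  have hle := intervalIntegral.integral_mono_on (μ := volume) (a := α - Real.pi)
    (b := α - Real.pi + 2 * Real.pi) (f := angularWeight ε α)
    (g := fun w => (Real.sqrt (((w - α) / Real.pi) ^ 2 + ε ^ 2))⁻¹) (by linarith)
    ((angularWeight_continuous hε α).intervalIntegrable _ _) (hc.intervalIntegrable _ _) fun w hw => by
      unfold angularWeight
      refine inv_anti₀ (by positivity) (Real.sqrt_le_sqrt ?_)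
      have h1 : |w - α| / Real.pi ≤ |Real.sin ((α - w) / 2)| := by
        have hab : |w - α| ≤ Real.pi := abs_le.2 ⟨by linarith [hw.1], by linarith [hw.2]⟩
        have h2 := Real.mul_le_sin (x := |w - α| / 2) (by positivity) (by linarith)
        have h3 : Real.sin (|w - α| / 2) ≤ |Real.sin ((α - w) / 2)| := by
          rcases abs_cases (w - α) with ⟨h, -⟩ | ⟨h, -⟩
          · rw [h, ← abs_neg, ← Real.sin_neg]
            refine le_trans (le_of_eq ?_) (le_abs_self _)
            congr 1; ring
          · rw [h]
            refine le_trans (le_of_eq ?_) (le_abs_self _)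
            congr 1; ring
        refine le_trans (le_of_eq ?_) (h2.trans h3)
        ring
      have h4 := mul_self_le_mul_self (by positivity) h1
      have h5 : ((w - α) / Real.pi) ^ 2 = |w - α| / Real.pi * (|w - α| / Real.pi) := by
        rw [← sq, div_pow, div_pow, sq_abs]
      rw [h5]
      have h6 := abs_mul_abs_self (Real.sin ((α - w) / 2))
      nlinarith
  refine hle.trans (le_of_eq ?_)
  rw [intervalIntegral.integral_eq_sub_of_hasDerivAt (fun w _ => hd w) (hc.intervalIntegrable _ _)]
  have e1 : (α - Real.pi + 2 * Real.pi - α) / (Real.pi * ε) = 1 / ε := by field_simp; ring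
  have e2 : (α - Real.pi - α) / (Real.pi * ε) = -(1 / ε) := by field_simp; ring
  rw [e1, e2, Real.arsinh_neg]; ring

/-! ### A regularised reciprocal of `1 - z` -/

/-- The `C¹` function equal to `2 - x` for `x ≤ 1` and to `1 / x` for `x ≥ 1`. -/
noncomputable def cappedInv (x : ℝ) : ℝ := (max x 1)⁻¹ + (1 - min x 1)

/-- The bump `1 - x * cappedInv x`. -/
noncomputable def cappedBump (x : ℝ) : ℝ := 1 - x * cappedInv x

theorem cappedInv_of_le {x : ℝ} (h : x ≤ 1) : cappedInv x = 2 - x := by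
  rw [cappedInv, max_eq_right h, min_eq_left h]; norm_num; ring

theorem cappedInv_of_ge {x : ℝ} (h : 1 ≤ x) : cappedInv x = x⁻¹ := by
  rw [cappedInv, max_eq_left h, min_eq_right h]; ring

/-- The branch `2 - x` is the tangent line of `1/x` at `1`, so the one-sided derivatives agree
there. -/
theorem hasDerivAt_cappedInv (x : ℝ) : HasDerivAt cappedInv (-((max x 1) ^ 2)⁻¹) x := by
  have hl : ∀ y : ℝ, HasDerivAt (fun x : ℝ => 2 - x) (-1) y := fun y => by
    simpa using (hasDerivAt_id y).const_sub 2
  rcases lt_trichotomy x 1 with h | h | h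
  · rw [max_eq_right h.le]
    norm_num
    refine (hl x).congr_of_eventuallyEq ?_
    filter_upwards [Iio_mem_nhds h] with y hy using cappedInv_of_le (le_of_lt hy)
  · subst h
    have h1 : HasDerivWithinAt cappedInv (-((max (1 : ℝ) 1) ^ 2)⁻¹) (Iic 1) 1 := by
      norm_num
      exact (hl 1).hasDerivWithinAt.congr (fun y hy => cappedInv_of_le hy) (cappedInv_of_le le_rfl)
    have h2 : HasDerivWithinAt cappedInv (-((max (1 : ℝ) 1) ^ 2)⁻¹) (Ici 1) 1 := by
      have := (hasDerivAt_inv (x := (1 : ℝ)) one_ne_zero).hasDerivWithinAt (s := Ici 1)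
      rw [max_self]
      exact this.congr (fun y hy => cappedInv_of_ge hy) (cappedInv_of_ge le_rfl)
    have h3 := h1.union h2
    rwa [Iic_union_Ici, hasDerivWithinAt_univ] at h3
  · rw [max_eq_left h.le]
    refine (hasDerivAt_inv (by linarith)).congr_of_eventuallyEq ?_
    filter_upwards [Ioi_mem_nhds h] with y hy using cappedInv_of_ge (le_of_lt hy)

theorem contDiff_cappedInv : ContDiff ℝ 1 cappedInv := by
  rw [contDiff_one_iff_deriv]
  refine ⟨fun x => (hasDerivAt_cappedInv x).differentiableAt, ?_⟩
  rw [show deriv cappedInv = fun x => -((max x 1) ^ 2)⁻¹ from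
    funext fun x => (hasDerivAt_cappedInv x).deriv]
  refine Continuous.neg (Continuous.inv₀ (by fun_prop) fun x => ?_)
  have : 0 < max x 1 := lt_max_of_lt_right one_pos
  positivity

theorem cappedInv_pos {x : ℝ} : 0 < cappedInv x := by
  rcases le_total x 1 with h | h
  · rw [cappedInv_of_le h]; linarith
  · rw [cappedInv_of_ge h]; positivity

theorem cappedInv_le {x : ℝ} (hx : 0 ≤ x) : cappedInv x ≤ 4 / (1 + x) := by
  rw [le_div_iff₀ (by linarith)]
  rcases le_total x 1 with h | h
  · rw [cappedInv_of_le h]; nlinarith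
  · rw [cappedInv_of_ge h, inv_mul_le_iff₀ (by linarith)]; linarith

theorem mul_deriv_cappedInv_le {x : ℝ} (hx : 0 ≤ x) : x * ((max x 1) ^ 2)⁻¹ ≤ 2 / (1 + x) := by
  rw [← div_eq_mul_inv]
  rcases le_total x 1 with h | h
  · rw [max_eq_right h, div_le_div_iff₀ (by norm_num) (by linarith)]; nlinarith
  · rw [max_eq_left h, div_le_div_iff₀ (by positivity) (by linarith)]; nlinarith

theorem cappedBump_of_le {x : ℝ} (h : x ≤ 1) : cappedBump x = (1 - x) ^ 2 := by
  rw [cappedBump, cappedInv_of_le h]; ring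

theorem cappedBump_of_ge {x : ℝ} (h : 1 ≤ x) : cappedBump x = 0 := by
  rw [cappedBump, cappedInv_of_ge h, mul_inv_cancel₀ (by linarith), sub_self]

theorem cappedBump_nonneg (x : ℝ) : 0 ≤ cappedBump x := by
  rcases le_total x 1 with h | h
  · rw [cappedBump_of_le h]; positivity
  · rw [cappedBump_of_ge h]

/-- The regularisation `1 / (|1 - z|² + 1 / lam)` of `1 / |1 - z|²`. -/
noncomputable def regSqInv (lam : ℝ) (z : ℂ) : ℝ := (‖1 - z‖ ^ 2 + lam⁻¹)⁻¹

/-- A `C¹` function of `z ∈ ℂ` equal to `1 / (1 - z)` where `lam * |1 - z|² ≥ 1`. -/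
noncomputable def regInv (lam : ℝ) (z : ℂ) : ℂ :=
  ((lam * cappedInv (lam * ‖1 - z‖ ^ 2) : ℝ) : ℂ) * (starRingEnd ℂ) (1 - z)

theorem one_sub_mul_regInv (lam : ℝ) (z : ℂ) :
    (1 - z) * regInv lam z = 1 - (cappedBump (lam * ‖1 - z‖ ^ 2) : ℂ) := by
  have := Complex.mul_conj' (1 - z)
  rw [regInv, cappedBump]
  push_cast
  linear_combination (lam * cappedInv (lam * ‖1 - z‖ ^ 2) : ℂ) * this

theorem regSqInv_pos {lam : ℝ} (hl : 0 < lam) (z : ℂ) : 0 < regSqInv lam z := by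
  unfold regSqInv; positivity

theorem regSqInv_eq {lam : ℝ} (hl : 0 < lam) (z : ℂ) :
    regSqInv lam z = lam / (1 + lam * ‖1 - z‖ ^ 2) := by
  unfold regSqInv
  rw [inv_eq_one_div, div_eq_div_iff (by positivity) (by positivity)]
  field_simp; ring

theorem norm_mul_sqrt_regSqInv_le {lam : ℝ} (hl : 0 < lam) (z : ℂ) :
    ‖1 - z‖ * Real.sqrt (regSqInv lam z) ≤ 1 := by
  have h : ‖1 - z‖ = Real.sqrt (‖1 - z‖ ^ 2) := (Real.sqrt_sq (norm_nonneg _)).symm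
  rw [h, ← Real.sqrt_mul (by positivity)]
  refine Real.sqrt_le_one.2 ?_
  rw [regSqInv, ← div_eq_mul_inv, div_le_one (by positivity)]
  have : 0 < lam⁻¹ := by positivity
  linarith

theorem norm_regInv_le {lam : ℝ} (hl : 0 < lam) (z : ℂ) :
    ‖regInv lam z‖ ≤ 4 * Real.sqrt (regSqInv lam z) := by
  rw [regInv, norm_mul, Complex.norm_real, RCLike.norm_conj,
    Real.norm_of_nonneg (mul_nonneg hl.le cappedInv_pos.le)]
  have h1 := cappedInv_le (x := lam * ‖1 - z‖ ^ 2) (by positivity)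
  have h2 : lam * cappedInv (lam * ‖1 - z‖ ^ 2) ≤ 4 * regSqInv lam z := by
    rw [regSqInv_eq hl]
    refine (mul_le_mul_of_nonneg_left h1 hl.le).trans (le_of_eq ?_)
    ring
  have h3 := norm_mul_sqrt_regSqInv_le hl z
  have h4 := Real.mul_self_sqrt (regSqInv_pos hl z).le
  have h5 := Real.sqrt_nonneg (regSqInv lam z)
  calc _ ≤ 4 * regSqInv lam z * ‖1 - z‖ := by gcongr
    _ = 4 * Real.sqrt (regSqInv lam z) * (‖1 - z‖ * Real.sqrt (regSqInv lam z)) := by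
        rw [← h4]; ring_nf; rw [Real.sqrt_sq h5]; ring
    _ ≤ _ := mul_le_of_le_one_right (by positivity) h3

theorem contDiff_regInv (lam : ℝ) : ContDiff ℝ 1 (regInv lam) := by
  unfold regInv
  refine ContDiff.mul ?_ ?_
  · refine Complex.ofRealCLM.contDiff.comp (contDiff_const.mul (contDiff_cappedInv.comp ?_))
    exact contDiff_const.mul ((contDiff_const.sub contDiff_id).norm_sq ℝ)
  · exact Complex.conjCLE.contDiff.comp (contDiff_const.sub contDiff_id)

/-- A derivative costs one further power of `1/|1-z|`, regularised at scale `lam^{-1/2}`. Both terms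
of the product rule have size `lam / (1 + lam |1-z|²)`, and the constant is uniform in `lam`. -/
theorem exists_hasDerivAt_regInv {lam : ℝ} (hl : 0 < lam) {q : ℝ → ℂ} {q' : ℂ} {x : ℝ}
    (hq : HasDerivAt q q' x) :
    ∃ D, HasDerivAt (fun y => regInv lam (q y)) D x ∧ ‖D‖ ≤ 8 * ‖q'‖ * regSqInv lam (q x) := by
  have h1 : HasDerivAt (fun y => 1 - q y) (-q') x := hq.const_sub 1
  have h2 := (((hasDerivAt_cappedInv _).comp x ((h1.norm_sq).const_mul lam)).const_mul lam)
  have h3 := (h2.ofReal_comp).mul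
    ((Complex.conjCLE : ℂ →L[ℝ] ℂ).hasFDerivAt.comp_hasDerivAt x h1)
  refine ⟨_, h3, (norm_add_le _ _).trans ?_⟩
  simp only [Function.comp_apply, norm_mul, Complex.norm_real,
    ContinuousLinearEquiv.coe_coe, Complex.conjCLE_apply, RCLike.norm_conj, norm_neg, Real.norm_eq_abs]
  set d := ‖1 - q x‖ with hd
  have hd0 : 0 ≤ d := norm_nonneg _
  rw [abs_of_pos hl, abs_of_pos cappedInv_pos, abs_of_nonneg (a := ((max _ _) ^ 2)⁻¹)
    (by positivity), abs_two]
  have hi : |inner ℝ (1 - q x) (-q')| ≤ d * ‖q'‖ := by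
    simpa using abs_real_inner_le_norm (1 - q x) (-q')
  have hx : 0 ≤ lam * d ^ 2 := by positivity
  have b1 := cappedInv_le hx
  have b2 := mul_deriv_cappedInv_le hx
  have hR : regSqInv lam (q x) = lam / (1 + lam * d ^ 2) := regSqInv_eq hl _
  set M := ((max (lam * d ^ 2) 1) ^ 2)⁻¹ with hM
  have hM0 : 0 ≤ M := by positivity
  calc lam * (M * (lam * (2 * |inner ℝ (1 - q x) (-q')|))) * d +
        lam * cappedInv (lam * d ^ 2) * ‖q'‖
      ≤ lam * (M * (lam * (2 * (d * ‖q'‖)))) * d + lam * (4 / (1 + lam * d ^ 2)) * ‖q'‖ := by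
        gcongr
    _ = (2 * lam * ‖q'‖) * ((lam * d ^ 2) * M) + lam * (4 / (1 + lam * d ^ 2)) * ‖q'‖ := by ring
    _ ≤ (2 * lam * ‖q'‖) * (2 / (1 + lam * d ^ 2)) + lam * (4 / (1 + lam * d ^ 2)) * ‖q'‖ := by
        gcongr
    _ = 8 * ‖q'‖ * regSqInv lam (q x) := by rw [hR]; ring

/-- Where the bump is nonzero, `regSqInv` is at least `lam / 2`. Thus the leftover bump is of the
same type as the terms with a differentiated `regInv`. -/
theorem mul_cappedBump_le {lam : ℝ} (hl : 0 < lam) (z : ℂ) :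
    lam * cappedBump (lam * ‖1 - z‖ ^ 2) ≤
      if lam * ‖1 - z‖ ^ 2 < 1 then 2 * regSqInv lam z else 0 := by
  have h0 : 0 ≤ lam * ‖1 - z‖ ^ 2 := by positivity
  split_ifs with h
  · rw [cappedBump_of_le h.le, regSqInv_eq hl, mul_div_assoc', le_div_iff₀ (by linarith)]
    have h1 : (1 - lam * ‖1 - z‖ ^ 2) ^ 2 ≤ 1 := by nlinarith
    have h2 : (1 - lam * ‖1 - z‖ ^ 2) ^ 2 * (1 + lam * ‖1 - z‖ ^ 2) ≤ 2 := by nlinarith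
    nlinarith
  · rw [cappedBump_of_ge (not_lt.1 h), mul_zero]

/-! ### Radial integrals -/

/-- The radial integrals are all bounded by comparing the integrand with the derivative of an
explicit primitive; nonnegativity of that derivative supplies its integrability. -/
theorem setLIntegral_Ioc_le_of_hasDerivAt {f F F' : ℝ → ℝ} {a b : ℝ} (hab : a ≤ b)
    (hF : ∀ x ∈ Icc a b, HasDerivAt F (F' x) x) (h0 : ∀ x ∈ Ioc a b, 0 ≤ F' x)
    (hf : ∀ x ∈ Ioc a b, f x ≤ F' x) :
    ∫⁻ x in Ioc a b, ENNReal.ofReal (f x) ≤ ENNReal.ofReal (F b - F a) := by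
  have hcont : ContinuousOn F (Icc a b) := fun x hx => (hF x hx).continuousAt.continuousWithinAt
  have hint : IntegrableOn F' (Ioc a b) :=
    intervalIntegral.integrableOn_deriv_of_nonneg hcont (fun x hx => hF x (Ioo_subset_Icc_self hx))
      fun x hx => h0 x (Ioo_subset_Ioc_self hx)
  calc ∫⁻ x in Ioc a b, ENNReal.ofReal (f x) ≤ ∫⁻ x in Ioc a b, ENNReal.ofReal (F' x) :=
        setLIntegral_mono' measurableSet_Ioc fun x hx => ENNReal.ofReal_le_ofReal (hf x hx)
    _ = ENNReal.ofReal (∫ x in Ioc a b, F' x) :=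
        (ofReal_integral_eq_lintegral_ofReal hint
          ((ae_restrict_iff' measurableSet_Ioc).2 (Filter.Eventually.of_forall h0))).symm
    _ = ENNReal.ofReal (F b - F a) := by
        rw [← intervalIntegral.integral_of_le hab, intervalIntegral.integral_eq_sub_of_hasDerivAt
          (by rwa [uIcc_of_le hab]) ((intervalIntegrable_iff_integrableOn_Ioc_of_le hab).2 hint)]

theorem setLIntegral_Ioi_le_of_hasDerivAt {f F F' : ℝ → ℝ} {a l : ℝ}
    (hF : ∀ x ∈ Ici a, HasDerivAt F (F' x) x) (h0 : ∀ x ∈ Ioi a, 0 ≤ F' x)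
    (hl : Filter.Tendsto F Filter.atTop (nhds l)) (hf : ∀ x ∈ Ioi a, f x ≤ F' x) :
    ∫⁻ x in Ioi a, ENNReal.ofReal (f x) ≤ ENNReal.ofReal (l - F a) := by
  have hint : IntegrableOn F' (Ioi a) := integrableOn_Ioi_deriv_of_nonneg' hF h0 hl
  calc ∫⁻ x in Ioi a, ENNReal.ofReal (f x) ≤ ∫⁻ x in Ioi a, ENNReal.ofReal (F' x) :=
        setLIntegral_mono' measurableSet_Ioi fun x hx => ENNReal.ofReal_le_ofReal (hf x hx)
    _ = ENNReal.ofReal (∫ x in Ioi a, F' x) :=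
        (ofReal_integral_eq_lintegral_ofReal hint
          ((ae_restrict_iff' measurableSet_Ioi).2 (Filter.Eventually.of_forall h0))).symm
    _ = ENNReal.ofReal (l - F a) := by rw [integral_Ioi_of_hasDerivAt_of_nonneg' hF h0 hl]

theorem japaneseBracket_sq (r : ℝ) : japaneseBracket r ^ 2 = 1 + r ^ 2 :=
  Real.sq_sqrt (by positivity)

theorem one_le_japaneseBracket (r : ℝ) : 1 ≤ japaneseBracket r :=
  Real.one_le_sqrt.2 (by nlinarith [sq_nonneg r])

theorem japaneseBracket_pos (r : ℝ) : 0 < japaneseBracket r :=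
  one_pos.trans_le (one_le_japaneseBracket r)

theorem le_japaneseBracket (r : ℝ) : r ≤ japaneseBracket r :=
  Real.le_sqrt_of_sq_le (by linarith)

theorem japaneseBracket_rpow_le {s : ℝ} (hs : 2 ≤ s) (r : ℝ) :
    japaneseBracket r ^ (-s) ≤ (1 + r ^ 2)⁻¹ := by
  rw [← japaneseBracket_sq, ← Real.rpow_natCast, ← Real.rpow_neg (japaneseBracket_pos r).le]
  exact Real.rpow_le_rpow_of_exponent_le (one_le_japaneseBracket r) (by push_cast; linarith)

theorem add_one_sq_le_exp {p c : ℝ} (hp : 0 ≤ p) (hc : 1 ≤ c) :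
    (1 + p) ^ 2 ≤ c ^ 2 * Real.exp (2 * (p / c)) := by
  have h := Real.add_one_le_exp (p / c)
  have h2 : 1 + p ≤ c * Real.exp (p / c) := by
    have : c * (p / c + 1) = p + c := by field_simp
    nlinarith
  have h3 : Real.exp (2 * (p / c)) = Real.exp (p / c) ^ 2 := by
    rw [← Real.exp_nat_mul]; push_cast; rfl
  rw [h3, ← mul_pow]
  gcongr

/-- Replacing `⟨r⟩^{-p}` by `R^{-p}` for `r ≥ R/2` naively costs `2^p`, which would make the
constants depend on `β`. If the two powers differ by more than a factor `2`, then `⟨r⟩` is below `R`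
by a relative amount of order at least `1/p`. In that case `X ≤ (1+p)²`, and the exponential
smallness of `⟨r⟩^{-p}` in `p` absorbs this polynomial. The second bound gains `1/R` close to `r =
R`. -/
theorem japaneseBracket_rpow_mul_le {p r R X : ℝ} (hp : 0 < p) (hR : 0 < R) (hr : R / 2 ≤ r)
    (hX : 0 ≤ X) (hX1 : X * (1 - (r / R) ^ 2) ^ 2 ≤ 1) :
    japaneseBracket r ^ (-p) * X ≤ 2048 * (R ^ (-p) * X + 1) ∧
    (|1 - (r / R) ^ 2| < 1 / 4 →
      japaneseBracket r ^ (-p) * X ≤ 2048 * (R ^ (-p) * X + R⁻¹)) := by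
  set J := japaneseBracket r with hJ
  have hJ0 : 0 < J := japaneseBracket_pos r
  have hJp : 0 < J ^ p := Real.rpow_pos_of_pos hJ0 p
  have hRp : 0 < R ^ p := Real.rpow_pos_of_pos hR p
  have hr0 : 0 < r := by linarith
  have hRX : 0 ≤ R ^ (-p) * X := by positivity
  rcases le_or_gt (R ^ p / 2) (J ^ p) with h | h
  · have h1 : J ^ (-p) ≤ 2 * R ^ (-p) := by
      rw [Real.rpow_neg hJ0.le, Real.rpow_neg hR.le, ← div_eq_mul_inv, inv_eq_one_div,
        div_le_div_iff₀ hJp hRp]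
      linarith
    have h2 : J ^ (-p) * X ≤ 2 * R ^ (-p) * X := by gcongr
    have hRi : 0 ≤ R⁻¹ := by positivity
    exact ⟨by linarith, fun _ => by linarith⟩
  · have hJR : J < R := by
      by_contra hcon
      have := Real.rpow_le_rpow hR.le (not_lt.1 hcon) hp.le
      linarith
    -- The logarithmic gap between `⟨r⟩` and `R`; in this case `p * y > log 2`.
    set y := Real.log (R / J) with hy
    have hy0 : 0 < y := Real.log_pos ((one_lt_div hJ0).2 hJR)
    have hey : Real.exp y = R / J := Real.exp_log (by positivity)
    have hpy : Real.log 2 < p * y := by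
      rw [hy, ← Real.log_rpow (by positivity), Real.div_rpow hR.le hJ0.le]
      refine Real.log_lt_log two_pos ?_
      rw [lt_div_iff₀ hJp]; linarith
    have hlog2 : 0.69 < Real.log 2 := by have := Real.log_two_gt_d9; linarith
    have hd : 2 * y / (1 + 2 * y) ≤ 1 - (r / R) ^ 2 := by
      have h1 : 1 + 2 * y ≤ (R / J) ^ 2 := by
        have := Real.add_one_le_exp (2 * y)
        have e : Real.exp (2 * y) = (R / J) ^ 2 := by
          rw [← hey, ← Real.exp_nat_mul]; push_cast; rfl
        linarith
      have h2 : (r / R) ^ 2 ≤ (1 + 2 * y)⁻¹ := by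
        rw [le_inv_comm₀ (by positivity) (by positivity)]
        refine h1.trans ?_
        rw [← inv_pow, inv_div]
        have : r ≤ J := le_japaneseBracket r
        gcongr
      have h3 : 2 * y / (1 + 2 * y) = 1 - (1 + 2 * y)⁻¹ := by field_simp; ring
      linarith
    have hXp : X ≤ (1 + p) ^ 2 := by
      have h1 : 1 / (1 + p) ≤ 1 - (r / R) ^ 2 := by
        refine le_trans ?_ hd
        rw [div_le_div_iff₀ (by positivity) (by positivity)]
        nlinarith
      have h2 : X * (1 / (1 + p)) ^ 2 ≤ 1 := by
        refine le_trans ?_ hX1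
        gcongr
      rwa [div_pow, one_pow, mul_one_div, div_le_one (by positivity)] at h2
    -- From `J < R ≤ 2r` and `J² = 1 + r²` follows `J² ≥ 4/3`, so negative powers of `J` decay
    -- exponentially in the exponent.
    have hlogJ : 1 / 8 ≤ Real.log J := by
      have h1 : 4 / 3 ≤ J ^ 2 := by
        have h2 := japaneseBracket_sq r
        have : J ≤ 2 * r := by linarith
        nlinarith
      have h2 := Real.one_sub_inv_le_log_of_pos (x := J ^ 2) (by positivity)
      have h3 : (J ^ 2)⁻¹ ≤ 3 / 4 := by
        rw [inv_le_comm₀ (by positivity) (by norm_num)]; linarith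
      rw [Real.log_pow] at h2
      push_cast at h2
      linarith
    constructor
    · have h1 : J ^ (-p) ≤ Real.exp (-(2 * (p / 16))) := by
        rw [Real.rpow_def_of_pos hJ0]
        refine Real.exp_le_exp.2 ?_
        nlinarith
      have h2 := add_one_sq_le_exp hp.le (c := 16) (by norm_num)
      have h3 : J ^ (-p) * X ≤ Real.exp (-(2 * (p / 16))) * (16 ^ 2 * Real.exp (2 * (p / 16))) := by
        gcongr; exact hXp.trans h2
      have h4 : Real.exp (-(2 * (p / 16))) * Real.exp (2 * (p / 16)) = 1 := by
        rw [← Real.exp_add]; simp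
      nlinarith
    · intro hd4
      -- Close to `r = R` the gap `y` is small, which forces `p > 4`; one factor `J` can then be
      -- spent to produce `1/R`.
      have hy6 : y < 1 / 6 := by
        have h1 := hd.trans_lt ((le_abs_self _).trans_lt hd4)
        rw [div_lt_div_iff₀ (by positivity) (by norm_num)] at h1
        linarith
      have hp4 : 4 < p := by nlinarith
      have h1 : J ^ (1 - p) ≤ Real.exp (-(2 * (p / 32))) := by
        rw [Real.rpow_def_of_pos hJ0]
        refine Real.exp_le_exp.2 ?_
        nlinarith
      have h2 := add_one_sq_le_exp hp.le (c := 32) (by norm_num)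
      have h3 : J ^ (1 - p) * X ≤
          Real.exp (-(2 * (p / 32))) * (32 ^ 2 * Real.exp (2 * (p / 32))) := by
        gcongr; exact hXp.trans h2
      have h4 : Real.exp (-(2 * (p / 32))) * Real.exp (2 * (p / 32)) = 1 := by
        rw [← Real.exp_add]; simp
      have h5 : J ^ (1 - p) = J * J ^ (-p) := by
        rw [sub_eq_add_neg, Real.rpow_add hJ0, Real.rpow_one]
      have h6 : R ≤ 2 * J := by linarith [le_japaneseBracket r]
      have h7 : J ^ (-p) * X * R ≤ 2048 := by
        have h8 : 0 ≤ J ^ (-p) * X := by positivity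
        have : J ^ (-p) * X * R ≤ J ^ (-p) * X * (2 * J) := by gcongr
        nlinarith
      have h8 : J ^ (-p) * X ≤ 2048 * R⁻¹ := by
        rw [← div_eq_mul_inv, le_div_iff₀ hR]; exact h7
      linarith

section Radial

variable {lam R σ : ℝ} {q : ℝ → ℂ}

theorem regSqInv_mul_le (hl : 0 < lam) {r : ℝ}
    (hq : ‖1 - q r‖ ^ 2 = (1 - (r / R) ^ 2) ^ 2 + 4 * (r / R) ^ 2 * σ ^ 2) :
    regSqInv lam (q r) * (1 - (r / R) ^ 2) ^ 2 ≤ 1 := by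
  rw [regSqInv, inv_mul_le_iff₀ (by positivity), hq]
  have : 0 < lam⁻¹ := by positivity
  have : 0 ≤ 4 * (r / R) ^ 2 * σ ^ 2 := by positivity
  linarith

theorem regSqInv_le_near (hl : 0 < lam) (hR : 0 < R) {r : ℝ} (hr : R / 2 ≤ r)
    (hq : ‖1 - q r‖ ^ 2 = (1 - (r / R) ^ 2) ^ 2 + 4 * (r / R) ^ 2 * σ ^ 2) :
    regSqInv lam (q r) ≤ ((r / R - 1) ^ 2 + (σ ^ 2 + lam⁻¹))⁻¹ := by
  have hl' : 0 < lam⁻¹ := by positivity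
  rw [regSqInv, hq]
  refine inv_anti₀ (by positivity) ?_
  have ht : 1 / 2 ≤ r / R := by rw [div_le_div_iff₀ two_pos hR]; linarith
  have h1 : (r / R - 1) ^ 2 ≤ (1 - (r / R) ^ 2) ^ 2 := by
    have : (1 - (r / R) ^ 2) ^ 2 = (r / R - 1) ^ 2 * (1 + r / R) ^ 2 := by ring
    rw [this]
    refine le_mul_of_one_le_right (sq_nonneg _) ?_
    nlinarith
  have h2 : σ ^ 2 ≤ 4 * (r / R) ^ 2 * σ ^ 2 := by
    refine le_mul_of_one_le_left (sq_nonneg _) ?_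
    nlinarith
  linarith

theorem regSqInv_le_inner (hl : 0 < lam) (hR : 0 < R) {r : ℝ} (hr0 : 0 < r) (hr : r ≤ R / 2)
    (hq : ‖1 - q r‖ ^ 2 = (1 - (r / R) ^ 2) ^ 2 + 4 * (r / R) ^ 2 * σ ^ 2) :
    regSqInv lam (q r) ≤ 2 := by
  have h := regSqInv_mul_le hl hq
  have h0 := (regSqInv_pos hl (q r)).le
  have ht : r / R ≤ 1 / 2 := by rw [div_le_div_iff₀ hR two_pos]; linarith
  have ht0 : 0 ≤ r / R := by positivity
  have h1 : 3 / 4 ≤ 1 - (r / R) ^ 2 := by nlinarith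
  have h2 : 1 / 2 ≤ (1 - (r / R) ^ 2) ^ 2 := by nlinarith
  nlinarith

theorem regSqInv_le_outer (hl : 0 < lam) (hR : 0 < R) {r : ℝ} (hr : 2 * R ≤ r)
    (hq : ‖1 - q r‖ ^ 2 = (1 - (r / R) ^ 2) ^ 2 + 4 * (r / R) ^ 2 * σ ^ 2) :
    regSqInv lam (q r) * (r / R) ^ 4 ≤ 2 := by
  have h := regSqInv_mul_le hl hq
  have h0 := (regSqInv_pos hl (q r)).le
  have ht : 2 ≤ r / R := by rw [le_div_iff₀ hR]; linarith
  have h1 : 3 / 4 * (r / R) ^ 2 ≤ (r / R) ^ 2 - 1 := by nlinarith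
  have h2 : (r / R) ^ 4 ≤ 2 * (1 - (r / R) ^ 2) ^ 2 := by nlinarith [sq_nonneg (r / R)]
  nlinarith

theorem mul_inv_one_add_sq_le {r : ℝ} (hr : 0 < r) : r * (1 + r ^ 2)⁻¹ ≤ r⁻¹ := by
  rw [← div_eq_mul_inv, inv_eq_one_div, div_le_div_iff₀ (by positivity) hr]; nlinarith

theorem hasDerivAt_neg_sq_div_sq (R : ℝ) {r : ℝ} (hr : 0 < r) :
    HasDerivAt (fun x : ℝ => -(R ^ 2 / x ^ 2)) (2 * R ^ 2 / r ^ 3) r := by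
  have h := (((hasDerivAt_pow 2 r).inv (by positivity)).const_mul (R ^ 2)).neg
  refine (h.congr_of_eventuallyEq (Filter.Eventually.of_forall fun x => ?_)).congr_deriv ?_
  · simp [div_eq_mul_inv]
  · field_simp; push_cast; ring

theorem tendsto_neg_sq_div_sq (R : ℝ) :
    Filter.Tendsto (fun x : ℝ => -(R ^ 2 / x ^ 2)) Filter.atTop (nhds 0) := by
  have := (Filter.Tendsto.const_div_atTop (Filter.tendsto_pow_atTop (α := ℝ) two_ne_zero)
    (R ^ 2)).neg
  simpa using this

theorem lintegral_Ioi_le_three {f : ℝ → ℝ≥0∞} {a b : ℝ} (ha : 0 ≤ a) (hab : a ≤ b) :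
    ∫⁻ r in Ioi (0 : ℝ), f r ≤
      (∫⁻ r in Ioc 0 a, f r) + ((∫⁻ r in Ioc a b, f r) + ∫⁻ r in Ioi b, f r) := by
  rw [← Ioc_union_Ioi_eq_Ioi ha]
  refine (lintegral_union_le _ _ _).trans ?_
  gcongr
  rw [← Ioc_union_Ioi_eq_Ioi hab]
  exact lintegral_union_le _ _ _

/-- Three regions. For `r ≤ R/2` the factor `|1-q|⁻¹` is bounded and the weight `r/(1+r²)` gives
`log(2+R)`. For `R/2 < r ≤ 2R` the regularised singularity of `|1-q|⁻¹` at `r = R` gives `arsinh`.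
Beyond `2R` the decay of `1/q` makes the integral bounded. The angular separation `σ` is not needed.
-/
theorem lintegral_sqrt_regSqInv_le {s : ℝ} (hs : 2 ≤ s) (hl : 0 < lam) (hR : 0 < R)
    (hq : ∀ r > 0, ‖1 - q r‖ ^ 2 = (1 - (r / R) ^ 2) ^ 2 + 4 * (r / R) ^ 2 * σ ^ 2) :
    ∫⁻ r in Ioi (0 : ℝ), ENNReal.ofReal
      (r * japaneseBracket r ^ (-s) * Real.sqrt (regSqInv lam (q r))) ≤
    ENNReal.ofReal (2 * Real.log (2 + R) + 4 * Real.arsinh (Real.sqrt lam) + 1 / 4) := by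
  have hw : ∀ r > 0, r * japaneseBracket r ^ (-s) ≤ r * (1 + r ^ 2)⁻¹ := fun r hr =>
    mul_le_mul_of_nonneg_left (japaneseBracket_rpow_le hs r) hr.le
  have hsl : 0 < Real.sqrt lam := Real.sqrt_pos.2 hl
  have har : 0 ≤ Real.arsinh (Real.sqrt lam) := Real.arsinh_nonneg_iff.2 hsl.le
  have p1 : ∫⁻ r in Ioc 0 (R / 2), ENNReal.ofReal
      (r * japaneseBracket r ^ (-s) * Real.sqrt (regSqInv lam (q r))) ≤
      ENNReal.ofReal (2 * Real.log (2 + R)) := by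
    refine (setLIntegral_Ioc_le_of_hasDerivAt (F := fun x => Real.log (1 + x ^ 2))
      (F' := fun x => 2 * x / (1 + x ^ 2)) (by positivity) (fun x _ => ?_) (fun x hx => ?_)
      fun x hx => ?_).trans (ENNReal.ofReal_le_ofReal ?_)
    · have := (((hasDerivAt_pow 2 x).const_add 1).log (by positivity))
      simpa using this
    · have := hx.1; positivity
    · have h1 := regSqInv_le_inner hl hR hx.1 hx.2 (hq x hx.1)
      have h2 : Real.sqrt (regSqInv lam (q x)) ≤ 2 := by
        rw [Real.sqrt_le_left (by norm_num)]; linarith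
      have hx0 : 0 < x := hx.1
      calc _ ≤ x * (1 + x ^ 2)⁻¹ * 2 :=
            mul_le_mul (hw x hx.1) h2 (Real.sqrt_nonneg _) (by positivity)
        _ = _ := by ring
    · have : (2 : ℝ) * Real.log (2 + R) = Real.log ((2 + R) ^ 2) := by
        rw [Real.log_pow]; push_cast; rfl
      rw [this]
      simp only [ne_eq, OfNat.ofNat_ne_zero, not_false_eq_true, zero_pow, add_zero, Real.log_one,
        sub_zero]
      refine Real.log_le_log (by positivity) (by nlinarith)
  have p2 : ∫⁻ r in Ioc (R / 2) (2 * R), ENNReal.ofReal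
      (r * japaneseBracket r ^ (-s) * Real.sqrt (regSqInv lam (q r))) ≤
      ENNReal.ofReal (4 * Real.arsinh (Real.sqrt lam)) := by
    refine (setLIntegral_Ioc_le_of_hasDerivAt
      (F := fun x => 2 * Real.arsinh ((x / R - 1) * Real.sqrt lam))
      (F' := fun x => 2 / R * (Real.sqrt ((x / R - 1) ^ 2 + lam⁻¹))⁻¹) (by linarith)
      (fun x _ => ?_) (fun x hx => by positivity)
      fun x hx => ?_).trans (ENNReal.ofReal_le_ofReal ?_)
    · have h := ((((hasDerivAt_id x).div_const R).sub_const 1).mul_const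
        (Real.sqrt lam)).arsinh.const_mul 2
      refine h.congr_deriv ?_
      simp only [id, smul_eq_mul]
      have e : Real.sqrt (1 + ((x / R - 1) * Real.sqrt lam) ^ 2) =
          Real.sqrt lam * Real.sqrt ((x / R - 1) ^ 2 + lam⁻¹) := by
        rw [← Real.sqrt_mul hl.le, mul_pow, Real.sq_sqrt hl.le]
        congr 1; field_simp; ring
      have h0 : 0 < Real.sqrt ((x / R - 1) ^ 2 + lam⁻¹) := by positivity
      rw [e]; field_simp
    · have hx0 : 0 < x := by have := hx.1; linarith
      have h1 := regSqInv_le_near hl hR hx.1.le (hq x hx0)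
      have h2 : Real.sqrt (regSqInv lam (q x)) ≤ (Real.sqrt ((x / R - 1) ^ 2 + lam⁻¹))⁻¹ := by
        rw [← Real.sqrt_inv]
        refine Real.sqrt_le_sqrt (h1.trans (inv_anti₀ (by positivity) ?_))
        nlinarith [sq_nonneg σ]
      have h3 : x * japaneseBracket x ^ (-s) ≤ 2 / R := by
        refine ((hw x hx0).trans (mul_inv_one_add_sq_le hx0)).trans ?_
        rw [inv_eq_one_div, div_le_div_iff₀ hx0 hR]; linarith [hx.1]
      exact mul_le_mul h3 h2 (Real.sqrt_nonneg _) (by positivity)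
    · have e1 : (2 * R / R - 1) * Real.sqrt lam = Real.sqrt lam := by field_simp; ring
      have e2 : (R / 2 / R - 1) * Real.sqrt lam = -(Real.sqrt lam / 2) := by field_simp; ring
      rw [e1, e2, Real.arsinh_neg]
      have := Real.arsinh_le_arsinh.2 (show Real.sqrt lam / 2 ≤ Real.sqrt lam by linarith)
      linarith
  have p3 : ∫⁻ r in Ioi (2 * R), ENNReal.ofReal
      (r * japaneseBracket r ^ (-s) * Real.sqrt (regSqInv lam (q r))) ≤ ENNReal.ofReal (1 / 4) := by
    refine (setLIntegral_Ioi_le_of_hasDerivAt (F := fun x => -(R ^ 2 / x ^ 2))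
      (F' := fun x => 2 * R ^ 2 / x ^ 3) (fun x hx => hasDerivAt_neg_sq_div_sq R ?_)
      (fun x hx => ?_) (tendsto_neg_sq_div_sq R) fun x hx => ?_).trans
      (ENNReal.ofReal_le_ofReal ?_)
    · have : 2 * R ≤ x := hx
      linarith
    · have : 2 * R < x := hx
      have : 0 < x := by linarith
      positivity
    · have hx2 : 2 * R < x := hx
      have hx0 : 0 < x := by linarith
      have h1 := regSqInv_le_outer hl hR hx2.le (hq x hx0)
      have h2 : Real.sqrt (regSqInv lam (q x)) ≤ 2 * (R / x) ^ 2 := by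
        rw [Real.sqrt_le_left (by positivity)]
        have e : (2 * (R / x) ^ 2) ^ 2 = 4 / (x / R) ^ 4 := by field_simp; ring
        rw [e, le_div_iff₀ (by positivity)]; linarith
      calc _ ≤ x⁻¹ * (2 * (R / x) ^ 2) :=
            mul_le_mul ((hw x hx0).trans (mul_inv_one_add_sq_le hx0)) h2 (Real.sqrt_nonneg _)
              (by positivity)
        _ = _ := by field_simp
    · have : R ^ 2 / (2 * R) ^ 2 = 1 / 4 := by field_simp; norm_num
      simp only [this]; norm_num
  have hlog : 0 ≤ Real.log (2 + R) := Real.log_nonneg (by linarith)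
  refine (lintegral_Ioi_le_three (a := R / 2) (b := 2 * R) (by positivity) (by linarith)).trans ?_
  rw [add_assoc (2 * _), ENNReal.ofReal_add (by positivity) (by positivity),
    ENNReal.ofReal_add (by positivity) (by positivity)]
  gcongr

/-- Only the region `R/2 < r ≤ 2R` is singular. There `|1-q|⁻²` is a Lorentzian peak in `r/R` of
width `(σ² + 1/lam)^{1/2}`, whose integral is of order `R` over the width, and the weight at the
peak is of order `R^{1-2β}`. -/
theorem lintegral_regSqInv_le {β : ℝ} (hβ : 1 / 2 < β) (hl : 16 ≤ lam) (hR : 0 < R)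
    (hq : ∀ r > 0, ‖1 - q r‖ ^ 2 = (1 - (r / R) ^ 2) ^ 2 + 4 * (r / R) ^ 2 * σ ^ 2) :
    ∫⁻ r in Ioi (0 : ℝ), ENNReal.ofReal
      (r * japaneseBracket r ^ (-(2 * β + 1)) * (r / R) ^ 2 * regSqInv lam (q r) +
        japaneseBracket r ^ (-(2 * β + 1)) * R ^ 2 *
          (if lam * ‖1 - q r‖ ^ 2 < 1 then regSqInv lam (q r) else 0)) ≤
    ENNReal.ofReal (40000 +
      16384 * Real.pi * (R ^ (2 - 2 * β) * (Real.sqrt (σ ^ 2 + lam⁻¹))⁻¹)) := by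
  have hl0 : 0 < lam := by linarith
  have hw : ∀ r > 0, r * japaneseBracket r ^ (-(2 * β + 1)) ≤ r⁻¹ := fun r hr =>
    (mul_le_mul_of_nonneg_left (japaneseBracket_rpow_le (by linarith) r) hr.le).trans
      (mul_inv_one_add_sq_le hr)
  -- Here `lam ≥ 16` keeps the bump away from both the inner and the outer region.
  have hsupp : ∀ r > 0, lam * ‖1 - q r‖ ^ 2 < 1 → |1 - (r / R) ^ 2| < 1 / 4 := by
    intro r hr h
    rw [hq r hr] at h
    refine abs_lt_of_sq_lt_sq ?_ (by norm_num)
    have : 0 ≤ 4 * (r / R) ^ 2 * σ ^ 2 := by positivity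
    nlinarith [sq_nonneg (1 - (r / R) ^ 2)]
  set S := Real.sqrt (σ ^ 2 + lam⁻¹) with hS
  have hl' : 0 < lam⁻¹ := by positivity
  have hS0 : 0 < S := Real.sqrt_pos.2 (by positivity)
  have hS2 : S ^ 2 = σ ^ 2 + lam⁻¹ := Real.sq_sqrt (by positivity)
  have p1 : ∫⁻ r in Ioc 0 (R / 2), ENNReal.ofReal
      (r * japaneseBracket r ^ (-(2 * β + 1)) * (r / R) ^ 2 * regSqInv lam (q r) +
        japaneseBracket r ^ (-(2 * β + 1)) * R ^ 2 *
          (if lam * ‖1 - q r‖ ^ 2 < 1 then regSqInv lam (q r) else 0)) ≤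
      ENNReal.ofReal (1 / 4) := by
    refine (setLIntegral_Ioc_le_of_hasDerivAt (F := fun x => x ^ 2 / R ^ 2)
      (F' := fun x => 2 * x / R ^ 2) (by positivity) (fun x _ => ?_) (fun x hx => ?_)
      fun x hx => ?_).trans (ENNReal.ofReal_le_ofReal (le_of_eq ?_))
    · simpa using (hasDerivAt_pow 2 x).div_const (R ^ 2)
    · have := hx.1; positivity
    · have hx0 : 0 < x := hx.1
      have ht : x / R ≤ 1 / 2 := by rw [div_le_div_iff₀ hR two_pos]; linarith [hx.2]
      have ht0 : 0 ≤ x / R := by positivity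
      rw [if_neg, mul_zero, add_zero]
      · calc _ ≤ x⁻¹ * (x / R) ^ 2 * 2 :=
              mul_le_mul (mul_le_mul_of_nonneg_right (hw x hx0) (by positivity))
                (regSqInv_le_inner hl0 hR hx0 hx.2 (hq x hx0)) (regSqInv_pos hl0 _).le
                (by positivity)
          _ = _ := by field_simp
      · intro h
        have := (abs_lt.1 (hsupp x hx0 h)).2
        nlinarith
    · field_simp; norm_num
  have p3 : ∫⁻ r in Ioi (2 * R), ENNReal.ofReal
      (r * japaneseBracket r ^ (-(2 * β + 1)) * (r / R) ^ 2 * regSqInv lam (q r) +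
        japaneseBracket r ^ (-(2 * β + 1)) * R ^ 2 *
          (if lam * ‖1 - q r‖ ^ 2 < 1 then regSqInv lam (q r) else 0)) ≤
      ENNReal.ofReal (1 / 4) := by
    refine (setLIntegral_Ioi_le_of_hasDerivAt (F := fun x => -(R ^ 2 / x ^ 2))
      (F' := fun x => 2 * R ^ 2 / x ^ 3) (fun x hx => hasDerivAt_neg_sq_div_sq R ?_)
      (fun x hx => ?_) (tendsto_neg_sq_div_sq R) fun x hx => ?_).trans
      (ENNReal.ofReal_le_ofReal ?_)
    · have : 2 * R ≤ x := hx
      linarith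
    · have : 2 * R < x := hx
      have : 0 < x := by linarith
      positivity
    · have hx2 : 2 * R < x := hx
      have hx0 : 0 < x := by linarith
      have ht : 2 ≤ x / R := by rw [le_div_iff₀ hR]; linarith
      have h1 := regSqInv_le_outer hl0 hR hx2.le (hq x hx0)
      rw [if_neg, mul_zero, add_zero]
      · have h2 : regSqInv lam (q x) ≤ 2 * (R / x) ^ 4 := by
          have e : 2 * (R / x) ^ 4 = 2 / (x / R) ^ 4 := by field_simp
          rw [e, le_div_iff₀ (by positivity)]; exact h1
        calc _ ≤ x⁻¹ * (x / R) ^ 2 * (2 * (R / x) ^ 4) :=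
              mul_le_mul (mul_le_mul_of_nonneg_right (hw x hx0) (by positivity)) h2
                (regSqInv_pos hl0 _).le (by positivity)
          _ = _ := by field_simp
      · intro h
        have := (abs_lt.1 (hsupp x hx0 h)).1
        nlinarith
    · have : R ^ 2 / (2 * R) ^ 2 = 1 / 4 := by field_simp; norm_num
      simp only [this]; norm_num
  -- The constant is `8192 + 8192`, one share from each of the bounds `t1` and `t2` below; likewise
  -- `24576 = 16384 + 8192` multiplies `1/R`, and `36864` is `24576` times the length `3/2` of the
  -- range of `x / R`.
  set A := 16384 * R ^ (-(2 * β - 1)) with hA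
  have hA0 : 0 ≤ A := by positivity
  have p2 : ∫⁻ r in Ioc (R / 2) (2 * R), ENNReal.ofReal
      (r * japaneseBracket r ^ (-(2 * β + 1)) * (r / R) ^ 2 * regSqInv lam (q r) +
        japaneseBracket r ^ (-(2 * β + 1)) * R ^ 2 *
          (if lam * ‖1 - q r‖ ^ 2 < 1 then regSqInv lam (q r) else 0)) ≤
      ENNReal.ofReal (36864 + A * (R * (Real.pi * S⁻¹))) := by
    refine (setLIntegral_Ioc_le_of_hasDerivAt
      (F := fun x => A * (R * (Real.arctan ((x / R - 1) / S) / S)) + 24576 * (x / R))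
      (F' := fun x => A * ((x / R - 1) ^ 2 + S ^ 2)⁻¹ + 24576 / R) (by linarith)
      (fun x _ => ?_) (fun x hx => by positivity)
      fun x hx => ?_).trans (ENNReal.ofReal_le_ofReal ?_)
    · have h := ((((((((hasDerivAt_id x).div_const R).sub_const 1).div_const S).arctan).div_const
        S).const_mul R).const_mul A).add (((hasDerivAt_id x).div_const R).const_mul 24576)
      refine h.congr_deriv ?_
      simp only [id]
      field_simp
      ring
    · have hx0 : 0 < x := by have := hx.1; linarith
      set J := japaneseBracket x with hJ
      have hJ0 : 0 < J := japaneseBracket_pos x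
      set X := regSqInv lam (q x) with hX
      have hX0 : 0 < X := regSqInv_pos hl0 _
      have hXn : X ≤ ((x / R - 1) ^ 2 + S ^ 2)⁻¹ := by
        rw [hS2]; exact regSqInv_le_near hl0 hR hx.1.le (hq x hx0)
      obtain ⟨c1, c2⟩ := japaneseBracket_rpow_mul_le (p := 2 * β - 1) (by linarith) hR hx.1.le
        hX0.le (regSqInv_mul_le hl0 (hq x hx0))
      rw [← hJ] at c1 c2
      -- Two powers are split off to absorb `x` or `R²`, leaving the positive exponent `p = 2β - 1`
      -- of `japaneseBracket_rpow_mul_le`.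
      have hsplit : J ^ (-(2 * β + 1)) = (1 + x ^ 2)⁻¹ * J ^ (-(2 * β - 1)) := by
        rw [← japaneseBracket_sq, ← Real.rpow_natCast, ← hJ, ← Real.rpow_neg hJ0.le,
          ← Real.rpow_add hJ0]
        congr 1; push_cast; ring
      set P := R ^ (-(2 * β - 1)) with hP
      have hP0 : 0 < P := Real.rpow_pos_of_pos hR _
      have ht0 : 0 < x / R := by positivity
      have ht : (x / R) ^ 2 ≤ 4 := by
        have : x / R ≤ 2 := by rw [div_le_iff₀ hR]; exact hx.2
        nlinarith
      have hxR : x⁻¹ ≤ 2 / R := by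
        rw [inv_eq_one_div, div_le_div_iff₀ hx0 hR]; linarith [hx.1]
      have t1 : x * J ^ (-(2 * β + 1)) * (x / R) ^ 2 * X ≤ 8192 * (P * X) + 16384 / R := by
        have a1 : x * (1 + x ^ 2)⁻¹ ≤ 1 := by
          rw [← div_eq_mul_inv, div_le_one (by positivity)]; nlinarith [sq_nonneg (x - 1)]
        have a2 : x * (1 + x ^ 2)⁻¹ ≤ 2 / R := (mul_inv_one_add_sq_le hx0).trans hxR
        have a0 : 0 < x * (1 + x ^ 2)⁻¹ := by positivity
        calc _ = (x * (1 + x ^ 2)⁻¹) * (J ^ (-(2 * β - 1)) * X) * (x / R) ^ 2 := by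
              rw [hsplit]; ring
          _ ≤ (x * (1 + x ^ 2)⁻¹) * (2048 * (P * X + 1)) * 4 := by gcongr
          _ = 8192 * (P * X) * (x * (1 + x ^ 2)⁻¹) + 8192 * (x * (1 + x ^ 2)⁻¹) := by ring
          _ ≤ 8192 * (P * X) * 1 + 8192 * (2 / R) := by gcongr
          _ = _ := by ring
      have t2 : J ^ (-(2 * β + 1)) * R ^ 2 * (if lam * ‖1 - q x‖ ^ 2 < 1 then X else 0) ≤
          8192 * (P * X) + 8192 / R := by
        split_ifs with h
        · have a1 : (1 + x ^ 2)⁻¹ * R ^ 2 ≤ 4 := by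
            rw [inv_mul_le_iff₀ (by positivity)]
            have : R ≤ 2 * x := by linarith [hx.1]
            nlinarith
          have a2 := c2 (hsupp x hx0 h)
          calc _ = ((1 + x ^ 2)⁻¹ * R ^ 2) * (J ^ (-(2 * β - 1)) * X) := by rw [hsplit]; ring
            _ ≤ 4 * (2048 * (P * X + R⁻¹)) := by gcongr
            _ = _ := by rw [div_eq_mul_inv]; ring
        · rw [mul_zero]; positivity
      calc _ ≤ (8192 * (P * X) + 16384 / R) + (8192 * (P * X) + 8192 / R) := add_le_add t1 t2
        _ = A * X + 24576 / R := by rw [hA]; ring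
        _ ≤ _ := by gcongr
    · have e1 : 2 * R / R = 2 := by field_simp
      have e2 : R / 2 / R = 1 / 2 := by field_simp
      simp only [e1, e2]
      have b1 := (Real.arctan_lt_pi_div_two ((2 - 1) / S)).le
      have b2 := (Real.neg_pi_div_two_lt_arctan ((1 / 2 - 1) / S)).le
      have b3 : Real.arctan ((2 - 1) / S) / S - Real.arctan ((1 / 2 - 1) / S) / S ≤
          Real.pi * S⁻¹ := by
        rw [← sub_div, div_eq_mul_inv]
        gcongr
        linarith
      have b4 := mul_le_mul_of_nonneg_left (mul_le_mul_of_nonneg_left b3 hR.le) hA0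
      nlinarith
  refine (lintegral_Ioi_le_three (a := R / 2) (b := 2 * R) (by positivity) (by linarith)).trans ?_
  refine (add_le_add p1 (add_le_add p2 p3)).trans ?_
  have e : A * (R * (Real.pi * S⁻¹)) = 16384 * Real.pi * (R ^ (2 - 2 * β) * S⁻¹) := by
    have : R ^ (2 - 2 * β) = R ^ (-(2 * β - 1)) * R := by
      rw [← Real.rpow_add_one hR.ne']; congr 1; ring
    rw [this, hA]; ring
  rw [← e, ← ENNReal.ofReal_add (by positivity) (by norm_num),
    ← ENNReal.ofReal_add (by norm_num) (by positivity)]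
  refine ENNReal.ofReal_le_ofReal ?_
  linarith

end Radial

/-! ### Integration by parts in polar coordinates -/

instance : IsFiniteMeasure circleMeasure :=
  inferInstanceAs (IsFiniteMeasure (volume.restrict (Ioc 0 (2 * Real.pi))))

theorem polarMeasure_eq :
    polarMeasure = volume.restrict (Ioi (0 : ℝ) ×ˢ Ioc 0 (2 * Real.pi)) := by
  rw [polarMeasure, circleMeasure, Measure.prod_restrict, Measure.volume_eq_prod]

theorem ae_circleMeasure : ∀ᵐ θ ∂circleMeasure, θ ∈ Ioo 0 (2 * Real.pi) := by
  rw [circleMeasure, Measure.restrict_congr_set (Ioo_ae_eq_Ioc (μ := volume)).symm]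
  exact ae_restrict_mem measurableSet_Ioo

theorem ae_polarMeasure : ∀ᵐ p ∂polarMeasure, 0 < p.1 ∧ p.2 ∈ Ioo 0 (2 * Real.pi) := by
  have h : polarMeasure = volume.restrict (Ioi (0 : ℝ) ×ˢ Ioo 0 (2 * Real.pi)) := by
    rw [polarMeasure, circleMeasure, Measure.restrict_congr_set (Ioo_ae_eq_Ioc (μ := volume)).symm,
      Measure.prod_restrict, Measure.volume_eq_prod]
  rw [h]
  exact ae_restrict_mem (measurableSet_Ioi.prod measurableSet_Ioo)

theorem ContinuousOn.aestronglyMeasurable_polarMeasure {E : Type*} [NormedAddCommGroup E]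
    {f : ℝ × ℝ → E} (hf : ContinuousOn f (Ioi 0 ×ˢ univ)) :
    AEStronglyMeasurable f polarMeasure := by
  rw [polarMeasure_eq]
  exact (hf.mono (prod_mono_right (subset_univ _))).aestronglyMeasurable
    (measurableSet_Ioi.prod measurableSet_Ioc)

theorem integrable_polarMeasure_of_le {f : ℝ × ℝ → ℂ} {B : ℝ}
    (hf : ContinuousOn f (Ioi 0 ×ˢ univ))
    (hB : ∀ r > (0 : ℝ), ∀ θ ∈ Ioo 0 (2 * Real.pi), ‖f (r, θ)‖ ≤ B * (1 + r ^ 2)⁻¹) :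
    Integrable f polarMeasure := by
  have h1 : Integrable (fun p : ℝ × ℝ => B * (1 + p.1 ^ 2)⁻¹) polarMeasure := by
    have : Integrable (fun r : ℝ => B * (1 + r ^ 2)⁻¹) (volume.restrict (Ioi (0 : ℝ))) :=
      (integrable_inv_one_add_sq.const_mul B).restrict
    exact this.comp_fst _
  refine h1.mono' hf.aestronglyMeasurable_polarMeasure ?_
  filter_upwards [ae_polarMeasure] with p hp using hB p.1 hp.1 p.2 hp.2

section Partial

variable {F : ℝ → ℝ → ℂ}

theorem isOpen_halfPlane : IsOpen (Ioi (0 : ℝ) ×ˢ (univ : Set ℝ)) := isOpen_Ioi.prod isOpen_univ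

theorem hasDerivAt_radial_fderiv
    (hF : ContDiffOn ℝ 1 (fun p : ℝ × ℝ => F p.1 p.2) (Ioi 0 ×ˢ univ)) {r : ℝ} (hr : 0 < r) (θ : ℝ) :
    HasDerivAt (fun s => F s θ) (fderiv ℝ (fun p : ℝ × ℝ => F p.1 p.2) (r, θ) (1, 0)) r := by
  have h := (hF.contDiffAt (isOpen_halfPlane.mem_nhds (x := (r, θ)) ⟨hr, trivial⟩)).differentiableAt
    one_ne_zero
  exact h.hasFDerivAt.comp_hasDerivAt r ((hasDerivAt_id r).prodMk (hasDerivAt_const r θ))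

theorem hasDerivAt_angular_fderiv
    (hF : ContDiffOn ℝ 1 (fun p : ℝ × ℝ => F p.1 p.2) (Ioi 0 ×ˢ univ)) {r : ℝ} (hr : 0 < r) (θ : ℝ) :
    HasDerivAt (fun t => F r t) (fderiv ℝ (fun p : ℝ × ℝ => F p.1 p.2) (r, θ) (0, 1)) θ := by
  have h := (hF.contDiffAt (isOpen_halfPlane.mem_nhds (x := (r, θ)) ⟨hr, trivial⟩)).differentiableAt
    one_ne_zero
  exact h.hasFDerivAt.comp_hasDerivAt θ ((hasDerivAt_const θ r).prodMk (hasDerivAt_id θ))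

theorem continuousOn_radial_deriv
    (hF : ContDiffOn ℝ 1 (fun p : ℝ × ℝ => F p.1 p.2) (Ioi 0 ×ˢ univ)) :
    ContinuousOn (fun p : ℝ × ℝ => deriv (fun s => F s p.2) p.1) (Ioi 0 ×ˢ univ) := by
  refine ContinuousOn.congr
    (f := fun p => fderiv ℝ (fun p : ℝ × ℝ => F p.1 p.2) p (1, 0)) ?_ fun p hp =>
      (hasDerivAt_radial_fderiv hF hp.1 p.2).deriv
  exact (hF.continuousOn_fderiv_of_isOpen isOpen_halfPlane le_rfl).clm_apply continuousOn_const

theorem continuousOn_angular_deriv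
    (hF : ContDiffOn ℝ 1 (fun p : ℝ × ℝ => F p.1 p.2) (Ioi 0 ×ˢ univ)) :
    ContinuousOn (fun p : ℝ × ℝ => deriv (fun t => F p.1 t) p.2) (Ioi 0 ×ˢ univ) := by
  refine ContinuousOn.congr
    (f := fun p => fderiv ℝ (fun p : ℝ × ℝ => F p.1 p.2) p (0, 1)) ?_ fun p hp =>
      (hasDerivAt_angular_fderiv hF hp.1 p.2).deriv
  exact (hF.continuousOn_fderiv_of_isOpen isOpen_halfPlane le_rfl).clm_apply continuousOn_const

theorem hasDerivAt_radial
    (hF : ContDiffOn ℝ 1 (fun p : ℝ × ℝ => F p.1 p.2) (Ioi 0 ×ˢ univ)) {r : ℝ} (hr : 0 < r) (θ : ℝ) :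
    HasDerivAt (fun s => F s θ) (deriv (fun s => F s θ) r) r :=
  (hasDerivAt_radial_fderiv hF hr θ).differentiableAt.hasDerivAt

theorem hasDerivAt_angular
    (hF : ContDiffOn ℝ 1 (fun p : ℝ × ℝ => F p.1 p.2) (Ioi 0 ×ˢ univ)) {r : ℝ} (hr : 0 < r) (θ : ℝ) :
    HasDerivAt (fun t => F r t) (deriv (fun t => F r t) θ) θ :=
  (hasDerivAt_angular_fderiv hF hr θ).differentiableAt.hasDerivAt

end Partial

section ByParts

variable {U : ℝ → ℝ → ℂ} {B : ℝ}

theorem integrable_radial_deriv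
    (hU : ContDiffOn ℝ 1 (fun p : ℝ × ℝ => U p.1 p.2) (Ioi 0 ×ˢ univ))
    (hB : ∀ r > (0 : ℝ), ∀ θ ∈ Ioo 0 (2 * Real.pi), ‖deriv (fun s => U s θ) r‖ ≤ B * (1 + r ^ 2)⁻¹) :
    Integrable (fun p : ℝ × ℝ => deriv (fun s => U s p.2) p.1) polarMeasure :=
  integrable_polarMeasure_of_le (continuousOn_radial_deriv hU) hB

theorem integrable_angular_deriv
    (hU : ContDiffOn ℝ 1 (fun p : ℝ × ℝ => U p.1 p.2) (Ioi 0 ×ˢ univ))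
    (hB : ∀ r > (0 : ℝ), ∀ θ ∈ Ioo 0 (2 * Real.pi),
      ‖(r : ℂ)⁻¹ * deriv (fun t => U r t) θ‖ ≤ B * (1 + r ^ 2)⁻¹) :
    Integrable (fun p : ℝ × ℝ => (p.1 : ℂ)⁻¹ * deriv (fun t => U p.1 t) p.2) polarMeasure := by
  refine integrable_polarMeasure_of_le (ContinuousOn.mul ?_ (continuousOn_angular_deriv hU)) hB
  refine ContinuousOn.inv₀ (by fun_prop) fun p hp => ?_
  exact_mod_cast (ne_of_gt hp.1)

/-- The radial variable is integrated first. The bound by `r²` makes the value `0` at `r = 0` a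
continuous extension, and the decay at infinity removes the other boundary term. -/
theorem integral_radial_deriv_eq_zero
    (hU : ContDiffOn ℝ 1 (fun p : ℝ × ℝ => U p.1 p.2) (Ioi 0 ×ˢ univ))
    (hB : ∀ r > (0 : ℝ), ∀ θ ∈ Ioo 0 (2 * Real.pi), ‖deriv (fun s => U s θ) r‖ ≤ B * (1 + r ^ 2)⁻¹)
    (hU0 : ∀ θ, U 0 θ = 0)
    (h0 : ∀ r > (0 : ℝ), ∀ θ ∈ Ioo 0 (2 * Real.pi), ‖U r θ‖ ≤ B * r ^ 2)
    (hinf : ∀ r > (0 : ℝ), ∀ θ ∈ Ioo 0 (2 * Real.pi), ‖U r θ‖ ≤ B * (1 + r ^ 2)⁻¹) :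
    ∫ p, deriv (fun s => U s p.2) p.1 ∂polarMeasure = 0 := by
  have hint := integrable_radial_deriv hU hB
  rw [polarMeasure] at hint ⊢
  rw [integral_prod_symm _ hint]
  refine integral_eq_zero_of_ae ?_
  filter_upwards [ae_circleMeasure, hint.prod_left_ae] with θ hθ hi
  have hc : ContinuousWithinAt (fun s => U s θ) (Ici 0) 0 := by
    rw [ContinuousWithinAt, hU0]
    have hlim : Filter.Tendsto (fun r : ℝ => B * r ^ 2) (nhdsWithin 0 (Ici 0)) (nhds 0) := by
      have : Filter.Tendsto (fun r : ℝ => B * r ^ 2) (nhds 0) (nhds (B * 0 ^ 2)) :=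
        (by fun_prop : Continuous fun r : ℝ => B * r ^ 2).tendsto 0
      simpa using this.mono_left nhdsWithin_le_nhds
    refine squeeze_zero_norm' ?_ hlim
    filter_upwards [self_mem_nhdsWithin] with r hr
    rcases (mem_Ici.1 hr).eq_or_lt with h | h
    · rw [← h, hU0]; simp
    · exact h0 r h θ hθ
  have ht : Filter.Tendsto (fun s => U s θ) Filter.atTop (nhds 0) := by
    have hlim : Filter.Tendsto (fun r : ℝ => B * (1 + r ^ 2)⁻¹) Filter.atTop (nhds 0) := by
      have h1 : Filter.Tendsto (fun r : ℝ => 1 + r ^ 2) Filter.atTop Filter.atTop :=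
        Filter.tendsto_atTop_add_const_left _ _ (Filter.tendsto_pow_atTop two_ne_zero)
      simpa using (h1.inv_tendsto_atTop).const_mul B
    refine squeeze_zero_norm' ?_ hlim
    filter_upwards [Filter.eventually_gt_atTop 0] with r hr using hinf r hr θ hθ
  have := integral_Ioi_of_hasDerivAt_of_tendsto hc
    (fun r hr => hasDerivAt_radial hU hr θ) hi ht
  simpa [hU0] using this

/-- With the angle integrated first, `1/r` is a constant and the inner integral vanishes by
periodicity. -/
theorem integral_angular_deriv_eq_zero
    (hU : ContDiffOn ℝ 1 (fun p : ℝ × ℝ => U p.1 p.2) (Ioi 0 ×ˢ univ))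
    (hB : ∀ r > (0 : ℝ), ∀ θ ∈ Ioo 0 (2 * Real.pi),
      ‖(r : ℂ)⁻¹ * deriv (fun t => U r t) θ‖ ≤ B * (1 + r ^ 2)⁻¹)
    (hper : ∀ r > (0 : ℝ), U r (2 * Real.pi) = U r 0) :
    ∫ p : ℝ × ℝ, (p.1 : ℂ)⁻¹ * deriv (fun t => U p.1 t) p.2 ∂polarMeasure = 0 := by
  have hint := integrable_angular_deriv hU hB
  rw [polarMeasure] at hint ⊢
  rw [integral_prod _ hint]
  refine integral_eq_zero_of_ae ?_
  filter_upwards [ae_restrict_mem measurableSet_Ioi] with r hr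
  have hr0 : (0 : ℝ) < r := hr
  have hc : Continuous fun θ => deriv (fun t => U r t) θ := by
    have := continuousOn_angular_deriv hU
    rw [← continuousOn_univ]
    exact this.comp (f := fun θ : ℝ => (r, θ)) (by fun_prop) fun θ _ => ⟨hr0, trivial⟩
  have h1 : ∫ θ in (0)..(2 * Real.pi), deriv (fun t => U r t) θ = 0 := by
    rw [intervalIntegral.integral_eq_sub_of_hasDerivAt
      (fun θ _ => hasDerivAt_angular hU hr0 θ) (hc.intervalIntegrable _ _), hper r hr0, sub_self]
  rw [intervalIntegral.integral_of_le Real.two_pi_pos.le] at h1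
  rw [integral_const_mul, circleMeasure, h1, mul_zero]
  rfl

end ByParts

/-! ### The amplitude of the vector field adapted to the phase -/

/-- The ratio `r² c / g(θ)`; the phase is stationary where it equals `1`. -/
noncomputable def statRatio (c : ℂ) (g : ℝ → ℂ) (r θ : ℝ) : ℂ := (r : ℂ) ^ 2 * (c / g θ)

/-- The amplitude `i e^{-iθ} ν(θ) v(r,θ) r² G(r,θ)`, with `G` the regularised inverse of
`1 - statRatio`. -/
noncomputable def amplitude (lam : ℝ) (c : ℂ) (g ν : ℝ → ℂ) (v : ℝ → ℝ → ℂ) (r θ : ℝ) : ℂ :=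
  Complex.I * (Complex.exp (-(Complex.I * θ)) * ν θ *
    (v r θ * ((r : ℂ) ^ 2 * regInv lam (statRatio c g r θ))))

/-- The oscillating factor `e^{iΨ}`. -/
noncomputable def oscFactor (h : ℝ → ℂ) (ρ α r θ : ℝ) : ℂ :=
  Complex.exp (Complex.I * phase h ρ α r θ)

theorem norm_exp_neg_I_mul (θ : ℝ) : ‖Complex.exp (-(Complex.I * θ))‖ = 1 := by
  rw [Complex.norm_exp]; simp

section Amplitude

variable {lam : ℝ} {c : ℂ} {g ν : ℝ → ℂ} {v : ℝ → ℝ → ℂ} {r θ Ω : ℝ}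

/-- The Euler field `r∂_r` doubles `q` and preserves the bound `Ω` on `v`, so each term of the
product rule carries the common factor `r Ω`. -/
theorem exists_hasDerivAt_amplitude_radial (hl : 0 < lam) (hr : 0 < r) {vr : ℂ}
    (hv : HasDerivAt (fun s => v s θ) vr r) (hvΩ : ‖v r θ‖ ≤ Ω) (hvrΩ : r * ‖vr‖ ≤ Ω) :
    ∃ A, HasDerivAt (fun s => amplitude lam c g ν v s θ) A r ∧
      ‖A‖ ≤ r * Ω * (3 * ‖ν θ‖ * ‖regInv lam (statRatio c g r θ)‖ +
        16 * ‖ν θ‖ * ‖statRatio c g r θ‖ * regSqInv lam (statRatio c g r θ)) := by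
  have hsq : HasDerivAt (fun s : ℝ => (s : ℂ) ^ 2) (2 * r) r := by
    refine ((hasDerivAt_id r).ofReal_comp.pow 2).congr_deriv ?_
    simp
  have hq : HasDerivAt (fun s => statRatio c g s θ) (2 * r * (c / g θ)) r := hsq.mul_const _
  obtain ⟨D, hD, hDn⟩ := exists_hasDerivAt_regInv hl hq
  refine ⟨_, ((hv.mul (hsq.mul hD)).const_mul
    (Complex.exp (-(Complex.I * θ)) * ν θ)).const_mul Complex.I, ?_⟩
  set G := regInv lam (statRatio c g r θ)
  set X := regSqInv lam (statRatio c g r θ)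
  have hX : 0 ≤ X := (regSqInv_pos hl _).le
  have hr' : ‖(r : ℂ)‖ = r := by rw [Complex.norm_real, Real.norm_of_nonneg hr.le]
  have hqn : r * ‖2 * (r : ℂ) * (c / g θ)‖ = 2 * ‖statRatio c g r θ‖ := by
    rw [statRatio, norm_mul, norm_mul, norm_mul, norm_pow, hr', Complex.norm_two]; ring
  have hΩ : 0 ≤ Ω := (norm_nonneg _).trans hvΩ
  rw [norm_mul, norm_mul, norm_mul, Complex.norm_I, norm_exp_neg_I_mul, one_mul, one_mul]
  have t1 : ‖vr * ((r : ℂ) ^ 2 * G)‖ ≤ r * Ω * ‖G‖ := by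
    rw [norm_mul, norm_mul, norm_pow, hr']
    calc _ = r * (r * ‖vr‖) * ‖G‖ := by ring
      _ ≤ _ := by gcongr
  have t2 : ‖2 * (r : ℂ) * G‖ = 2 * r * ‖G‖ := by
    rw [norm_mul, norm_mul, hr', Complex.norm_two]
  have t3 : ‖(r : ℂ) ^ 2 * D‖ ≤ r * (16 * ‖statRatio c g r θ‖ * X) := by
    rw [norm_mul, norm_pow, hr']
    calc r ^ 2 * ‖D‖ ≤ r ^ 2 * (8 * ‖2 * (r : ℂ) * (c / g θ)‖ * X) := by gcongr
      _ = r * (8 * (r * ‖2 * (r : ℂ) * (c / g θ)‖) * X) := by ring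
      _ = _ := by rw [hqn]; ring
  have t4 : ‖v r θ * (2 * (r : ℂ) * G + (r : ℂ) ^ 2 * D)‖ ≤
      Ω * (2 * r * ‖G‖ + r * (16 * ‖statRatio c g r θ‖ * X)) := by
    rw [norm_mul]
    refine mul_le_mul hvΩ ((norm_add_le _ _).trans ?_) (norm_nonneg _) hΩ
    rw [t2]; gcongr
  calc ‖ν θ‖ * ‖vr * ((r : ℂ) ^ 2 * G) + v r θ * (2 * (r : ℂ) * G + (r : ℂ) ^ 2 * D)‖
      ≤ ‖ν θ‖ * (r * Ω * ‖G‖ + Ω * (2 * r * ‖G‖ + r * (16 * ‖statRatio c g r θ‖ * X))) := by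
        gcongr
        exact (norm_add_le _ _).trans (add_le_add t1 t4)
    _ = _ := by ring

/-- The angular derivative of `q` is `-(g'/g) q`; this is where `|γ''|/|γ'|` enters. -/
theorem exists_hasDerivAt_amplitude_angular (hl : 0 < lam) (hr : 0 < r) {vt g' ν' : ℂ}
    (hv : HasDerivAt (fun t => v r t) vt θ) (hg : HasDerivAt g g' θ) (hg0 : g θ ≠ 0)
    (hν : HasDerivAt ν ν' θ) (hvΩ : ‖v r θ‖ ≤ Ω) (hvtΩ : ‖vt‖ ≤ Ω) :
    ∃ A, HasDerivAt (fun t => amplitude lam c g ν v r t) A θ ∧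
      ‖A‖ ≤ r ^ 2 * Ω * ((2 * ‖ν θ‖ + ‖ν'‖) * ‖regInv lam (statRatio c g r θ)‖ +
        8 * ‖ν θ‖ * ‖g' / g θ‖ * ‖statRatio c g r θ‖ * regSqInv lam (statRatio c g r θ)) := by
  have he : HasDerivAt (fun t : ℝ => Complex.exp (-(Complex.I * t)))
      (Complex.exp (-(Complex.I * θ)) * -(Complex.I)) θ := by
    have h1 : HasDerivAt (fun t : ℝ => -(Complex.I * (t : ℂ))) (-(Complex.I)) θ := by
      refine ((hasDerivAt_id θ).ofReal_comp.const_mul Complex.I).neg.congr_deriv ?_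
      simp
    exact h1.cexp
  have hq : HasDerivAt (fun t => statRatio c g r t)
      ((r : ℂ) ^ 2 * (-(c * g') / g θ ^ 2)) θ := by
    have h1 := ((hasDerivAt_const θ c).div hg hg0).const_mul ((r : ℂ) ^ 2)
    refine h1.congr_deriv ?_
    simp
  obtain ⟨D, hD, hDn⟩ := exists_hasDerivAt_regInv hl hq
  refine ⟨_, ((he.mul hν).mul (hv.mul (hD.const_mul ((r : ℂ) ^ 2)))).const_mul Complex.I, ?_⟩
  set G := regInv lam (statRatio c g r θ)
  set X := regSqInv lam (statRatio c g r θ)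
  have hX : 0 ≤ X := (regSqInv_pos hl _).le
  have hr' : ‖(r : ℂ)‖ = r := by rw [Complex.norm_real, Real.norm_of_nonneg hr.le]
  have hqn : ‖(r : ℂ) ^ 2 * (-(c * g') / g θ ^ 2)‖ = ‖g' / g θ‖ * ‖statRatio c g r θ‖ := by
    rw [statRatio, ← norm_mul, ← norm_neg]; congr 1; field_simp
  have hΩ : 0 ≤ Ω := (norm_nonneg _).trans hvΩ
  rw [norm_mul, Complex.norm_I, one_mul]
  simp only [Pi.mul_apply]
  have t1 : ‖Complex.exp (-(Complex.I * θ)) * -Complex.I * ν θ +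
      Complex.exp (-(Complex.I * θ)) * ν'‖ ≤ ‖ν θ‖ + ‖ν'‖ := by
    refine (norm_add_le _ _).trans_eq ?_
    simp only [norm_mul, norm_exp_neg_I_mul, norm_neg, Complex.norm_I, one_mul]
  have t2 : ‖v r θ * ((r : ℂ) ^ 2 * G)‖ ≤ Ω * (r ^ 2 * ‖G‖) := by
    rw [norm_mul, norm_mul, norm_pow, hr']; gcongr
  have t3 : ‖vt * ((r : ℂ) ^ 2 * G) + v r θ * ((r : ℂ) ^ 2 * D)‖ ≤
      Ω * (r ^ 2 * ‖G‖) + Ω * (r ^ 2 * (8 * (‖g' / g θ‖ * ‖statRatio c g r θ‖) * X)) := by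
    refine (norm_add_le _ _).trans ?_
    rw [norm_mul, norm_mul, norm_mul, norm_mul, norm_pow, hr', ← hqn]
    gcongr
  calc _ ≤ (‖ν θ‖ + ‖ν'‖) * (Ω * (r ^ 2 * ‖G‖)) + ‖ν θ‖ *
        (Ω * (r ^ 2 * ‖G‖) + Ω * (r ^ 2 * (8 * (‖g' / g θ‖ * ‖statRatio c g r θ‖) * X))) := by
        refine (norm_add_le _ _).trans (add_le_add ?_ ?_)
        · rw [norm_mul]; gcongr
        · rw [norm_mul, norm_mul, norm_exp_neg_I_mul, one_mul]; gcongr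
    _ = _ := by ring

theorem norm_amplitude (hr : 0 < r) :
    ‖amplitude lam c g ν v r θ‖ =
      ‖ν θ‖ * (‖v r θ‖ * (r ^ 2 * ‖regInv lam (statRatio c g r θ)‖)) := by
  have hr' : ‖(r : ℂ)‖ = r := by rw [Complex.norm_real, Real.norm_of_nonneg hr.le]
  simp only [amplitude, norm_mul, norm_pow, hr', norm_exp_neg_I_mul, Complex.norm_I, one_mul]

theorem contDiffOn_amplitude (hg : ContDiff ℝ 1 g) (hg0 : ∀ θ, g θ ≠ 0) (hν : ContDiff ℝ 1 ν)
    (hv : ContDiffOn ℝ 1 (fun p : ℝ × ℝ => v p.1 p.2) (Ioi 0 ×ˢ univ)) :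
    ContDiffOn ℝ 1 (fun p : ℝ × ℝ => amplitude lam c g ν v p.1 p.2) (Ioi 0 ×ˢ univ) := by
  have hsnd : ∀ {f : ℝ → ℂ}, ContDiff ℝ 1 f → ContDiff ℝ 1 fun p : ℝ × ℝ => f p.2 :=
    fun hf => hf.comp contDiff_snd
  have hofReal : ContDiff ℝ 1 fun x : ℝ => (x : ℂ) := Complex.ofRealCLM.contDiff
  have hsq : ContDiff ℝ 1 fun p : ℝ × ℝ => (p.1 : ℂ) ^ 2 := (hofReal.comp contDiff_fst).pow 2
  have hq : ContDiff ℝ 1 fun p : ℝ × ℝ => statRatio c g p.1 p.2 :=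
    hsq.mul (by
      simp only [div_eq_mul_inv]
      exact contDiff_const.mul ((hsnd hg).inv fun p => hg0 p.2))
  have he : ContDiff ℝ 1 fun t : ℝ => Complex.exp (-(Complex.I * t)) :=
    (contDiff_const.mul hofReal).neg.cexp
  exact contDiffOn_const.mul ((((hsnd he).mul (hsnd hν)).contDiffOn).mul
    (hv.mul (hsq.mul ((contDiff_regInv lam).comp hq)).contDiffOn))

end Amplitude

/-! ### The oscillating factor and the first order operator -/

section Factor

variable {h : ℝ → ℂ} {ρ α r θ : ℝ}

theorem norm_oscFactor_le (hr : 0 < r) (him : 0 ≤ (h θ).im) : ‖oscFactor h ρ α r θ‖ ≤ 1 := by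
  rw [oscFactor, Complex.norm_exp]
  refine Real.exp_le_one_iff.2 ?_
  have : (h θ / (r : ℂ)).im = (h θ).im / r := Complex.div_ofReal_im _ _
  simp only [phase, Complex.mul_re, Complex.I_re, zero_mul, Complex.I_im, one_mul, zero_sub,
    Complex.add_im, Complex.ofReal_im, zero_add, this]
  have : 0 ≤ (h θ).im / r := by positivity
  linarith

theorem hasDerivAt_oscFactor_radial (hr : 0 < r) :
    HasDerivAt (fun s => oscFactor h ρ α s θ)
      (Complex.I * (ρ * Real.sin (θ + α) - h θ / (r : ℂ) ^ 2) * oscFactor h ρ α r θ) r := by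
  have hr0 : (r : ℂ) ≠ 0 := by exact_mod_cast hr.ne'
  have h1 : HasDerivAt (fun s : ℝ => (s : ℂ)) 1 r := (hasDerivAt_id r).ofReal_comp
  have h2 : HasDerivAt (fun s : ℝ => Complex.I * phase h ρ α s θ)
      (Complex.I * (ρ * Real.sin (θ + α) - h θ / (r : ℂ) ^ 2)) r := by
    have := (((h1.const_mul (ρ : ℂ)).mul_const (Real.sin (θ + α) : ℂ)).add
      ((hasDerivAt_const r (h θ)).div h1 hr0)).const_mul Complex.I
    refine (this.congr_of_eventuallyEq (Filter.Eventually.of_forall fun s => ?_)).congr_deriv ?_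
    · simp [phase]
    · ring
  exact h2.cexp.congr_deriv (mul_comm _ _)

theorem hasDerivAt_oscFactor_angular {h' : ℂ} (hh : HasDerivAt h h' θ) :
    HasDerivAt (fun t => oscFactor h ρ α r t)
      (Complex.I * (ρ * r * Real.cos (θ + α) + h' / (r : ℂ)) * oscFactor h ρ α r θ) θ := by
  have h1 : HasDerivAt (fun t : ℝ => ((ρ * r * Real.sin (t + α) : ℝ) : ℂ))
      ((ρ * r * Real.cos (θ + α) : ℝ) : ℂ) θ := by
    have := ((((hasDerivAt_id θ).add_const α).sin).const_mul (ρ * r)).ofReal_comp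
    simpa using this
  have h2 : HasDerivAt (fun t : ℝ => Complex.I * phase h ρ α r t)
      (Complex.I * (ρ * r * Real.cos (θ + α) + h' / (r : ℂ))) θ := by
    have := (h1.add (hh.div_const (r : ℂ))).const_mul Complex.I
    refine this.congr_deriv ?_
    push_cast; ring
  exact h2.cexp.congr_deriv (mul_comm _ _)

theorem contDiffOn_oscFactor (hh : ContDiff ℝ 1 h) :
    ContDiffOn ℝ 1 (fun p : ℝ × ℝ => oscFactor h ρ α p.1 p.2) (Ioi 0 ×ˢ univ) := by
  have hofReal : ContDiff ℝ 1 fun x : ℝ => (x : ℂ) := Complex.ofRealCLM.contDiff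
  have h1 : ContDiff ℝ 1 fun p : ℝ × ℝ => ((ρ * p.1 * Real.sin (p.2 + α) : ℝ) : ℂ) :=
    hofReal.comp ((contDiff_const.mul contDiff_fst).mul
      (Real.contDiff_sin.comp (contDiff_snd.add contDiff_const)))
  have h2 : ContDiffOn ℝ 1 (fun p : ℝ × ℝ => h p.2 / (p.1 : ℂ)) (Ioi 0 ×ˢ univ) := by
    simp only [div_eq_mul_inv]
    exact ((hh.comp contDiff_snd).contDiffOn).mul ((hofReal.comp contDiff_fst).contDiffOn.inv
      fun p hp => Complex.ofReal_ne_zero.2 (ne_of_gt hp.1))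
  exact (contDiffOn_const.mul (h1.contDiffOn.add h2)).cexp

theorem hasDerivAt_gammaCurve {h' : ℂ} (hh : HasDerivAt h h' θ) :
    HasDerivAt (gammaCurve h)
      (Complex.exp (-(Complex.I * θ)) * (Complex.I * h θ - h')) θ := by
  have he : HasDerivAt (fun t : ℝ => Complex.exp (-(Complex.I * t)))
      (Complex.exp (-(Complex.I * θ)) * -(Complex.I)) θ := by
    have h1 : HasDerivAt (fun t : ℝ => -(Complex.I * (t : ℂ))) (-(Complex.I)) θ := by
      refine ((hasDerivAt_id θ).ofReal_comp.const_mul Complex.I).neg.congr_deriv ?_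
      simp
    exact h1.cexp
  exact (he.neg.mul hh).congr_deriv (by simp only [Pi.neg_apply]; ring)

/-- The vector field `(1/r) ∂_θ + i ∂_r` applied to the phase factor, times the amplitude. -/
theorem dbar_oscFactor_mul_amplitude {lam : ℝ} {g m ν : ℝ → ℂ} {v : ℝ → ℝ → ℂ} {h' : ℂ}
    (hr : 0 < r) (hg : g θ = Complex.exp (-(Complex.I * θ)) * (Complex.I * h θ - h'))
    (hg0 : g θ ≠ 0) (hν : ν θ = m θ / g θ) :
    ((r : ℂ)⁻¹ * (Complex.I * (ρ * r * Real.cos (θ + α) + h' / (r : ℂ))) +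
        Complex.I * (Complex.I * (ρ * Real.sin (θ + α) - h θ / (r : ℂ) ^ 2))) *
      amplitude lam (ρ * Complex.exp (Complex.I * α)) g ν v r θ =
    m θ * v r θ * (1 - (cappedBump
      (lam * ‖1 - statRatio (ρ * Complex.exp (Complex.I * α)) g r θ‖ ^ 2) : ℂ)) := by
  have hr0 : (r : ℂ) ≠ 0 := by exact_mod_cast hr.ne'
  have hE : Complex.exp (-(Complex.I * θ)) ≠ 0 := Complex.exp_ne_zero _
  rw [← one_sub_mul_regInv, amplitude, hν]
  set G := regInv lam (statRatio (ρ * Complex.exp (Complex.I * α)) g r θ)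
  rw [statRatio]
  have hexp : (Real.cos (θ + α) : ℂ) + Complex.I * Real.sin (θ + α) =
      Complex.exp (Complex.I * α) / Complex.exp (-(Complex.I * θ)) := by
    rw [← Complex.exp_sub, Complex.ofReal_cos, Complex.ofReal_sin, mul_comm Complex.I (Complex.sin _),
      ← Complex.exp_mul_I]
    congr 1; push_cast; ring
  have hh' : h' - Complex.I * h θ = -g θ / Complex.exp (-(Complex.I * θ)) := by
    rw [hg]; field_simp; ring
  have hphase : (r : ℂ)⁻¹ * (Complex.I * (ρ * r * Real.cos (θ + α) + h' / (r : ℂ))) +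
        Complex.I * (Complex.I * (ρ * Real.sin (θ + α) - h θ / (r : ℂ) ^ 2)) =
      Complex.I * (ρ * ((Real.cos (θ + α) : ℂ) + Complex.I * Real.sin (θ + α)) +
        (h' - Complex.I * h θ) / (r : ℂ) ^ 2) := by
    field_simp
    ring
  rw [hphase, hexp, hh']
  field_simp
  linear_combination (ρ * Complex.exp (Complex.I * α) * r ^ 2 - g θ) * m θ * v r θ * G * Complex.I_sq

end Factor

/-! ### Qualitative bounds for integrability and for the boundary terms -/

section CrudeBounds

variable {lam : ℝ} {c : ℂ} {g : ℝ → ℂ} {r θ : ℝ}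

theorem norm_mul_sqrt_regSqInv_le_add (hl : 0 < lam) (z : ℂ) :
    ‖z‖ * Real.sqrt (regSqInv lam z) ≤ 1 + Real.sqrt lam := by
  have h1 := norm_mul_sqrt_regSqInv_le hl z
  have h2 : Real.sqrt (regSqInv lam z) ≤ Real.sqrt lam := by
    refine Real.sqrt_le_sqrt ?_
    rw [regSqInv_eq hl]
    exact div_le_self hl.le (by nlinarith [sq_nonneg ‖1 - z‖])
  have h3 : ‖z‖ ≤ 1 + ‖1 - z‖ := by
    calc ‖z‖ = ‖1 - (1 - z)‖ := by congr 1; ring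
      _ ≤ _ := (norm_sub_le _ _).trans_eq (by rw [norm_one])
  nlinarith [Real.sqrt_nonneg (regSqInv lam z)]

/-- Since `r² = |g/c| |q|`, the decay of `regInv` as `q` grows becomes decay in `r`. -/
theorem one_add_sq_mul_sqrt_regSqInv_le (hl : 0 < lam) (hc : c ≠ 0) (hg0 : g θ ≠ 0) {B : ℝ}
    (hB : ‖g θ / c‖ ≤ B) :
    (1 + r ^ 2) * Real.sqrt (regSqInv lam (statRatio c g r θ)) ≤
      (1 + B) * (1 + Real.sqrt lam) := by
  set z := statRatio c g r θ with hz
  have h1 := norm_mul_sqrt_regSqInv_le_add hl z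
  have h2 : Real.sqrt (regSqInv lam z) ≤ Real.sqrt lam := by
    refine Real.sqrt_le_sqrt ?_
    rw [regSqInv_eq hl]
    exact div_le_self hl.le (by nlinarith [sq_nonneg ‖1 - z‖])
  have h3 : r ^ 2 ≤ B * ‖z‖ := by
    have e : r ^ 2 = ‖g θ / c‖ * ‖z‖ := by
      have h4 : ‖(r : ℂ) ^ 2‖ = r ^ 2 := by rw [norm_pow, Complex.norm_real, Real.norm_eq_abs, sq_abs]
      rw [hz, statRatio, ← norm_mul, ← h4]
      congr 1; field_simp
    rw [e]; gcongr
  have h0 := Real.sqrt_nonneg (regSqInv lam z)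
  have hB0 : 0 ≤ B := (norm_nonneg _).trans hB
  have h5 : r ^ 2 * Real.sqrt (regSqInv lam z) ≤ B * (1 + Real.sqrt lam) := by
    calc _ ≤ B * ‖z‖ * Real.sqrt (regSqInv lam z) := by gcongr
      _ = B * (‖z‖ * Real.sqrt (regSqInv lam z)) := by ring
      _ ≤ _ := by gcongr
  nlinarith

/-- A bound for the terms produced by one derivative of the oscillating amplitude. -/
theorem crude_bound (hl : 0 < lam) (hc : c ≠ 0) (hg0 : g θ ≠ 0) {ρ B N Ω a b d k : ℝ}
    (hr : 0 < r) (hρ : 0 < ρ) (hB : ‖g θ / c‖ ≤ B) (hΩ : Ω ≤ N * (1 + r ^ 2)⁻¹)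
    (hΩ0 : 0 ≤ Ω) (ha : a ∈ Icc 0 B) (hb : b ∈ Icc 0 B) (hd : d ∈ Icc 0 B) (hk : k ∈ Icc 0 B) :
    (ρ + k / r ^ 2) * (a * (Ω * (r ^ 2 * ‖regInv lam (statRatio c g r θ)‖))) +
      r * Ω * ((3 * a + b) * ‖regInv lam (statRatio c g r θ)‖ +
        16 * a * (1 + d) * ‖statRatio c g r θ‖ * regSqInv lam (statRatio c g r θ)) ≤
    (N * (100 * (ρ + 1 + B) * (1 + B) * ((1 + B) * (1 + Real.sqrt lam)) ^ 2)) *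
      (1 + r ^ 2)⁻¹ := by
  set z := statRatio c g r θ
  set Y := Real.sqrt (regSqInv lam z) with hY
  have hY0 : 0 ≤ Y := Real.sqrt_nonneg _
  have hYX : regSqInv lam z = Y * Y := (Real.mul_self_sqrt (regSqInv_pos hl z).le).symm
  have hG : ‖regInv lam z‖ ≤ 4 * Y := norm_regInv_le hl z
  have hq : ‖z‖ * Y ≤ 1 + Real.sqrt lam := norm_mul_sqrt_regSqInv_le_add hl z
  have h1 := one_add_sq_mul_sqrt_regSqInv_le (r := r) hl hc hg0 hB
  have hB0 : 0 ≤ B := (norm_nonneg _).trans hB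
  set M := (1 + B) * (1 + Real.sqrt lam) with hM
  have hsl := Real.sqrt_nonneg lam
  have hM1 : 1 + Real.sqrt lam ≤ M := by nlinarith
  have hM1' : 1 ≤ M := by linarith
  have hY1 : Y ≤ M := by nlinarith [mul_nonneg (sq_nonneg r) hY0]
  have hrY : r * Y ≤ M := by nlinarith [mul_nonneg (sq_nonneg (r - 1)) hY0]
  have hr2Y : r ^ 2 * Y ≤ M := by nlinarith
  have hqM : ‖z‖ * Y ≤ M := hq.trans hM1
  have hzY : 0 ≤ ‖z‖ * Y := by positivity
  have hMM : M ≤ M ^ 2 := by nlinarith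
  obtain ⟨ha0, ha1⟩ := ha
  obtain ⟨hb0, hb1⟩ := hb
  obtain ⟨hd0, hd1⟩ := hd
  obtain ⟨hk0, hk1⟩ := hk
  have t1 : (ρ + k / r ^ 2) * (a * (Ω * (r ^ 2 * ‖regInv lam z‖))) ≤ Ω * (4 * (ρ + B) * B * M) := by
    have e : (ρ + k / r ^ 2) * (a * (Ω * (r ^ 2 * ‖regInv lam z‖))) =
        Ω * (a * (ρ * (r ^ 2 * ‖regInv lam z‖) + k * ‖regInv lam z‖)) := by field_simp
    rw [e]
    refine mul_le_mul_of_nonneg_left ?_ hΩ0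
    calc a * (ρ * (r ^ 2 * ‖regInv lam z‖) + k * ‖regInv lam z‖)
        ≤ B * (ρ * (r ^ 2 * (4 * Y)) + B * (4 * Y)) := by gcongr
      _ = B * (4 * ρ * (r ^ 2 * Y) + 4 * B * Y) := by ring
      _ ≤ B * (4 * ρ * M + 4 * B * M) := by gcongr
      _ = _ := by ring
  have t2 : r * Ω * ((3 * a + b) * ‖regInv lam z‖ +
        16 * a * (1 + d) * ‖z‖ * regSqInv lam z) ≤ Ω * (16 * B * M + 16 * B * (1 + B) * M ^ 2) := by
    rw [hYX]
    calc _ ≤ r * Ω * ((3 * B + B) * (4 * Y) + 16 * B * (1 + B) * ‖z‖ * (Y * Y)) := by gcongr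
      _ = Ω * (16 * B * (r * Y) + 16 * B * (1 + B) * ((r * Y) * (‖z‖ * Y))) := by ring
      _ ≤ Ω * (16 * B * M + 16 * B * (1 + B) * (M * M)) := by gcongr
      _ = _ := by ring
  calc _ ≤ Ω * (4 * (ρ + B) * B * M) + Ω * (16 * B * M + 16 * B * (1 + B) * M ^ 2) :=
        add_le_add t1 t2
    _ = Ω * (4 * (ρ + B) * B * M + 16 * B * M + 16 * B * (1 + B) * M ^ 2) := by ring
    _ ≤ Ω * (100 * (ρ + 1 + B) * (1 + B) * M ^ 2) := by
        refine mul_le_mul_of_nonneg_left ?_ hΩ0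
        have e1 : 4 * (ρ + B) * B * M ≤ 4 * (ρ + 1 + B) * (1 + B) * M ^ 2 := by
          gcongr <;> linarith
        have e2 : 16 * B * M ≤ 16 * (ρ + 1 + B) * (1 + B) * M ^ 2 := by
          have : B * M ≤ (1 + B) * M ^ 2 := by gcongr; linarith
          have : 0 ≤ (1 + B) * M ^ 2 := by positivity
          nlinarith
        have e3 : 16 * B * (1 + B) * M ^ 2 ≤ 16 * (ρ + 1 + B) * (1 + B) * M ^ 2 := by
          gcongr; linarith
        have : 0 ≤ (ρ + 1 + B) * (1 + B) * M ^ 2 := by positivity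
        linarith
    _ ≤ (N * (1 + r ^ 2)⁻¹) * (100 * (ρ + 1 + B) * (1 + B) * M ^ 2) := by gcongr
    _ = _ := by ring

end CrudeBounds

/-! ### Pointwise form of the integration by parts -/

section Pointwise

variable {h g m ν : ℝ → ℂ} {v : ℝ → ℝ → ℂ} {ρ α lam r θ Ω : ℝ} {h' g' ν' vr vt : ℂ}

/-- The first two bounds, where the derivative may fall on `e^{iΨ}`, serve only to justify
integrability. In the last one those terms combine through `dbar_oscFactor_mul_amplitude` into the
original integrand minus its bump part, so only derivatives of the amplitude and the bump survive.
-/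
theorem exists_deriv_oscFactor_mul_amplitude (hl : 0 < lam) (hr : 0 < r) (hρ : 0 < ρ)
    (him : 0 ≤ (h θ).im) (hh : HasDerivAt h h' θ) (hgd : HasDerivAt g g' θ) (hg0 : g θ ≠ 0)
    (hg : g θ = Complex.exp (-(Complex.I * θ)) * (Complex.I * h θ - h'))
    (hν : HasDerivAt ν ν' θ) (hνm : ν θ = m θ / g θ)
    (hvr : HasDerivAt (fun s => v s θ) vr r) (hvt : HasDerivAt (fun t => v r t) vt θ)
    (hvΩ : ‖v r θ‖ ≤ Ω) (hvrΩ : r * ‖vr‖ ≤ Ω) (hvtΩ : ‖vt‖ ≤ Ω) :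
    ∃ Ur Ut, HasDerivAt (fun s => oscFactor h ρ α s θ *
        amplitude lam (ρ * Complex.exp (Complex.I * α)) g ν v s θ) Ur r ∧
      HasDerivAt (fun t => oscFactor h ρ α r t *
        amplitude lam (ρ * Complex.exp (Complex.I * α)) g ν v r t) Ut θ ∧
      ‖Ur‖ ≤ (ρ + ‖h θ‖ / r ^ 2) * (‖ν θ‖ * (Ω * (r ^ 2 *
          ‖regInv lam (statRatio (ρ * Complex.exp (Complex.I * α)) g r θ)‖))) +
        r * Ω * (3 * ‖ν θ‖ * ‖regInv lam (statRatio (ρ * Complex.exp (Complex.I * α)) g r θ)‖ +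
          16 * ‖ν θ‖ * ‖statRatio (ρ * Complex.exp (Complex.I * α)) g r θ‖ *
            regSqInv lam (statRatio (ρ * Complex.exp (Complex.I * α)) g r θ)) ∧
      ‖(r : ℂ)⁻¹ * Ut‖ ≤ (ρ + ‖h'‖ / r ^ 2) * (‖ν θ‖ * (Ω * (r ^ 2 *
          ‖regInv lam (statRatio (ρ * Complex.exp (Complex.I * α)) g r θ)‖))) +
        r * Ω * ((2 * ‖ν θ‖ + ‖ν'‖) *
            ‖regInv lam (statRatio (ρ * Complex.exp (Complex.I * α)) g r θ)‖ +
          8 * ‖ν θ‖ * ‖g' / g θ‖ * ‖statRatio (ρ * Complex.exp (Complex.I * α)) g r θ‖ *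
            regSqInv lam (statRatio (ρ * Complex.exp (Complex.I * α)) g r θ)) ∧
      ‖oscFactor h ρ α r θ * v r θ * m θ - ((r : ℂ)⁻¹ * Ut + Complex.I * Ur)‖ ≤
        r * Ω * ((5 * ‖ν θ‖ + ‖ν'‖) *
            ‖regInv lam (statRatio (ρ * Complex.exp (Complex.I * α)) g r θ)‖ +
          16 * (1 + ‖g' / g θ‖) * ‖ν θ‖ *
            ‖statRatio (ρ * Complex.exp (Complex.I * α)) g r θ‖ *
            regSqInv lam (statRatio (ρ * Complex.exp (Complex.I * α)) g r θ)) +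
        Ω * (‖m θ‖ * cappedBump
          (lam * ‖1 - statRatio (ρ * Complex.exp (Complex.I * α)) g r θ‖ ^ 2)) := by
  set c : ℂ := ρ * Complex.exp (Complex.I * α) with hc
  obtain ⟨Ar, hAr, hArn⟩ := exists_hasDerivAt_amplitude_radial (c := c) (g := g) (ν := ν)
    hl hr hvr hvΩ hvrΩ
  obtain ⟨At, hAt, hAtn⟩ := exists_hasDerivAt_amplitude_angular (c := c) hl hr hvt hgd hg0 hν
    hvΩ hvtΩ
  have hE := norm_oscFactor_le (ρ := ρ) (α := α) hr him
  have hAn := norm_amplitude (lam := lam) (c := c) (g := g) (ν := ν) (v := v) (θ := θ) hr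
  have key := dbar_oscFactor_mul_amplitude (lam := lam) (α := α) (ρ := ρ) (v := v) hr hg hg0 hνm
  rw [← hc] at key
  set E := oscFactor h ρ α r θ with hEdef
  set A := amplitude lam c g ν v r θ with hAdef
  set G := regInv lam (statRatio c g r θ)
  set X := regSqInv lam (statRatio c g r θ)
  set q := statRatio c g r θ
  have hX : 0 ≤ X := (regSqInv_pos hl _).le
  have hΩ : 0 ≤ Ω := (norm_nonneg _).trans hvΩ
  have hr' : ‖(r : ℂ)‖ = r := by rw [Complex.norm_real, Real.norm_of_nonneg hr.le]
  have hr0 : (r : ℂ) ≠ 0 := by exact_mod_cast hr.ne'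
  have hρ' : ‖(ρ : ℂ)‖ = ρ := by rw [Complex.norm_real, Real.norm_of_nonneg hρ.le]
  have hAle : ‖A‖ ≤ ‖ν θ‖ * (Ω * (r ^ 2 * ‖G‖)) := by rw [hAn]; gcongr
  have hsin : ‖(Real.sin (θ + α) : ℂ)‖ ≤ 1 := by
    rw [Complex.norm_real]; exact Real.abs_sin_le_one _
  have hcos : ‖(Real.cos (θ + α) : ℂ)‖ ≤ 1 := by
    rw [Complex.norm_real]; exact Real.abs_cos_le_one _
  have hAt' : ‖(r : ℂ)⁻¹ * At‖ ≤ r * Ω * ((2 * ‖ν θ‖ + ‖ν'‖) * ‖G‖ +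
        8 * ‖ν θ‖ * ‖g' / g θ‖ * ‖q‖ * X) := by
    rw [norm_mul, norm_inv, hr', inv_mul_le_iff₀ hr]
    refine hAtn.trans_eq ?_
    ring
  refine ⟨_, _, (hasDerivAt_oscFactor_radial hr).mul hAr,
    (hasDerivAt_oscFactor_angular hh).mul hAt, ?_, ?_, ?_⟩
  · rw [← hEdef, ← hAdef]
    refine (norm_add_le _ _).trans (add_le_add ?_ ?_)
    · rw [norm_mul, norm_mul, norm_mul, Complex.norm_I, one_mul]
      have h1 : ‖(ρ : ℂ) * Real.sin (θ + α) - h θ / (r : ℂ) ^ 2‖ ≤ ρ + ‖h θ‖ / r ^ 2 := by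
        refine (norm_sub_le _ _).trans ?_
        rw [norm_mul, norm_div, norm_pow, hr', hρ']
        gcongr
        exact mul_le_of_le_one_right hρ.le hsin
      calc _ ≤ (ρ + ‖h θ‖ / r ^ 2) * 1 * (‖ν θ‖ * (Ω * (r ^ 2 * ‖G‖))) := by gcongr
        _ = _ := by rw [mul_one]
    · rw [norm_mul]
      exact (mul_le_of_le_one_left (norm_nonneg _) hE).trans hArn
  · rw [← hEdef, ← hAdef, mul_add]
    refine (norm_add_le _ _).trans (add_le_add ?_ ?_)
    · have e : (r : ℂ)⁻¹ * (Complex.I * (ρ * r * Real.cos (θ + α) + h' / (r : ℂ)) * E * A) =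
          Complex.I * (ρ * Real.cos (θ + α) + h' / (r : ℂ) ^ 2) * E * A := by field_simp
      rw [e, norm_mul, norm_mul, norm_mul, Complex.norm_I, one_mul]
      have h1 : ‖(ρ : ℂ) * Real.cos (θ + α) + h' / (r : ℂ) ^ 2‖ ≤ ρ + ‖h'‖ / r ^ 2 := by
        refine (norm_add_le _ _).trans ?_
        rw [norm_mul, norm_div, norm_pow, hr', hρ']
        gcongr
        exact mul_le_of_le_one_right hρ.le hcos
      calc _ ≤ (ρ + ‖h'‖ / r ^ 2) * 1 * (‖ν θ‖ * (Ω * (r ^ 2 * ‖G‖))) := by gcongr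
        _ = _ := by rw [mul_one]
    · rw [mul_left_comm, norm_mul]
      exact (mul_le_of_le_one_left (norm_nonneg _) hE).trans hAt'
  · rw [← hEdef, ← hAdef]
    have e : E * v r θ * m θ - ((r : ℂ)⁻¹ *
        (Complex.I * (ρ * r * Real.cos (θ + α) + h' / (r : ℂ)) * E * A + E * At) +
        Complex.I * (Complex.I * (ρ * Real.sin (θ + α) - h θ / (r : ℂ) ^ 2) * E * A + E * Ar)) =
        E * (m θ * v r θ * (cappedBump (lam * ‖1 - q‖ ^ 2) : ℂ) -
          ((r : ℂ)⁻¹ * At + Complex.I * Ar)) := by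
      linear_combination (-E) * key
    rw [e, norm_mul]
    refine (mul_le_of_le_one_left (norm_nonneg _) hE).trans ((norm_sub_le _ _).trans ?_)
    have t1 : ‖m θ * v r θ * (cappedBump (lam * ‖1 - q‖ ^ 2) : ℂ)‖ ≤
        Ω * (‖m θ‖ * cappedBump (lam * ‖1 - q‖ ^ 2)) := by
      have hb := cappedBump_nonneg (lam * ‖1 - q‖ ^ 2)
      rw [norm_mul, norm_mul, Complex.norm_real, Real.norm_of_nonneg hb]
      calc _ = ‖v r θ‖ * (‖m θ‖ * cappedBump (lam * ‖1 - q‖ ^ 2)) := by ring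
        _ ≤ _ := by gcongr
    have t2 : ‖(r : ℂ)⁻¹ * At + Complex.I * Ar‖ ≤
        r * Ω * ((2 * ‖ν θ‖ + ‖ν'‖) * ‖G‖ + 8 * ‖ν θ‖ * ‖g' / g θ‖ * ‖q‖ * X) +
        r * Ω * (3 * ‖ν θ‖ * ‖G‖ + 16 * ‖ν θ‖ * ‖q‖ * X) := by
      refine (norm_add_le _ _).trans (add_le_add hAt' ?_)
      rw [norm_mul, Complex.norm_I, one_mul]; exact hArn
    have t3 : 0 ≤ r * Ω * (8 * ‖ν θ‖ * ‖g' / g θ‖ * ‖q‖ * X) := by positivity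
    calc _ ≤ Ω * (‖m θ‖ * cappedBump (lam * ‖1 - q‖ ^ 2)) +
        (r * Ω * ((2 * ‖ν θ‖ + ‖ν'‖) * ‖G‖ + 8 * ‖ν θ‖ * ‖g' / g θ‖ * ‖q‖ * X) +
        r * Ω * (3 * ‖ν θ‖ * ‖G‖ + 16 * ‖ν θ‖ * ‖q‖ * X)) := add_le_add t1 t2
      _ ≤ _ := by
        have : r * Ω * ((5 * ‖ν θ‖ + ‖ν'‖) * ‖G‖ + 16 * (1 + ‖g' / g θ‖) * ‖ν θ‖ * ‖q‖ * X) =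
          (r * Ω * ((2 * ‖ν θ‖ + ‖ν'‖) * ‖G‖ + 8 * ‖ν θ‖ * ‖g' / g θ‖ * ‖q‖ * X) +
            r * Ω * (3 * ‖ν θ‖ * ‖G‖ + 16 * ‖ν θ‖ * ‖q‖ * X)) +
            r * Ω * (8 * ‖ν θ‖ * ‖g' / g θ‖ * ‖q‖ * X) := by ring
        linarith

end Pointwise

/-! ### Smooth periodic functions -/

theorem SmoothOnCircle.differentiable {f : ℝ → ℂ} (hf : SmoothOnCircle f) : Differentiable ℝ f :=
  hf.1.differentiable (by simp)

theorem SmoothOnCircle.hasDerivAt {f : ℝ → ℂ} (hf : SmoothOnCircle f) (θ : ℝ) :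
    HasDerivAt f (deriv f θ) θ := (hf.differentiable θ).hasDerivAt

theorem SmoothOnCircle.continuous {f : ℝ → ℂ} (hf : SmoothOnCircle f) : Continuous f :=
  hf.1.continuous

theorem SmoothOnCircle.contDiff_one {f : ℝ → ℂ} (hf : SmoothOnCircle f) : ContDiff ℝ 1 f :=
  hf.1.of_le (by exact_mod_cast le_top)

theorem SmoothOnCircle.deriv {f : ℝ → ℂ} (hf : SmoothOnCircle f) : SmoothOnCircle (deriv f) := by
  refine ⟨(contDiff_infty_iff_deriv.1 hf.1).2, fun x => ?_⟩
  have : (fun y => f (y + 2 * Real.pi)) = f := funext hf.2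
  rw [← deriv_comp_add_const, this]

theorem SmoothOnCircle.div {f g : ℝ → ℂ} (hf : SmoothOnCircle f) (hg : SmoothOnCircle g)
    (h0 : ∀ θ, g θ ≠ 0) : SmoothOnCircle fun θ => f θ / g θ := by
  refine ⟨?_, fun x => by simp only [hf.2 x, hg.2 x]⟩
  simp only [div_eq_mul_inv]
  exact hf.1.mul (hg.1.inv h0)

theorem exp_neg_I_mul_two_pi : Complex.exp (-(Complex.I * (2 * Real.pi : ℝ))) = 1 := by
  have : -(Complex.I * (2 * Real.pi : ℝ)) = -(2 * Real.pi * Complex.I) := by push_cast; ring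
  rw [this, Complex.exp_neg, Complex.exp_two_pi_mul_I, inv_one]

theorem exp_neg_I_mul_periodic :
    Function.Periodic (fun t : ℝ => Complex.exp (-(Complex.I * t))) (2 * Real.pi) := by
  intro t
  have : -(Complex.I * ((t + 2 * Real.pi : ℝ) : ℂ)) =
      -(Complex.I * t) + -(Complex.I * (2 * Real.pi : ℝ)) := by push_cast; ring
  simp only [this, Complex.exp_add, exp_neg_I_mul_two_pi, mul_one]

theorem SmoothOnCircle.gammaCurve {h : ℝ → ℂ} (hh : SmoothOnCircle h) :
    SmoothOnCircle (gammaCurve h) := by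
  constructor
  · have hofReal : ContDiff ℝ ∞ fun x : ℝ => (x : ℂ) := Complex.ofRealCLM.contDiff
    exact ((contDiff_const.mul hofReal).neg.cexp.neg).mul hh.1
  · intro t
    have h1 := exp_neg_I_mul_periodic t
    simp only at h1
    simp only [_root_.gammaCurve, h1, hh.2 t]

/-! ### Reduction to an absolutely convergent integral -/

section Reduction

variable {h m : ℝ → ℂ} {v : ℝ → ℝ → ℂ} {ρ α lam N s : ℝ}

theorem integrable_oscIntegrand (hh : SmoothOnCircle h) (hm : SmoothOnCircle m)
    (him : ∀ θ, 0 ≤ (h θ).im) (hv : C1OnHalfLineCircle v) (hs : 2 ≤ s) (hN : 0 ≤ N)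
    (hvN : ∀ r > (0 : ℝ), ∀ θ ∈ Ioo 0 (2 * Real.pi), ‖v r θ‖ ≤ N * japaneseBracket r ^ (-s)) :
    Integrable (fun p : ℝ × ℝ => oscIntegrand h m v ρ α p.1 p.2) polarMeasure := by
  obtain ⟨B, hB⟩ := isCompact_Icc.exists_bound_of_continuousOn
    (s := Icc 0 (2 * Real.pi)) hm.continuous.continuousOn
  refine integrable_polarMeasure_of_le (B := N * B) ?_ fun r hr θ hθ => ?_
  · exact (((contDiffOn_oscFactor hh.contDiff_one).continuousOn).mul hv.1.continuousOn).mul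
      (hm.continuous.comp continuous_snd).continuousOn
  · have h1 : ‖oscFactor h ρ α r θ‖ ≤ 1 := norm_oscFactor_le hr (him θ)
    have h2 := hvN r hr θ hθ
    have h3 := japaneseBracket_rpow_le hs r
    have h4 := hB θ (Ioo_subset_Icc_self hθ)
    change ‖oscFactor h ρ α r θ * v r θ * m θ‖ ≤ _
    rw [norm_mul, norm_mul]
    calc _ ≤ 1 * (N * (1 + r ^ 2)⁻¹) * B := by
          gcongr
          exact h2.trans (by gcongr)
      _ = _ := by ring

/-- The part of the integrand that is left after one integration by parts, in modulus. -/
noncomputable def reducedBound (lam : ℝ) (c : ℂ) (g m : ℝ → ℂ) (s r θ : ℝ) : ℝ :=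
  r * japaneseBracket r ^ (-s) *
    ((5 * ‖m θ / g θ‖ + ‖deriv (fun t => m t / g t) θ‖) * ‖regInv lam (statRatio c g r θ)‖ +
      16 * (1 + ‖deriv g θ / g θ‖) * ‖m θ / g θ‖ * ‖statRatio c g r θ‖ *
        regSqInv lam (statRatio c g r θ)) +
  japaneseBracket r ^ (-s) * (‖m θ‖ * cappedBump (lam * ‖1 - statRatio c g r θ‖ ^ 2))

/-- The integrals of `(1/r)∂_θ U` and `∂_r U` vanish for `U = e^{iΨ}` times the amplitude.
Subtracting them from the integrand changes nothing, and the modulus of the difference is bounded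
pointwise. -/
theorem enorm_oscIntegral_le_lintegral (hh : SmoothOnCircle h) (hm : SmoothOnCircle m)
    (him : ∀ θ, 0 ≤ (h θ).im) (hg0 : ∀ θ, deriv (gammaCurve h) θ ≠ 0)
    (hv : C1OnHalfLineCircle v) (hρ : 0 < ρ) (hl : 0 < lam) (hs : 2 ≤ s) (hN : 0 ≤ N)
    (hvN : ∀ r > (0 : ℝ), ∀ θ ∈ Ioo 0 (2 * Real.pi), ‖v r θ‖ ≤ N * japaneseBracket r ^ (-s))
    (hvrN : ∀ r > (0 : ℝ), ∀ θ ∈ Ioo 0 (2 * Real.pi),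
      r * ‖deriv (fun t => v t θ) r‖ ≤ N * japaneseBracket r ^ (-s))
    (hvtN : ∀ r > (0 : ℝ), ∀ θ ∈ Ioo 0 (2 * Real.pi),
      ‖deriv (fun t => v r t) θ‖ ≤ N * japaneseBracket r ^ (-s)) :
    ‖oscIntegral h m v ρ α‖ₑ ≤ ∫⁻ θ, (∫⁻ r in Ioi (0 : ℝ), ENNReal.ofReal (N *
      reducedBound lam (ρ * Complex.exp (Complex.I * α)) (deriv (gammaCurve h)) m s r θ))
        ∂circleMeasure := by
  have hg : SmoothOnCircle (deriv (gammaCurve h)) := hh.gammaCurve.deriv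
  set g := deriv (gammaCurve h) with hgdef
  set c : ℂ := ρ * Complex.exp (Complex.I * α) with hc
  have hc0 : c ≠ 0 := mul_ne_zero (by exact_mod_cast hρ.ne') (Complex.exp_ne_zero _)
  set ν := fun θ => m θ / g θ with hνdef
  have hνs : SmoothOnCircle ν := hm.div hg hg0
  have hgf : ∀ θ, g θ = Complex.exp (-(Complex.I * θ)) * (Complex.I * h θ - deriv h θ) := fun θ =>
    (hasDerivAt_gammaCurve (hh.hasDerivAt θ)).deriv
  set U : ℝ → ℝ → ℂ := fun r θ => oscFactor h ρ α r θ * amplitude lam c g ν v r θ with hU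
  have hUs : ContDiffOn ℝ 1 (fun p : ℝ × ℝ => U p.1 p.2) (Ioi 0 ×ˢ univ) :=
    (contDiffOn_oscFactor hh.contDiff_one).mul
      (contDiffOn_amplitude hg.contDiff_one hg0 hνs.contDiff_one hv.1)
  have main := fun (r : ℝ) (hr : r > 0) (θ : ℝ) (hθ : θ ∈ Ioo 0 (2 * Real.pi)) =>
    exists_deriv_oscFactor_mul_amplitude (α := α) (m := m) hl hr hρ (him θ) (hh.hasDerivAt θ)
      (hg.hasDerivAt θ) (hg0 θ) (hgf θ) (hνs.hasDerivAt θ) rfl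
      (hasDerivAt_radial hv.1 hr θ) (hasDerivAt_angular hv.1 hr θ) (hvN r hr θ hθ)
      (hvrN r hr θ hθ) (hvtN r hr θ hθ)
  obtain ⟨B, hB⟩ : ∃ B, ∀ θ ∈ Ioo 0 (2 * Real.pi), ‖ν θ‖ ∈ Icc 0 B ∧ ‖deriv ν θ‖ ∈ Icc 0 B ∧
      ‖deriv g θ / g θ‖ ∈ Icc 0 B ∧ ‖h θ‖ ∈ Icc 0 B ∧ ‖deriv h θ‖ ∈ Icc 0 B ∧
      ‖g θ / c‖ ≤ B := by
    have hcont : Continuous fun θ => ‖ν θ‖ + ‖deriv ν θ‖ + ‖deriv g θ / g θ‖ + ‖h θ‖ +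
        ‖deriv h θ‖ + ‖g θ / c‖ := by
      have c1 := hνs.continuous
      have c2 := hνs.deriv.continuous
      have c3 := (hg.deriv.div hg hg0).continuous
      have c4 := hh.continuous
      have c5 := hh.deriv.continuous
      have c6 := hg.continuous
      fun_prop
    obtain ⟨B, hB⟩ := isCompact_Icc.exists_bound_of_continuousOn
      (s := Icc 0 (2 * Real.pi)) hcont.continuousOn
    refine ⟨B, fun θ hθ => ?_⟩
    have h1 := (le_abs_self _).trans (hB θ (Ioo_subset_Icc_self hθ))
    have := norm_nonneg (ν θ)
    have := norm_nonneg (deriv ν θ)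
    have := norm_nonneg (deriv g θ / g θ)
    have := norm_nonneg (h θ)
    have := norm_nonneg (deriv h θ)
    have := norm_nonneg (g θ / c)
    refine ⟨⟨?_, ?_⟩, ⟨?_, ?_⟩, ⟨?_, ?_⟩, ⟨?_, ?_⟩, ⟨?_, ?_⟩, ?_⟩ <;> linarith
  have hBpos : 0 ≤ B := by
    have := (hB Real.pi ⟨Real.pi_pos, by linarith [Real.pi_pos]⟩).1
    exact this.1.trans this.2
  have hΩ : ∀ r, N * japaneseBracket r ^ (-s) ≤ N * (1 + r ^ 2)⁻¹ := fun r =>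
    mul_le_mul_of_nonneg_left (japaneseBracket_rpow_le hs r) hN
  have hΩ0 : ∀ r, 0 ≤ N * japaneseBracket r ^ (-s) := fun r =>
    mul_nonneg hN (Real.rpow_nonneg (japaneseBracket_pos r).le _)
  -- This constant depends on everything in sight; it only feeds the qualitative hypotheses of the
  -- integration by parts and does not appear in the conclusion.
  set M := N * (100 * (ρ + 1 + B) * (1 + B) * ((1 + B) * (1 + Real.sqrt lam)) ^ 2) with hM
  have bR : ∀ r > (0 : ℝ), ∀ θ ∈ Ioo 0 (2 * Real.pi),
      ‖deriv (fun s => U s θ) r‖ ≤ M * (1 + r ^ 2)⁻¹ := by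
    intro r hr θ hθ
    obtain ⟨Ur, Ut, h1, -, h2, -, -⟩ := main r hr θ hθ
    obtain ⟨b1, b2, b3, b4, b5, b6⟩ := hB θ hθ
    rw [show deriv (fun s => U s θ) r = Ur from h1.deriv]
    refine h2.trans (le_trans ?_ (crude_bound hl hc0 (hg0 θ) hr hρ b6 (hΩ r) (hΩ0 r) b1 b2
      b3 b4))
    have h3 := hΩ0 r
    have hX := (regSqInv_pos hl (statRatio c g r θ)).le
    have h4 : 16 * ‖ν θ‖ ≤ 16 * ‖ν θ‖ * (1 + ‖deriv g θ / g θ‖) :=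
      le_mul_of_one_le_right (by positivity) (by linarith [b3.1])
    refine add_le_add le_rfl (mul_le_mul_of_nonneg_left (add_le_add ?_ ?_) (by positivity))
    · gcongr; linarith [b2.1]
    · exact mul_le_mul_of_nonneg_right (mul_le_mul_of_nonneg_right h4 (norm_nonneg _)) hX
  have bT : ∀ r > (0 : ℝ), ∀ θ ∈ Ioo 0 (2 * Real.pi),
      ‖(r : ℂ)⁻¹ * deriv (fun t => U r t) θ‖ ≤ M * (1 + r ^ 2)⁻¹ := by
    intro r hr θ hθ
    obtain ⟨Ur, Ut, -, h1, -, h2, -⟩ := main r hr θ hθ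
    obtain ⟨b1, b2, b3, b4, b5, b6⟩ := hB θ hθ
    rw [show deriv (fun t => U r t) θ = Ut from h1.deriv]
    refine h2.trans (le_trans ?_ (crude_bound hl hc0 (hg0 θ) hr hρ b6 (hΩ r) (hΩ0 r) b1 b2
      b3 b5))
    have h3 := hΩ0 r
    have hX := (regSqInv_pos hl (statRatio c g r θ)).le
    have h4 : 8 * ‖ν θ‖ * ‖deriv g θ / g θ‖ ≤ 16 * ‖ν θ‖ * (1 + ‖deriv g θ / g θ‖) := by
      nlinarith [b1.1, b3.1, mul_nonneg b1.1 b3.1]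
    refine add_le_add le_rfl (mul_le_mul_of_nonneg_left (add_le_add ?_ ?_) (by positivity))
    · gcongr; norm_num
    · exact mul_le_mul_of_nonneg_right (mul_le_mul_of_nonneg_right h4 (norm_nonneg _)) hX
  set M₁ := (1 + B) * (1 + Real.sqrt lam) with hM₁
  have hM₁1 : 1 ≤ M₁ := by nlinarith [Real.sqrt_nonneg lam]
  have hMM : 4 * B * N * M₁ ≤ M := by
    have h1 : B * M₁ ≤ (1 + B) * M₁ ^ 2 := by
      have : M₁ ≤ M₁ ^ 2 := by nlinarith
      gcongr; linarith
    have h2 : (1 + B) * M₁ ^ 2 ≤ (ρ + 1 + B) * ((1 + B) * M₁ ^ 2) :=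
      le_mul_of_one_le_left (by positivity) (by linarith)
    have h3 : 0 ≤ (1 + B) * M₁ ^ 2 := by positivity
    have h4 : 4 * (B * M₁) ≤ 100 * ((ρ + 1 + B) * ((1 + B) * M₁ ^ 2)) := by linarith
    calc 4 * B * N * M₁ = N * (4 * (B * M₁)) := by ring
      _ ≤ N * (100 * ((ρ + 1 + B) * ((1 + B) * M₁ ^ 2))) := by gcongr
      _ = M := by rw [hM]; ring
  have hUn : ∀ r > (0 : ℝ), ∀ θ ∈ Ioo 0 (2 * Real.pi), ‖U r θ‖ ≤
      B * (N * (1 + r ^ 2)⁻¹ * (r ^ 2 * (4 * Real.sqrt (regSqInv lam (statRatio c g r θ))))) := by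
    intro r hr θ hθ
    have h1 : ‖oscFactor h ρ α r θ‖ ≤ 1 := norm_oscFactor_le hr (him θ)
    simp only [hU]
    rw [norm_mul, norm_amplitude hr]
    refine (mul_le_of_le_one_left (by positivity) h1).trans ?_
    have h2 := (hvN r hr θ hθ).trans (hΩ r)
    have h3 := norm_regInv_le hl (statRatio c g r θ)
    have h4 := (hB θ hθ).1.2
    gcongr
  have bU0 : ∀ r > (0 : ℝ), ∀ θ ∈ Ioo 0 (2 * Real.pi), ‖U r θ‖ ≤ M * r ^ 2 := by
    intro r hr θ hθ
    have h1 := one_add_sq_mul_sqrt_regSqInv_le (r := r) hl hc0 (hg0 θ) (hB θ hθ).2.2.2.2.2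
    set Y := Real.sqrt (regSqInv lam (statRatio c g r θ)) with hY
    have hY0 : 0 ≤ Y := Real.sqrt_nonneg _
    have h2 : Y ≤ M₁ := by nlinarith [mul_nonneg (sq_nonneg r) hY0]
    have h3 : (1 + r ^ 2)⁻¹ ≤ 1 := inv_le_one_of_one_le₀ (by nlinarith)
    calc _ ≤ B * (N * (1 + r ^ 2)⁻¹ * (r ^ 2 * (4 * Y))) := hUn r hr θ hθ
      _ ≤ B * (N * 1 * (r ^ 2 * (4 * M₁))) := by gcongr
      _ = 4 * B * N * M₁ * r ^ 2 := by ring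
      _ ≤ M * r ^ 2 := by gcongr
  have bUinf : ∀ r > (0 : ℝ), ∀ θ ∈ Ioo 0 (2 * Real.pi), ‖U r θ‖ ≤ M * (1 + r ^ 2)⁻¹ := by
    intro r hr θ hθ
    have h1 := one_add_sq_mul_sqrt_regSqInv_le (r := r) hl hc0 (hg0 θ) (hB θ hθ).2.2.2.2.2
    set Y := Real.sqrt (regSqInv lam (statRatio c g r θ)) with hY
    have hY0 : 0 ≤ Y := Real.sqrt_nonneg _
    have h2 : r ^ 2 * Y ≤ M₁ := by nlinarith
    calc _ ≤ B * (N * (1 + r ^ 2)⁻¹ * (r ^ 2 * (4 * Y))) := hUn r hr θ hθ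
      _ = 4 * B * N * (r ^ 2 * Y) * (1 + r ^ 2)⁻¹ := by ring
      _ ≤ 4 * B * N * M₁ * (1 + r ^ 2)⁻¹ := by gcongr
      _ ≤ M * (1 + r ^ 2)⁻¹ := by gcongr
  -- The factor `r²` of the amplitude kills the boundary term at the origin.
  have hU0 : ∀ θ, U 0 θ = 0 := fun θ => by simp [hU, amplitude]
  have hUper : ∀ r > (0 : ℝ), U r (2 * Real.pi) = U r 0 := by
    intro r hr
    have p1 : ∀ {f : ℝ → ℂ}, Function.Periodic f (2 * Real.pi) → f (2 * Real.pi) = f 0 :=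
      fun hf => by simpa using hf 0
    have e1 := p1 hh.2
    have e2 := p1 hg.2
    have e3 := p1 hνs.2
    have e4 := p1 (hv.2 r hr)
    have e5 := p1 exp_neg_I_mul_periodic
    have e6 : Real.sin (2 * Real.pi + α) = Real.sin (0 + α) := by
      rw [add_comm, Real.sin_add_two_pi, zero_add]
    simp only [hU, oscFactor, amplitude, phase, statRatio, e1, e2, e3, e4, e5, e6]
  have iR := integrable_radial_deriv hUs bR
  have iT := integrable_angular_deriv hUs bT
  have zR := integral_radial_deriv_eq_zero hUs bR hU0 bU0 bUinf
  have zT := integral_angular_deriv_eq_zero hUs bT hUper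
  have iO := integrable_oscIntegrand (ρ := ρ) (α := α) hh hm him hv hs hN hvN
  have iL := iT.add (iR.const_mul Complex.I)
  have hosc : oscIntegral h m v ρ α = ∫ p : ℝ × ℝ, (oscIntegrand h m v ρ α p.1 p.2 -
      ((p.1 : ℂ)⁻¹ * deriv (fun t => U p.1 t) p.2 +
        Complex.I * deriv (fun s => U s p.2) p.1)) ∂polarMeasure := by
    have e1 : ∫ p : ℝ × ℝ, ((p.1 : ℂ)⁻¹ * deriv (fun t => U p.1 t) p.2 +
        Complex.I * deriv (fun s => U s p.2) p.1) ∂polarMeasure = 0 := by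
      rw [integral_add iT (iR.const_mul Complex.I), integral_const_mul, zR, zT]; simp
    have e2 := integral_sub iO iL
    simp only [Pi.add_apply] at e2
    rw [e2, e1, sub_zero, oscIntegral]
    rw [polarMeasure] at iO ⊢
    exact (integral_prod_symm _ iO).symm
  have iF := iO.sub iL
  rw [hosc]
  refine (enorm_integral_le_lintegral_enorm _).trans ?_
  have iF' := iF.aestronglyMeasurable.enorm
  simp only [Pi.sub_def, Pi.add_apply] at iF'
  rw [polarMeasure] at iF' ⊢
  rw [lintegral_prod_symm _ iF']
  refine lintegral_mono_ae ?_
  filter_upwards [ae_circleMeasure] with θ hθ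
  refine setLIntegral_mono' measurableSet_Ioi fun r hr => ?_
  rw [← ofReal_norm]
  refine ENNReal.ofReal_le_ofReal ?_
  obtain ⟨Ur, Ut, h1, h2, -, -, h3⟩ := main r hr θ hθ
  rw [show deriv (fun s => U s θ) r = Ur from h1.deriv,
    show deriv (fun t => U r t) θ = Ut from h2.deriv]
  refine h3.trans (le_of_eq ?_)
  rw [reducedBound, ← hc]
  ring

end Reduction

/-! ### Estimates at a fixed angle -/

theorem norm_one_sub_mul_exp_sq (x φ : ℝ) :
    ‖1 - (x : ℂ) * Complex.exp (φ * Complex.I)‖ ^ 2 =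
      (1 - x) ^ 2 + 4 * x * Real.sin (φ / 2) ^ 2 := by
  rw [← Complex.normSq_eq_norm_sq, Complex.normSq_apply]
  simp only [Complex.sub_re, Complex.one_re, Complex.re_ofReal_mul, Complex.exp_ofReal_mul_I_re,
    Complex.sub_im, Complex.one_im, Complex.im_ofReal_mul, Complex.exp_ofReal_mul_I_im]
  have h1 : Real.cos φ = 1 - 2 * Real.sin (φ / 2) ^ 2 := by
    have := Real.cos_two_mul (φ / 2)
    rw [mul_div_cancel₀ _ two_ne_zero] at this
    have h2 := Real.sin_sq_add_cos_sq (φ / 2)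
    linarith
  have h2 := Real.sin_sq_add_cos_sq φ
  linear_combination x ^ 2 * h2 - 2 * x * h1

section FixedAngle

variable {g m : ℝ → ℂ} {W : ℝ → ℝ} {ρ α lam r θ : ℝ}

/-- The polar form of `q`: its modulus is `1` at the radius `R = (|g|/ρ)^{1/2}`, and its argument
there and everywhere on the ray is `α - W`. -/
theorem statRatio_eq (hW : IsContinuousArg g W) (hg0 : g θ ≠ 0) (hρ : 0 < ρ) :
    statRatio (ρ * Complex.exp (Complex.I * α)) g r θ =
      (((r / Real.sqrt (‖g θ‖ / ρ)) ^ 2 : ℝ) : ℂ) *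
        Complex.exp ((α - W θ : ℝ) * Complex.I) := by
  have hgn : 0 < ‖g θ‖ := norm_pos_iff.2 hg0
  have hgn' : (‖g θ‖ : ℂ) ≠ 0 := by exact_mod_cast hgn.ne'
  have e : Complex.exp ((α - W θ : ℝ) * Complex.I) =
      Complex.exp (Complex.I * α) / Complex.exp (Complex.I * W θ) := by
    rw [← Complex.exp_sub]; congr 1; push_cast; ring
  have hρ' : (ρ : ℂ) ≠ 0 := by exact_mod_cast hρ.ne'
  rw [statRatio, e, div_pow, Real.sq_sqrt (by positivity)]
  conv_lhs => rw [hW.2 θ]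
  have := Complex.exp_ne_zero (Complex.I * W θ)
  push_cast
  field_simp

theorem norm_statRatio (hW : IsContinuousArg g W) (hg0 : g θ ≠ 0) (hρ : 0 < ρ) :
    ‖statRatio (ρ * Complex.exp (Complex.I * α)) g r θ‖ =
      (r / Real.sqrt (‖g θ‖ / ρ)) ^ 2 := by
  rw [statRatio_eq hW hg0 hρ, norm_mul, Complex.norm_exp_ofReal_mul_I, mul_one, Complex.norm_real,
    Real.norm_of_nonneg (sq_nonneg _)]

theorem norm_one_sub_statRatio_sq (hW : IsContinuousArg g W) (hg0 : g θ ≠ 0) (hρ : 0 < ρ) :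
    ‖1 - statRatio (ρ * Complex.exp (Complex.I * α)) g r θ‖ ^ 2 =
      (1 - (r / Real.sqrt (‖g θ‖ / ρ)) ^ 2) ^ 2 +
        4 * (r / Real.sqrt (‖g θ‖ / ρ)) ^ 2 * Real.sin ((α - W θ) / 2) ^ 2 := by
  rw [statRatio_eq hW hg0 hρ, norm_one_sub_mul_exp_sq]

/-- The remainder is sorted into two groups: terms with an undifferentiated `regInv`, and terms of
size `|1-q|⁻²` with coefficient `(1+|z|)|ν|`. The bump belongs to the second group because `|m| =
|ν| R² ρ` and `ρ ≤ lam`. -/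
theorem reducedBound_le {s : ℝ} (hW : IsContinuousArg g W) (hg0 : g θ ≠ 0) (hρ : 0 < ρ)
    (hl : 0 < lam) (hρl : ρ ≤ lam) (hr : 0 < r) :
    reducedBound lam (ρ * Complex.exp (Complex.I * α)) g m s r θ ≤
      4 * (5 * ‖m θ / g θ‖ + ‖deriv (fun t => m t / g t) θ‖) *
        (r * japaneseBracket r ^ (-s) *
          Real.sqrt (regSqInv lam (statRatio (ρ * Complex.exp (Complex.I * α)) g r θ))) +
      16 * ((1 + ‖deriv g θ / g θ‖) * ‖m θ / g θ‖) *
        (r * japaneseBracket r ^ (-s) * (r / Real.sqrt (‖g θ‖ / ρ)) ^ 2 *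
            regSqInv lam (statRatio (ρ * Complex.exp (Complex.I * α)) g r θ) +
          japaneseBracket r ^ (-s) * Real.sqrt (‖g θ‖ / ρ) ^ 2 *
          (if lam * ‖1 - statRatio (ρ * Complex.exp (Complex.I * α)) g r θ‖ ^ 2 < 1 then
            regSqInv lam (statRatio (ρ * Complex.exp (Complex.I * α)) g r θ) else 0)) := by
  have hq := norm_statRatio (r := r) (α := α) hW hg0 hρ
  have hgn : 0 < ‖g θ‖ := norm_pos_iff.2 hg0
  rw [reducedBound, hq]
  have hJ : 0 ≤ japaneseBracket r ^ (-s) := Real.rpow_nonneg (japaneseBracket_pos r).le _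
  set z := statRatio (ρ * Complex.exp (Complex.I * α)) g r θ
  set J := japaneseBracket r ^ (-s)
  have hG := norm_regInv_le hl z
  have hchi := mul_cappedBump_le hl z
  have hX := (regSqInv_pos hl z).le
  have hc0 := cappedBump_nonneg (lam * ‖1 - z‖ ^ 2)
  set T := if lam * ‖1 - z‖ ^ 2 < 1 then regSqInv lam z else 0 with hT
  have hT0 : 0 ≤ T := by rw [hT]; split_ifs <;> [exact hX; exact le_rfl]
  have hchi2 : ρ * cappedBump (lam * ‖1 - z‖ ^ 2) ≤ 2 * T := by
    refine (mul_le_mul_of_nonneg_right hρl hc0).trans (hchi.trans_eq ?_)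
    rw [hT]; split_ifs <;> simp
  have hR2 : Real.sqrt (‖g θ‖ / ρ) ^ 2 = ‖g θ‖ / ρ := Real.sq_sqrt (by positivity)
  have hm : ‖m θ‖ * cappedBump (lam * ‖1 - z‖ ^ 2) ≤
      16 * ((1 + ‖deriv g θ / g θ‖) * ‖m θ / g θ‖) * (Real.sqrt (‖g θ‖ / ρ) ^ 2 * T) := by
    have e : ‖m θ‖ = ‖m θ / g θ‖ * Real.sqrt (‖g θ‖ / ρ) ^ 2 * ρ := by
      rw [hR2, norm_div]; field_simp
    calc _ = ‖m θ / g θ‖ * Real.sqrt (‖g θ‖ / ρ) ^ 2 *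
          (ρ * cappedBump (lam * ‖1 - z‖ ^ 2)) := by rw [e]; ring
      _ ≤ ‖m θ / g θ‖ * Real.sqrt (‖g θ‖ / ρ) ^ 2 * (2 * T) := by gcongr
      _ = 2 * (1 * ‖m θ / g θ‖) * (Real.sqrt (‖g θ‖ / ρ) ^ 2 * T) := by ring
      _ ≤ _ := by
        gcongr
        · norm_num
        · exact le_add_of_nonneg_right (norm_nonneg _)
  calc _ ≤ r * J * ((5 * ‖m θ / g θ‖ + ‖deriv (fun t => m t / g t) θ‖) *
          (4 * Real.sqrt (regSqInv lam z)) +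
        16 * (1 + ‖deriv g θ / g θ‖) * ‖m θ / g θ‖ * (r / Real.sqrt (‖g θ‖ / ρ)) ^ 2 *
          regSqInv lam z) + J * (16 * ((1 + ‖deriv g θ / g θ‖) * ‖m θ / g θ‖) *
            (Real.sqrt (‖g θ‖ / ρ) ^ 2 * T)) := by gcongr
    _ = _ := by ring

theorem lintegral_reducedBound_le {β N : ℝ} (hβ : 1 / 2 < β) (hN : 0 ≤ N)
    (hW : IsContinuousArg g W) (hg0 : g θ ≠ 0) (hρ : 0 < ρ) (hl : 16 ≤ lam) (hρl : ρ ≤ lam) :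
    ∫⁻ r in Ioi (0 : ℝ), ENNReal.ofReal (N *
      reducedBound lam (ρ * Complex.exp (Complex.I * α)) g m (2 * β + 1) r θ) ≤
    ENNReal.ofReal (N *
      (4 * (5 * ‖m θ / g θ‖ + ‖deriv (fun t => m t / g t) θ‖) *
        (2 * Real.log (2 + Real.sqrt (‖g θ‖ / ρ)) + 4 * Real.arsinh (Real.sqrt lam) + 1 / 4) +
      16 * ((1 + ‖deriv g θ / g θ‖) * ‖m θ / g θ‖) *
        (40000 + 16384 * Real.pi * (Real.sqrt (‖g θ‖ / ρ) ^ (2 - 2 * β) *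
          angularWeight (Real.sqrt lam)⁻¹ α (W θ))))) := by
  have hl0 : 0 < lam := by linarith
  have hgn : 0 < ‖g θ‖ := norm_pos_iff.2 hg0
  have hR : 0 < Real.sqrt (‖g θ‖ / ρ) := Real.sqrt_pos.2 (by positivity)
  have hq : ∀ r > (0 : ℝ), _ := fun r _ =>
    norm_one_sub_statRatio_sq (r := r) (α := α) hW hg0 hρ
  have h1 := lintegral_sqrt_regSqInv_le (s := 2 * β + 1) (by linarith) hl0 hR hq
  have h2 := lintegral_regSqInv_le hβ hl hR hq
  set R := Real.sqrt (‖g θ‖ / ρ) with hRdef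
  set a := 4 * (5 * ‖m θ / g θ‖ + ‖deriv (fun t => m t / g t) θ‖) with ha
  set b := 16 * ((1 + ‖deriv g θ / g θ‖) * ‖m θ / g θ‖) with hb
  have ha0 : 0 ≤ a := by positivity
  have hb0 : 0 ≤ b := by positivity
  have hlog : 0 ≤ Real.log (2 + R) := Real.log_nonneg (by linarith)
  have har : 0 ≤ Real.arsinh (Real.sqrt lam) := Real.arsinh_nonneg_iff.2 (Real.sqrt_nonneg _)
  set c : ℂ := ρ * Complex.exp (Complex.I * α)
  set f₁ : ℝ → ℝ := fun r => r * japaneseBracket r ^ (-(2 * β + 1)) *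
    Real.sqrt (regSqInv lam (statRatio c g r θ)) with hf₁
  set f₂ : ℝ → ℝ := fun r => r * japaneseBracket r ^ (-(2 * β + 1)) * (r / R) ^ 2 *
      regSqInv lam (statRatio c g r θ) +
    japaneseBracket r ^ (-(2 * β + 1)) * R ^ 2 *
      (if lam * ‖1 - statRatio c g r θ‖ ^ 2 < 1 then regSqInv lam (statRatio c g r θ) else 0)
    with hf₂
  -- Additivity of the lower integral requires measurability of one summand only, so `f₂` can be
  -- left alone.
  have hmeas : Measurable f₁ := by
    have m1 : Measurable fun r => japaneseBracket r ^ (-(2 * β + 1)) := by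
      unfold japaneseBracket
      fun_prop
    have m2 : Measurable fun r => statRatio c g r θ := by unfold statRatio; fun_prop
    have m3 : Measurable fun r => regSqInv lam (statRatio c g r θ) := by
      unfold regSqInv; fun_prop
    exact (measurable_id.mul m1).mul m3.sqrt
  have hJ : ∀ r, 0 ≤ japaneseBracket r ^ (-(2 * β + 1)) := fun r =>
    Real.rpow_nonneg (japaneseBracket_pos r).le _
  have hf₁0 : ∀ r > 0, 0 ≤ f₁ r := fun r hr =>
    mul_nonneg (mul_nonneg hr.le (hJ r)) (Real.sqrt_nonneg _)
  have hf₂0 : ∀ r > 0, 0 ≤ f₂ r := fun r hr => by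
    have hX := (regSqInv_pos hl0 (statRatio c g r θ)).le
    have := hJ r
    have hr' : 0 ≤ r := hr.le
    simp only [hf₂]
    split_ifs <;> positivity
  have haw : angularWeight (Real.sqrt lam)⁻¹ α (W θ) =
      (Real.sqrt (Real.sin ((α - W θ) / 2) ^ 2 + lam⁻¹))⁻¹ := by
    rw [angularWeight, inv_pow, Real.sq_sqrt hl0.le]
  rw [haw]
  set L₁ := 2 * Real.log (2 + R) + 4 * Real.arsinh (Real.sqrt lam) + 1 / 4
  set L₂ := 40000 + 16384 * Real.pi *
    (R ^ (2 - 2 * β) * (Real.sqrt (Real.sin ((α - W θ) / 2) ^ 2 + lam⁻¹))⁻¹)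
  have hL₁ : 0 ≤ L₁ := by positivity
  have hL₂ : 0 ≤ L₂ := by positivity
  calc ∫⁻ r in Ioi (0 : ℝ), ENNReal.ofReal (N * reducedBound lam c g m (2 * β + 1) r θ)
      ≤ ∫⁻ r in Ioi (0 : ℝ), (ENNReal.ofReal (N * a) * ENNReal.ofReal (f₁ r) +
          ENNReal.ofReal (N * b) * ENNReal.ofReal (f₂ r)) := by
        refine setLIntegral_mono' measurableSet_Ioi fun r hr => ?_
        rw [← ENNReal.ofReal_mul (by positivity), ← ENNReal.ofReal_mul (by positivity),
          ← ENNReal.ofReal_add (mul_nonneg (by positivity) (hf₁0 r hr))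
            (mul_nonneg (by positivity) (hf₂0 r hr))]
        refine ENNReal.ofReal_le_ofReal ?_
        have := reducedBound_le (m := m) (s := 2 * β + 1) (α := α) hW hg0 hρ hl0 hρl hr
        calc _ ≤ N * (a * f₁ r + b * f₂ r) := mul_le_mul_of_nonneg_left this hN
          _ = _ := by ring
    _ = ENNReal.ofReal (N * a) * (∫⁻ r in Ioi (0 : ℝ), ENNReal.ofReal (f₁ r)) +
          ENNReal.ofReal (N * b) * ∫⁻ r in Ioi (0 : ℝ), ENNReal.ofReal (f₂ r) := by
        rw [lintegral_add_left (hmeas.ennreal_ofReal.const_mul _),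
          lintegral_const_mul' _ _ ENNReal.ofReal_ne_top,
          lintegral_const_mul' _ _ ENNReal.ofReal_ne_top]
    _ ≤ ENNReal.ofReal (N * a) * ENNReal.ofReal L₁ +
          ENNReal.ofReal (N * b) * ENNReal.ofReal L₂ := by gcongr
    _ = ENNReal.ofReal (N * (a * L₁ + b * L₂)) := by
        rw [← ENNReal.ofReal_mul (by positivity), ← ENNReal.ofReal_mul (by positivity),
          ← ENNReal.ofReal_add (by positivity) (by positivity)]
        congr 1; ring

end FixedAngle

/-! ### Assembling the angular estimates -/

theorem lintegral_circleMeasure_ofReal {f : ℝ → ℝ} (hf : Continuous f) (h0 : ∀ θ, 0 ≤ f θ) :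
    ∫⁻ θ, ENNReal.ofReal (f θ) ∂circleMeasure =
      ENNReal.ofReal (∫ θ in 0..2 * Real.pi, f θ) := by
  rw [intervalIntegral.integral_of_le Real.two_pi_pos.le, ofReal_integral_eq_lintegral_ofReal
    ((hf.integrableOn_Icc).mono_set Ioc_subset_Icc_self) (Filter.Eventually.of_forall h0)]
  rfl

theorem arsinh_sqrt_le {ρ : ℝ} (hρ : 0 < ρ) :
    Real.arsinh (Real.sqrt (max ρ 16)) ≤ 5 * Real.log (ρ + 2) := by
  set lam := max ρ 16 with hlam
  have hl : lam ≤ ρ + 16 := max_le (by linarith) (by linarith)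
  have hl0 : 0 < lam := lt_max_of_lt_left hρ
  have h1 : Real.sqrt lam ≤ (1 + lam) / 2 := by
    rw [Real.sqrt_le_left (by positivity)]; nlinarith [sq_nonneg (lam - 1)]
  have h2 : Real.sqrt (1 + Real.sqrt lam ^ 2) ≤ (2 + lam) / 2 := by
    rw [Real.sq_sqrt hl0.le, Real.sqrt_le_left (by positivity)]; nlinarith
  have h3 : (5 : ℝ) * Real.log (ρ + 2) = Real.log ((ρ + 2) ^ 5) := by rw [Real.log_pow]; norm_num
  rw [h3, Real.arsinh]
  refine Real.log_le_log (by positivity) ?_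
  -- Four of the five powers absorb the numerical constant introduced by `lam ≤ ρ + 16`.
  have h4 : (16 : ℝ) ≤ (ρ + 2) ^ 4 := by
    have : (2 : ℝ) ^ 4 ≤ (ρ + 2) ^ 4 := by gcongr; linarith
    linarith
  have h5 : (ρ + 2) ^ 5 = (ρ + 2) ^ 4 * (ρ + 2) := by ring
  nlinarith

theorem log_two_add_sqrt_div_le {ρ M x : ℝ} (hρ : 0 < ρ) (hx0 : 0 ≤ x) (hx : x ≤ M) :
    Real.log (2 + Real.sqrt (x / ρ)) ≤ Real.log (ρ⁻¹ + 2) + Real.log (2 + M) := by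
  have hM : 0 ≤ M := hx0.trans hx
  have hρ' : 0 < ρ⁻¹ := inv_pos.2 hρ
  rw [← Real.log_mul (by positivity) (by positivity)]
  refine Real.log_le_log (by positivity) ?_
  have : Real.sqrt (x / ρ) ≤ (M + ρ⁻¹) / 2 := by
    rw [Real.sqrt_le_left (by positivity), div_eq_mul_inv]
    nlinarith [sq_nonneg (M - ρ⁻¹)]
  nlinarith

theorem half_le_log_two_add {x : ℝ} (hx : 0 ≤ x) : 2 / 3 ≤ Real.log (x + 2) := by
  have h1 := Real.log_two_gt_d9
  have h2 : Real.log 2 ≤ Real.log (x + 2) := Real.log_le_log two_pos (by linarith)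
  linarith

/-- The constant of the oscillatory integral estimate. -/
noncomputable def oscConst (δ₀ : ℝ) (n : ℤ) : ℝ :=
  84 * (7 + 6 * Real.pi * |(n : ℝ)|) + 640000 * (5 + 3 * |Real.log δ₀|) +
    16 * 16384 * Real.pi * (10 * Real.pi * |(n : ℝ)|)

theorem oscConst_pos (δ₀ : ℝ) (n : ℤ) : 0 < oscConst δ₀ n := by
  have := Real.pi_pos
  unfold oscConst; positivity

/-- The three summands on the left, coming from `5|ν| + |ν'|`, from `(1+|z|)|ν|` and from the
angular singularity, are matched with the three summands of `oscConst`. -/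
theorem le_oscConst_mul {δ₀ K κ ℓ ℓ₁ ℓ₂ A : ℝ} {n : ℤ} (hK : 0 ≤ K) (hκ : 0 ≤ κ) (hℓ : 0 ≤ ℓ)
    (hℓ₁ : 0 ≤ ℓ₁) (hℓ₂ : 0 ≤ ℓ₂) (hA : A ≤ 5 * ℓ) :
    4 * (2 * (ℓ₁ + ℓ₂) + 21 * ℓ) * ((7 + 6 * Real.pi * |(n : ℝ)|) * K) +
      (640000 * ((5 + 3 * |Real.log δ₀|) * (K * ℓ₂)) +
        16 * 16384 * Real.pi * κ * (|(n : ℝ)| * (2 * Real.pi * A))) ≤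
    oscConst δ₀ n * ((κ + K) * ℓ + K * (ℓ₁ + ℓ₂)) := by
  have hpi := Real.pi_pos
  set a₁ := 7 + 6 * Real.pi * |(n : ℝ)| with ha₁
  set a₂ := 5 + 3 * |Real.log δ₀| with ha₂
  set a₃ := 16 * 16384 * Real.pi * (10 * Real.pi * |(n : ℝ)|) with ha₃
  have ha₁0 : 0 ≤ a₁ := by positivity
  have ha₂0 : 0 ≤ a₂ := by positivity
  have ha₃0 : 0 ≤ a₃ := by positivity
  set Q := (κ + K) * ℓ + K * (ℓ₁ + ℓ₂) with hQ
  have p1 : 0 ≤ K * ℓ := by positivity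
  have p2 : 0 ≤ K * (ℓ₁ + ℓ₂) := by positivity
  have p3 : 0 ≤ κ * ℓ := by positivity
  have p4 : Q = κ * ℓ + K * ℓ + K * (ℓ₁ + ℓ₂) := by rw [hQ]; ring
  have s1 : 4 * (2 * (ℓ₁ + ℓ₂) + 21 * ℓ) * (a₁ * K) ≤ 84 * a₁ * Q := by
    have h1 : 4 * (2 * (ℓ₁ + ℓ₂) + 21 * ℓ) ≤ 84 * (ℓ + (ℓ₁ + ℓ₂)) := by linarith
    calc _ ≤ 84 * (ℓ + (ℓ₁ + ℓ₂)) * (a₁ * K) := by gcongr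
      _ = 84 * a₁ * (K * ℓ + K * (ℓ₁ + ℓ₂)) := by ring
      _ ≤ _ := mul_le_mul_of_nonneg_left (by linarith) (by positivity)
  have s2 : 640000 * (a₂ * (K * ℓ₂)) ≤ 640000 * a₂ * Q := by
    have h1 : K * ℓ₂ ≤ Q := by
      have : 0 ≤ K * ℓ₁ := by positivity
      have : K * (ℓ₁ + ℓ₂) = K * ℓ₁ + K * ℓ₂ := by ring
      linarith
    rw [mul_assoc (640000 : ℝ)]
    gcongr
  have s3 : 16 * 16384 * Real.pi * κ * (|(n : ℝ)| * (2 * Real.pi * A)) ≤ a₃ * Q := by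
    calc _ ≤ 16 * 16384 * Real.pi * κ * (|(n : ℝ)| * (2 * Real.pi * (5 * ℓ))) := by gcongr
      _ = a₃ * (κ * ℓ) := by rw [ha₃]; ring
      _ ≤ _ := mul_le_mul_of_nonneg_left (by linarith) ha₃0
  have e : oscConst δ₀ n = 84 * a₁ + 640000 * a₂ + a₃ := rfl
  rw [e]; linarith

set_option maxHeartbeats 600000 in
-- The quantitative core with all norms replaced by finite real numbers. The radial bounds at fixed
-- `θ` are multiplied by the coefficients `fa`, `fb` and `fc`, and each coefficient is integrated
-- over the circle by its own mechanism.
theorem enorm_oscIntegral_le_of_bounds {h m : ℝ → ℂ} {W : ℝ → ℝ} {v : ℝ → ℝ → ℂ}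
    {β ρ α N κ M δ₀ : ℝ} {n : ℤ} (hh : SmoothOnCircle h) (hm : SmoothOnCircle m)
    (him : ∀ θ, 0 ≤ (h θ).im) (hδ₀ : 0 < δ₀) (hgδ : ∀ θ, δ₀ ≤ ‖deriv (gammaCurve h) θ‖)
    (hW : IsContinuousArg (deriv (gammaCurve h)) W)
    (hwind : W (2 * Real.pi) - W 0 = 2 * Real.pi * n)
    (hcount : ∀ w : Real.Angle,
      {θ : ℝ | θ ∈ Ico 0 (2 * Real.pi) ∧ (W θ : Real.Angle) = w}.encard = (n.natAbs : ℕ∞))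
    (hβ : 1 / 2 < β) (hv : C1OnHalfLineCircle v) (hρ : 0 < ρ) (hN : 0 ≤ N)
    (hvN : ∀ r > (0 : ℝ), ∀ θ ∈ Ioo 0 (2 * Real.pi),
      ‖v r θ‖ ≤ N * japaneseBracket r ^ (-(2 * β + 1)))
    (hvrN : ∀ r > (0 : ℝ), ∀ θ ∈ Ioo 0 (2 * Real.pi),
      r * ‖deriv (fun t => v t θ) r‖ ≤ N * japaneseBracket r ^ (-(2 * β + 1)))
    (hvtN : ∀ r > (0 : ℝ), ∀ θ ∈ Ioo 0 (2 * Real.pi),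
      ‖deriv (fun t => v r t) θ‖ ≤ N * japaneseBracket r ^ (-(2 * β + 1)))
    (hκ0 : 0 ≤ κ)
    (hκ : ∀ᵐ θ ∂circleMeasure,
      (1 + ‖deriv (deriv (gammaCurve h)) θ / deriv (gammaCurve h) θ‖) *
        ‖m θ / deriv (gammaCurve h) θ‖ ≤
      κ * |deriv W θ| * ‖deriv (gammaCurve h) θ‖ ^ (β - 1))
    (hM : ∀ θ ∈ Icc 0 (2 * Real.pi), ‖deriv (gammaCurve h) θ‖ ≤ M) {K : ℝ}
    (hK : K = ∫ θ in 0..2 * Real.pi, ‖deriv (fun t => m t / deriv (gammaCurve h) t) θ +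
      (1 + ‖deriv (deriv (gammaCurve h)) θ / deriv (gammaCurve h) θ‖ +
        deriv (deriv (gammaCurve h)) θ / deriv (gammaCurve h) θ) *
          (m θ / deriv (gammaCurve h) θ)‖) :
    ‖oscIntegral h m v ρ α‖ₑ ≤ ENNReal.ofReal (N * (oscConst δ₀ n *
      ((ρ ^ (β - 1) * κ + K) * Real.log (ρ + 2) +
        K * (Real.log (ρ⁻¹ + 2) + Real.log (2 + M))))) := by
  have hg : SmoothOnCircle (deriv (gammaCurve h)) := hh.gammaCurve.deriv
  have hg0 : ∀ θ, deriv (gammaCurve h) θ ≠ 0 := fun θ =>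
    norm_pos_iff.1 (hδ₀.trans_le (hgδ θ))
  have hpi := Real.two_pi_pos
  have hpi0 := Real.pi_pos
  set lam := max ρ 16 with hlam
  have hl : 16 ≤ lam := le_max_right _ _
  have hρl : ρ ≤ lam := le_max_left _ _
  have hl0 : 0 < lam := by linarith
  refine (enorm_oscIntegral_le_lintegral (s := 2 * β + 1) (lam := lam) hh hm him hg0 hv hρ hl0
    (by linarith) hN hvN hvrN hvtN).trans ?_
  set g := deriv (gammaCurve h) with hgdef
  set ν := fun t => m t / g t with hνdef
  set z := fun t => deriv g t / g t with hzdef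
  have hνs : SmoothOnCircle ν := hm.div hg hg0
  have hzs : SmoothOnCircle z := hg.deriv.div hg hg0
  have hWd : ∀ θ, HasDerivAt W (z θ).im θ := fun θ => hW.hasDerivAt (hg.hasDerivAt θ) (hg0 θ)
  obtain ⟨hinj, hmaps⟩ := injOn_of_encard_eq hW.1 hwind hcount
  have hper : ∀ {f : ℝ → ℂ}, Function.Periodic f (2 * Real.pi) → f (2 * Real.pi) = f 0 :=
    fun hf => by simpa using hf 0
  have cν := hνs.continuous
  have cν' := hνs.deriv.continuous
  have cz := hzs.continuous
  have cim : Continuous fun θ => (z θ).im := Complex.continuous_im.comp cz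
  have hε : 0 < (Real.sqrt lam)⁻¹ := inv_pos.2 (Real.sqrt_pos.2 hl0)
  -- the four integrals over the circle
  have hVar : ∫ θ in 0..2 * Real.pi, |(z θ).im| ≤ 2 * Real.pi * |(n : ℝ)| := by
    have h1 := lintegral_abs_deriv_mul_comp_le (F := fun _ => 1) hWd hwind hinj hmaps
      continuous_const (fun _ => zero_le_one) (fun _ => rfl) 0
    simp only [mul_one] at h1
    rw [lintegral_circleMeasure_ofReal cim.abs fun _ => abs_nonneg _] at h1
    have h2 := (ENNReal.ofReal_le_ofReal_iff (by simp; positivity)).1 h1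
    simpa [mul_comm] using h2
  have hS : ∀ θ, HasDerivAt (fun t => Real.log ‖g t‖) (z θ).re θ := by
    intro θ
    have h1 := ((hg.hasDerivAt θ).norm_sq.log (by
      have := norm_pos_iff.2 (hg0 θ)
      positivity)).div_const 2
    refine (h1.congr_of_eventuallyEq (Filter.Eventually.of_forall fun t => ?_)).congr_deriv ?_
    · simp only [Real.log_pow]; push_cast; ring
    · have h2 : (z θ).re = inner ℝ (g θ) (deriv g θ) / ‖g θ‖ ^ 2 := by
        rw [hzdef, Complex.div_re, ← Complex.normSq_eq_norm_sq, Complex.inner]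
        simp only [Complex.mul_re, Complex.conj_re, Complex.conj_im]
        ring
      rw [h2]; ring
  have hSD : ∀ θ ∈ Icc 0 (2 * Real.pi), |Real.log ‖g θ‖| ≤ |Real.log δ₀| + Real.log (2 + M) := by
    intro θ hθ
    have hgp : 0 < ‖g θ‖ := norm_pos_iff.2 (hg0 θ)
    have h1 : Real.log δ₀ ≤ Real.log ‖g θ‖ := Real.log_le_log hδ₀ (hgδ θ)
    have h2 : Real.log ‖g θ‖ ≤ Real.log (2 + M) :=
      Real.log_le_log hgp (by linarith [hM θ hθ])
    have h3 : 0 ≤ Real.log (2 + M) := Real.log_nonneg (by linarith [hM θ hθ])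
    rw [abs_le]
    constructor <;> linarith [neg_abs_le (Real.log δ₀), abs_nonneg (Real.log δ₀)]
  have hM0 : 0 ≤ M := (norm_nonneg _).trans (hM 0 ⟨le_rfl, hpi.le⟩)
  have hL1 : (1 : ℝ) ≤ 2 * Real.pi := by linarith [Real.pi_gt_three]
  have I1 := integral_norm_le hpi hνs.hasDerivAt cν' cz (hper hνs.2)
  have I2 := integral_norm_deriv_le hL1 hνs.hasDerivAt cν' cz (hper hνs.2) hVar
  have I3 := integral_norm_mul_le hpi hνs.hasDerivAt cν' cz (hper hνs.2) hS
    (by rw [hper hg.2]) hSD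
  rw [← hK] at I1 I2 I3
  have hK0 : 0 ≤ K := by
    rw [hK]; exact intervalIntegral.integral_nonneg hpi.le fun _ _ => norm_nonneg _
  have I4 := (lintegral_abs_deriv_mul_comp_le hWd hwind hinj hmaps
    (angularWeight_continuous hε α) (angularWeight_nonneg _ α) (angularWeight_periodic _ α)
    (α - Real.pi)).trans (ENNReal.ofReal_le_ofReal
      (mul_le_mul_of_nonneg_left (integral_angularWeight_le hε α) (abs_nonneg _)))
  rw [one_div, inv_inv] at I4
  set ℓ := Real.log (ρ + 2) with hℓ
  set ℓ₁ := Real.log (ρ⁻¹ + 2) with hℓ₁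
  set ℓ₂ := Real.log (2 + M) with hℓ₂
  have hℓ0 : 2 / 3 ≤ ℓ := half_le_log_two_add hρ.le
  have hℓ₁0 : 2 / 3 ≤ ℓ₁ := half_le_log_two_add (inv_pos.2 hρ).le
  have hℓ₂0 : 2 / 3 ≤ ℓ₂ := by rw [hℓ₂, add_comm]; exact half_le_log_two_add hM0
  have har := arsinh_sqrt_le hρ
  rw [← hlam, ← hℓ] at har
  have har0 : 0 ≤ Real.arsinh (Real.sqrt lam) := Real.arsinh_nonneg_iff.2 (Real.sqrt_nonneg _)
  -- The share `20ℓ` bounds `4 arsinh √lam`, and one more `ℓ ≥ 2/3` absorbs the constant `1/4`.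
  set Λ := 2 * (ℓ₁ + ℓ₂) + 21 * ℓ with hΛ
  have hΛ0 : 0 ≤ Λ := by positivity
  set C₁ : ℝ := 16 * 16384 * Real.pi * (κ * ρ ^ (β - 1)) with hC₁
  have hC₁0 : 0 ≤ C₁ := by positivity
  set fa : ℝ → ℝ := fun θ => 5 * ‖ν θ‖ + ‖deriv ν θ‖ with hfa
  set fb : ℝ → ℝ := fun θ => (1 + ‖z θ‖) * ‖ν θ‖ with hfb
  set fc : ℝ → ℝ := fun θ => |(z θ).im| * angularWeight (Real.sqrt lam)⁻¹ α (W θ) with hfc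
  have fa0 : ∀ θ, 0 ≤ fa θ := fun θ => by positivity
  have fb0 : ∀ θ, 0 ≤ fb θ := fun θ => by positivity
  have fc0 : ∀ θ, 0 ≤ fc θ := fun θ => mul_nonneg (abs_nonneg _) (angularWeight_nonneg _ _ _)
  have ca : Continuous fa := by fun_prop
  have cb : Continuous fb := by fun_prop
  have Ia : ∫ θ in 0..2 * Real.pi, fa θ ≤ (7 + 6 * Real.pi * |(n : ℝ)|) * K := by
    rw [intervalIntegral.integral_add, intervalIntegral.integral_const_mul]
    · nlinarith
    all_goals exact Continuous.intervalIntegrable (by fun_prop) _ _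
  have Ib : ∫ θ in 0..2 * Real.pi, fb θ ≤ (5 + 3 * |Real.log δ₀|) * (K * ℓ₂) := by
    have e : ∫ θ in 0..2 * Real.pi, fb θ =
        (∫ θ in 0..2 * Real.pi, ‖ν θ‖) + ∫ θ in 0..2 * Real.pi, ‖z θ‖ * ‖ν θ‖ := by
      rw [← intervalIntegral.integral_add]
      · congr 1; ext θ; simp only [hfb]; ring
      all_goals exact Continuous.intervalIntegrable (by fun_prop) _ _
    rw [e]
    -- The lower bound `ℓ₂ ≥ 2/3` converts the terms without a logarithm.
    have h1 : K ≤ 3 / 2 * (K * ℓ₂) := by nlinarith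
    have h2 := mul_le_mul_of_nonneg_left h1 (abs_nonneg (Real.log δ₀))
    nlinarith
  calc ∫⁻ θ, (∫⁻ r in Ioi (0 : ℝ), ENNReal.ofReal (N *
        reducedBound lam (ρ * Complex.exp (Complex.I * α)) g m (2 * β + 1) r θ)) ∂circleMeasure
      ≤ ∫⁻ θ, (ENNReal.ofReal (N * (4 * Λ)) * ENNReal.ofReal (fa θ) +
          (ENNReal.ofReal (N * 640000) * ENNReal.ofReal (fb θ) +
            ENNReal.ofReal (N * C₁) * ENNReal.ofReal (fc θ))) ∂circleMeasure := by
        refine lintegral_mono_ae ?_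
        filter_upwards [ae_circleMeasure, hκ] with θ hθ hκθ
        refine (lintegral_reducedBound_le hβ hN hW (hg0 θ) hρ hl hρl).trans ?_
        rw [← ENNReal.ofReal_mul (by positivity), ← ENNReal.ofReal_mul (by positivity),
          ← ENNReal.ofReal_mul (by positivity),
          ← ENNReal.ofReal_add (mul_nonneg (by positivity) (fb0 θ))
            (mul_nonneg (by positivity) (fc0 θ)),
          ← ENNReal.ofReal_add (mul_nonneg (by positivity) (fa0 θ))
            (add_nonneg (mul_nonneg (by positivity) (fb0 θ))
              (mul_nonneg (by positivity) (fc0 θ)))]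
        refine ENNReal.ofReal_le_ofReal ?_
        have hgp : 0 < ‖g θ‖ := norm_pos_iff.2 (hg0 θ)
        have t1 : 2 * Real.log (2 + Real.sqrt (‖g θ‖ / ρ)) + 4 * Real.arsinh (Real.sqrt lam) +
            1 / 4 ≤ Λ := by
          have := log_two_add_sqrt_div_le hρ hgp.le (hM θ (Ioo_subset_Icc_self hθ))
          rw [hΛ]; linarith
        -- Here `R^{2-2β} = |g|^{1-β} ρ^{β-1}`, and the hypothesis on `κ` supplies exactly the
        -- inverse power of `|g|` together with the Jacobian `|W'|`.
        have t2 : fb θ * (Real.sqrt (‖g θ‖ / ρ) ^ (2 - 2 * β) *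
            angularWeight (Real.sqrt lam)⁻¹ α (W θ)) ≤ κ * ρ ^ (β - 1) * fc θ := by
          have e1 : Real.sqrt (‖g θ‖ / ρ) ^ (2 - 2 * β) = ‖g θ‖ ^ (1 - β) * ρ ^ (β - 1) := by
            rw [Real.sqrt_eq_rpow, ← Real.rpow_mul (by positivity),
              Real.div_rpow hgp.le hρ.le, div_eq_mul_inv, ← Real.rpow_neg hρ.le]
            congr 2 <;> ring
          have e2 : ‖g θ‖ ^ (β - 1) * ‖g θ‖ ^ (1 - β) = 1 := by
            rw [← Real.rpow_add hgp]; simp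
          have e3 : deriv W θ = (z θ).im := (hWd θ).deriv
          rw [e3] at hκθ
          have haw := angularWeight_nonneg (Real.sqrt lam)⁻¹ α (W θ)
          rw [e1]
          calc _ ≤ (κ * |(z θ).im| * ‖g θ‖ ^ (β - 1)) * (‖g θ‖ ^ (1 - β) * ρ ^ (β - 1) *
                angularWeight (Real.sqrt lam)⁻¹ α (W θ)) :=
                mul_le_mul_of_nonneg_right hκθ (by positivity)
            _ = κ * ρ ^ (β - 1) * (|(z θ).im| * angularWeight (Real.sqrt lam)⁻¹ α (W θ)) *
                (‖g θ‖ ^ (β - 1) * ‖g θ‖ ^ (1 - β)) := by ring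
            _ = _ := by rw [e2, mul_one]
        have t3 : 4 * fa θ * (2 * Real.log (2 + Real.sqrt (‖g θ‖ / ρ)) +
            4 * Real.arsinh (Real.sqrt lam) + 1 / 4) ≤ 4 * fa θ * Λ :=
          mul_le_mul_of_nonneg_left t1 (mul_nonneg (by norm_num) (fa0 θ))
        have t4 := mul_le_mul_of_nonneg_left t2
          (show (0 : ℝ) ≤ 16 * 16384 * Real.pi by positivity)
        calc _ = N * (4 * fa θ * (2 * Real.log (2 + Real.sqrt (‖g θ‖ / ρ)) +
              4 * Real.arsinh (Real.sqrt lam) + 1 / 4) + 640000 * fb θ +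
              16 * 16384 * Real.pi * (fb θ * (Real.sqrt (‖g θ‖ / ρ) ^ (2 - 2 * β) *
                angularWeight (Real.sqrt lam)⁻¹ α (W θ)))) := by ring
          _ ≤ N * (4 * fa θ * Λ + 640000 * fb θ +
              16 * 16384 * Real.pi * (κ * ρ ^ (β - 1) * fc θ)) := by gcongr
          _ = _ := by rw [hC₁]; ring
    _ = ENNReal.ofReal (N * (4 * Λ)) * (∫⁻ θ, ENNReal.ofReal (fa θ) ∂circleMeasure) +
          (ENNReal.ofReal (N * 640000) * (∫⁻ θ, ENNReal.ofReal (fb θ) ∂circleMeasure) +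
            ENNReal.ofReal (N * C₁) * ∫⁻ θ, ENNReal.ofReal (fc θ) ∂circleMeasure) := by
        rw [lintegral_add_left (ca.measurable.ennreal_ofReal.const_mul _),
          lintegral_add_left (cb.measurable.ennreal_ofReal.const_mul _),
          lintegral_const_mul' _ _ ENNReal.ofReal_ne_top,
          lintegral_const_mul' _ _ ENNReal.ofReal_ne_top,
          lintegral_const_mul' _ _ ENNReal.ofReal_ne_top]
    _ ≤ ENNReal.ofReal (N * (4 * Λ)) * ENNReal.ofReal ((7 + 6 * Real.pi * |(n : ℝ)|) * K) +
          (ENNReal.ofReal (N * 640000) *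
              ENNReal.ofReal ((5 + 3 * |Real.log δ₀|) * (K * ℓ₂)) +
            ENNReal.ofReal (N * C₁) * ENNReal.ofReal
              (|(n : ℝ)| * (2 * Real.pi * Real.arsinh (Real.sqrt lam)))) := by
        rw [lintegral_circleMeasure_ofReal ca fa0, lintegral_circleMeasure_ofReal cb fb0]
        gcongr
    _ ≤ _ := by
        rw [← ENNReal.ofReal_mul (by positivity), ← ENNReal.ofReal_mul (by positivity),
          ← ENNReal.ofReal_mul (by positivity),
          ← ENNReal.ofReal_add (by positivity) (by positivity),
          ← ENNReal.ofReal_add (by positivity) (by positivity)]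
        refine ENNReal.ofReal_le_ofReal ?_
        have hfin := le_oscConst_mul (δ₀ := δ₀) (n := n) hK0
          (show 0 ≤ ρ ^ (β - 1) * κ by positivity) (show 0 ≤ ℓ by linarith)
          (show 0 ≤ ℓ₁ by linarith) (show 0 ≤ ℓ₂ by linarith) har
        refine le_trans (le_of_eq ?_) (mul_le_mul_of_nonneg_left hfin hN)
        rw [hC₁, hΛ]; ring

/-! ### From essential suprema to pointwise bounds -/

/-- By continuity the set where the bound fails is open in the open strip, and a nonempty open set
has positive measure. -/
theorem norm_le_of_ae_polarMeasure {E : Type*} [NormedAddCommGroup E] {f : ℝ × ℝ → E} {B : ℝ}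
    (hf : ContinuousOn f (Ioi 0 ×ˢ univ)) (h : ∀ᵐ p ∂polarMeasure, ‖f p‖ ≤ B)
    {r θ : ℝ} (hr : 0 < r) (hθ : θ ∈ Ioo 0 (2 * Real.pi)) : ‖f (r, θ)‖ ≤ B := by
  by_contra hcon
  have hopen : IsOpen (Ioi (0 : ℝ) ×ˢ Ioo 0 (2 * Real.pi)) := isOpen_Ioi.prod isOpen_Ioo
  have hcont : ContinuousOn (fun p => ‖f p‖) (Ioi (0 : ℝ) ×ˢ Ioo 0 (2 * Real.pi)) :=
    (hf.mono (prod_mono_right (subset_univ _))).norm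
  have hV : IsOpen ((Ioi (0 : ℝ) ×ˢ Ioo 0 (2 * Real.pi)) ∩ (fun p => ‖f p‖) ⁻¹' Ioi B) :=
    hcont.isOpen_inter_preimage hopen isOpen_Ioi
  have hmem : (r, θ) ∈ (Ioi (0 : ℝ) ×ˢ Ioo 0 (2 * Real.pi)) ∩ (fun p => ‖f p‖) ⁻¹' Ioi B :=
    ⟨⟨hr, hθ⟩, not_le.1 hcon⟩
  refine (hV.measure_pos volume ⟨_, hmem⟩).ne' ?_
  rw [polarMeasure_eq, ae_restrict_iff' (measurableSet_Ioi.prod measurableSet_Ioc)] at h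
  refine measure_mono_null (fun p hp => ?_) (ae_iff.1 h)
  simp only [mem_ofPred_eq, Classical.not_imp, not_le]
  exact ⟨⟨hp.1.1, Ioo_subset_Ioc_self hp.1.2⟩, hp.2⟩

theorem le_of_ae_circleMeasure {f : ℝ → ℝ} {B : ℝ} (hf : Continuous f)
    (h : ∀ᵐ θ ∂circleMeasure, f θ ≤ B) {θ : ℝ} (hθ : θ ∈ Icc 0 (2 * Real.pi)) : f θ ≤ B := by
  have hIoo : ∀ t ∈ Ioo 0 (2 * Real.pi), f t ≤ B := by
    intro t ht
    by_contra hcon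
    have hV : IsOpen (Ioo 0 (2 * Real.pi) ∩ f ⁻¹' Ioi B) :=
      isOpen_Ioo.inter (isOpen_Ioi.preimage hf)
    refine (hV.measure_pos volume ⟨t, ht, not_le.1 hcon⟩).ne' ?_
    rw [circleMeasure, ae_restrict_iff' measurableSet_Ioc] at h
    refine measure_mono_null (fun p hp => ?_) (ae_iff.1 h)
    simp only [mem_ofPred_eq, Classical.not_imp, not_le]
    exact ⟨Ioo_subset_Ioc_self hp.1, hp.2⟩
  rw [← closure_Ioo Real.two_pi_pos.ne] at hθ
  exact le_on_closure hIoo hf.continuousOn continuousOn_const hθ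

theorem norm_le_toReal_of_eLpNorm_top {X E : Type*} [MeasurableSpace X] [NormedAddCommGroup E]
    {μ : Measure X} {f : X → E} {a : ℝ≥0∞} (h : eLpNorm f ⊤ μ ≤ a) (ha : a ≠ ⊤) :
    ∀ᵐ x ∂μ, ‖f x‖ ≤ a.toReal := by
  rw [eLpNorm_exponent_top] at h
  filter_upwards [ae_le_eLpNormEssSup (f := f) (μ := μ)] with x hx
  have h1 := (ENNReal.ofReal_le_iff_le_toReal ha).1 ((ofReal_norm (f x)).trans_le (hx.trans h))
  exact h1

section WeightedNorm

variable {v : ℝ → ℝ → ℂ} {β : ℝ}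

theorem japaneseBracket_continuous : Continuous japaneseBracket := by
  unfold japaneseBracket; fun_prop

theorem japaneseBracket_rpow_continuous (s : ℝ) : Continuous fun r => japaneseBracket r ^ s :=
  japaneseBracket_continuous.rpow_const fun r => Or.inl (japaneseBracket_pos r).ne'

theorem le_mul_japaneseBracket_rpow_neg {s r x N : ℝ} (h : japaneseBracket r ^ s * x ≤ N) :
    x ≤ N * japaneseBracket r ^ (-s) := by
  have hJ := Real.rpow_pos_of_pos (japaneseBracket_pos r) s
  rw [Real.rpow_neg (japaneseBracket_pos r).le, ← div_eq_mul_inv, le_div_iff₀ hJ, mul_comm]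
  exact h

theorem norm_le_of_weightedNorm (hv : C1OnHalfLineCircle v) (hN : weightedNorm v β ≠ ⊤)
    {r θ : ℝ} (hr : 0 < r) (hθ : θ ∈ Ioo 0 (2 * Real.pi)) :
    ‖v r θ‖ ≤ (weightedNorm v β).toReal * japaneseBracket r ^ (-(2 * β + 1)) := by
  have h1 := norm_le_toReal_of_eLpNorm_top (le_self_add : _ ≤ weightedNorm v β) hN
  have hc : ContinuousOn (fun p : ℝ × ℝ => japaneseBracket p.1 ^ (2 * β + 1) • v p.1 p.2)
      (Ioi 0 ×ˢ univ) :=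
    ((japaneseBracket_rpow_continuous _).comp continuous_fst).continuousOn.smul hv.1.continuousOn
  have h2 := norm_le_of_ae_polarMeasure hc h1 hr hθ
  refine le_mul_japaneseBracket_rpow_neg ?_
  rwa [norm_smul, Real.norm_of_nonneg (Real.rpow_nonneg (japaneseBracket_pos r).le _)] at h2

/-- The extra power of `⟨r⟩` in the derivative part of the norm is spent on `r ≤ ⟨r⟩`, so that `r
v_r` and `v_θ` obey the same bound as `v`. -/
theorem norm_deriv_le_of_weightedNorm (hv : C1OnHalfLineCircle v) (hN : weightedNorm v β ≠ ⊤)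
    {r θ : ℝ} (hr : 0 < r) (hθ : θ ∈ Ioo 0 (2 * Real.pi)) :
    r * ‖deriv (fun s => v s θ) r‖ ≤
        (weightedNorm v β).toReal * japaneseBracket r ^ (-(2 * β + 1)) ∧
      ‖deriv (fun t => v r t) θ‖ ≤
        (weightedNorm v β).toReal * japaneseBracket r ^ (-(2 * β + 1)) := by
  have h1 := norm_le_toReal_of_eLpNorm_top (le_add_self : _ ≤ weightedNorm v β) hN
  have hc : ContinuousOn (fun p : ℝ × ℝ => japaneseBracket p.1 ^ (2 * β + 2) •
      ((deriv (fun s => v s p.2) p.1, (1 / p.1) • deriv (fun t => v p.1 t) p.2) : ℂ × ℂ))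
      (Ioi 0 ×ˢ univ) := by
    have hi : ContinuousOn (fun p : ℝ × ℝ => 1 / p.1) (Ioi 0 ×ˢ univ) :=
      continuousOn_const.div continuousOn_fst fun p hp =>
        ne_of_gt (show (0 : ℝ) < p.1 from hp.1)
    have ha : ContinuousOn (fun p : ℝ × ℝ => (1 / p.1) • deriv (fun t => v p.1 t) p.2)
        (Ioi 0 ×ˢ univ) := hi.smul (continuousOn_angular_deriv hv.1)
    exact ((japaneseBracket_rpow_continuous _).comp continuous_fst).continuousOn.smul
      ((continuousOn_radial_deriv hv.1).prodMk ha)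
  have h2 := norm_le_of_ae_polarMeasure hc h1 hr hθ
  have hJ0 := japaneseBracket_pos r
  have hJ := (Real.rpow_pos_of_pos hJ0 (2 * β + 2)).le
  rw [norm_smul, Real.norm_of_nonneg hJ, Prod.norm_def] at h2
  have hmul : ∀ x : ℝ, 0 ≤ x → japaneseBracket r ^ (2 * β + 2) * x ≤ (weightedNorm v β).toReal →
      r * x ≤ (weightedNorm v β).toReal * japaneseBracket r ^ (-(2 * β + 1)) := by
    intro x hx h
    refine le_mul_japaneseBracket_rpow_neg (le_trans ?_ h)
    have e : japaneseBracket r ^ (2 * β + 2) =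
        japaneseBracket r ^ (2 * β + 1) * japaneseBracket r := by
      rw [← Real.rpow_add_one hJ0.ne']; congr 1; ring
    rw [e, mul_assoc]
    exact mul_le_mul_of_nonneg_left (mul_le_mul_of_nonneg_right (le_japaneseBracket r) hx)
      (Real.rpow_nonneg hJ0.le _)
  constructor
  · exact hmul _ (norm_nonneg _)
      ((mul_le_mul_of_nonneg_left (le_max_left _ _) hJ).trans h2)
  · have h3 := hmul _ (norm_nonneg _)
      ((mul_le_mul_of_nonneg_left (le_max_right _ _) hJ).trans h2)
    rw [norm_smul, Real.norm_of_nonneg (by positivity), one_div, mul_inv_cancel_left₀ hr.ne'] at h3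
    exact h3

end WeightedNorm

/-! ### The quantities `κ` as real bounds -/

section Kappa

variable {h m : ℝ → ℂ} {W : ℝ → ℝ} {β : ℝ}

/-- Finiteness of `κ^{(∞)}` forces `m = 0` at almost every point where `W' = 0`, so the quotient can
be cleared without dividing by zero. -/
theorem ae_le_of_kappaInf (hg0 : ∀ θ, deriv (gammaCurve h) θ ≠ 0) (hκ : kappaInf h m W β ≠ ⊤) :
    ∀ᵐ θ ∂circleMeasure,
      (1 + ‖deriv (deriv (gammaCurve h)) θ / deriv (gammaCurve h) θ‖) *
        ‖m θ / deriv (gammaCurve h) θ‖ ≤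
      (kappaInf h m W β).toReal * |deriv W θ| * ‖deriv (gammaCurve h) θ‖ ^ (β - 1) := by
  set κ := kappaInf h m W β with hκdef
  rw [kappaInf, eLpNorm_exponent_top] at hκdef
  filter_upwards [hκdef ▸ ae_le_eLpNormEssSup] with θ hθ
  rw [enorm_eq_self] at hθ
  set g := deriv (gammaCurve h) with hg
  have hgp : 0 < ‖g θ‖ := norm_pos_iff.2 (hg0 θ)
  have hgβ : 0 < ‖g θ‖ ^ β := Real.rpow_pos_of_pos hgp β
  rw [norm_div, norm_div]
  set A := (1 / ‖g θ‖ ^ β) * (1 + ‖deriv g θ‖ / ‖g θ‖) with hA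
  have hA0 : 0 < A := by positivity
  have hmain : A * ‖m θ‖ ≤ κ.toReal * |deriv W θ| := by
    by_cases hW : deriv W θ = 0
    · by_cases hm : m θ = 0
      · simp [hm, hW]
      · exfalso
        rw [hW, enorm_zero, ENNReal.div_zero (enorm_ne_zero.2 hm),
          ENNReal.mul_top (ENNReal.ofReal_pos.2 hA0).ne'] at hθ
        exact hκ (top_le_iff.1 hθ)
    · have hWp : 0 < |deriv W θ| := abs_pos.2 hW
      rw [← ofReal_norm, ← ofReal_norm (deriv W θ), Real.norm_eq_abs,
        ← ENNReal.ofReal_div_of_pos hWp, ← ENNReal.ofReal_mul hA0.le,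
        ENNReal.ofReal_le_iff_le_toReal hκ, mul_div_assoc', div_le_iff₀ hWp] at hθ
      exact hθ
  have e : ‖g θ‖ ^ (β - 1) = ‖g θ‖ ^ β / ‖g θ‖ := Real.rpow_sub_one hgp.ne' β
  rw [e]
  calc _ = A * ‖m θ‖ * (‖g θ‖ ^ β / ‖g θ‖) := by rw [hA]; field_simp
    _ ≤ κ.toReal * |deriv W θ| * (‖g θ‖ ^ β / ‖g θ‖) :=
        mul_le_mul_of_nonneg_right hmain (by positivity)

/-- From `m'/g = ν' + zν` the two integrands differ by the unimodular factor `g/|g|`. This rewrites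
`κ^{(1)}` as the `L¹` norm handled by the first order estimates on a period. -/
theorem kappaOne_eq (hh : SmoothOnCircle h) (hm : SmoothOnCircle m)
    (hg0 : ∀ θ, deriv (gammaCurve h) θ ≠ 0) :
    kappaOne h m = ENNReal.ofReal (∫ θ in 0..2 * Real.pi,
      ‖deriv (fun t => m t / deriv (gammaCurve h) t) θ +
      (1 + ‖deriv (deriv (gammaCurve h)) θ / deriv (gammaCurve h) θ‖ +
        deriv (deriv (gammaCurve h)) θ / deriv (gammaCurve h) θ) *
          (m θ / deriv (gammaCurve h) θ)‖) := by
  have hg : SmoothOnCircle (deriv (gammaCurve h)) := hh.gammaCurve.deriv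
  set g := deriv (gammaCurve h)
  have hν : SmoothOnCircle fun t => m t / g t := hm.div hg hg0
  have hz : SmoothOnCircle fun t => deriv g t / g t := hg.deriv.div hg hg0
  rw [← lintegral_circleMeasure_ofReal _ fun θ => norm_nonneg _]
  · rw [kappaOne, eLpNorm_one_eq_lintegral_enorm]
    refine lintegral_congr fun θ => ?_
    rw [← ofReal_norm]
    congr 1
    have hgp : (‖g θ‖ : ℂ) ≠ 0 := by exact_mod_cast (norm_pos_iff.2 (hg0 θ)).ne'
    have hg0' := hg0 θ
    have hd : deriv (fun t => m t / g t) θ =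
        (deriv m θ * g θ - m θ * deriv g θ) / g θ ^ 2 :=
      ((hm.hasDerivAt θ).div (hg.hasDerivAt θ) hg0').deriv
    have e : ((1 / ‖g θ‖ : ℝ) : ℂ) * (((1 + ‖deriv g θ‖ / ‖g θ‖ : ℝ) : ℂ) * m θ + deriv m θ) =
        (g θ / ‖g θ‖) * (deriv (fun t => m t / g t) θ +
          (1 + ‖deriv g θ / g θ‖ + deriv g θ / g θ) * (m θ / g θ)) := by
      rw [hd, norm_div]
      push_cast
      field_simp
      ring
    rw [e, norm_mul, norm_div, Complex.norm_real, norm_norm,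
      div_self (norm_pos_iff.2 hg0').ne', one_mul]
  · have c1 := hν.deriv.continuous
    have c2 := hz.continuous
    have c3 := hν.continuous
    exact (c1.add (((continuous_const.add (Complex.continuous_ofReal.comp c2.norm)).add c2).mul
      c3)).norm

theorem eLpNorm_circleMeasure_ne_top {f : ℝ → ℂ} (hf : Continuous f) (p : ℝ≥0∞) :
    eLpNorm f p circleMeasure ≠ ⊤ := by
  obtain ⟨B, hB⟩ := isCompact_Icc.exists_bound_of_continuousOn
    (s := Icc 0 (2 * Real.pi)) hf.continuousOn
  refine (MemLp.of_bound (p := p) hf.aestronglyMeasurable B ?_).2.ne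
  filter_upwards [ae_circleMeasure] with θ hθ using hB θ (Ioo_subset_Icc_self hθ)

theorem norm_deriv_gammaCurve_le (hh : SmoothOnCircle h) (hm : SmoothOnCircle m)
    {θ : ℝ} (hθ : θ ∈ Icc 0 (2 * Real.pi)) :
    ‖deriv (gammaCurve h) θ‖ ≤ (kappaDollar h m).toReal := by
  have hg : SmoothOnCircle (deriv (gammaCurve h)) := hh.gammaCurve.deriv
  have hfin : kappaDollar h m ≠ ⊤ := ENNReal.add_ne_top.2
    ⟨eLpNorm_circleMeasure_ne_top hm.deriv.continuous 1,
      eLpNorm_circleMeasure_ne_top hg.continuous ⊤⟩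
  exact le_of_ae_circleMeasure hg.continuous.norm
    (norm_le_toReal_of_eLpNorm_top (le_add_self : _ ≤ kappaDollar h m) hfin) hθ

/-- If `κ^{(1)} = 0`, then `integral_norm_le` gives `ν = 0` almost everywhere, hence `m = 0`. This
settles the case `0 · ∞` of the final bound. -/
theorem oscIntegral_eq_zero_of_kappaOne (hh : SmoothOnCircle h) (hm : SmoothOnCircle m)
    (hg0 : ∀ θ, deriv (gammaCurve h) θ ≠ 0) (hκ : kappaOne h m = 0) (v : ℝ → ℝ → ℂ) (ρ α : ℝ) :
    oscIntegral h m v ρ α = 0 := by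
  have hg : SmoothOnCircle (deriv (gammaCurve h)) := hh.gammaCurve.deriv
  rw [kappaOne_eq hh hm hg0, ENNReal.ofReal_eq_zero] at hκ
  set g := deriv (gammaCurve h)
  have hν : SmoothOnCircle fun t => m t / g t := hm.div hg hg0
  have hz : SmoothOnCircle fun t => deriv g t / g t := hg.deriv.div hg hg0
  have h1 := integral_norm_le Real.two_pi_pos hν.hasDerivAt hν.deriv.continuous hz.continuous
    (by simpa using hν.2 0)
  have h2 := lintegral_circleMeasure_ofReal hν.continuous.norm fun _ => norm_nonneg _
  rw [ENNReal.ofReal_eq_zero.2 (h1.trans hκ), lintegral_eq_zero_iff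
    hν.continuous.norm.measurable.ennreal_ofReal] at h2
  refine integral_eq_zero_of_ae ?_
  filter_upwards [h2] with θ hθ
  have hm0 : m θ = 0 := by
    have := ENNReal.ofReal_eq_zero.1 hθ
    have h3 := norm_le_zero_iff.1 this
    exact (div_eq_zero_iff.1 h3).resolve_right (hg0 θ)
  simp [oscIntegrand, hm0]

end Kappa

theorem lemma3p1 (δ₀ : ℝ) (hδ₀ : 0 < δ₀) (n : ℤ) :
    ∃ C : ℝ, 0 < C ∧
      ∀ (h m : ℝ → ℂ) (W : ℝ → ℝ) (β : ℝ),
        SmoothOnCircle h → SmoothOnCircle m →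
        (∀ θ, 0 ≤ (h θ).im) →
        (∀ θ, δ₀ ≤ ‖deriv (gammaCurve h) θ‖) →
        -- `W` is the argument of `γ'`, which has winding number `n` about the origin
        IsContinuousArg (deriv (gammaCurve h)) W →
        W (2 * Real.pi) - W 0 = 2 * Real.pi * n →
        -- `W`, as a map from the circle to the circle, is `|n|`-to-1
        (∀ w : Real.Angle,
          {θ : ℝ | θ ∈ Ico 0 (2 * Real.pi) ∧ (W θ : Real.Angle) = w}.encard = (n.natAbs : ℕ∞)) →
        1 / 2 < β →
        ∀ v : ℝ → ℝ → ℂ, C1OnHalfLineCircle v →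
        ∀ ρ α : ℝ, 0 < ρ →
          (weightedNorm v β < ⊤ →
            Integrable (fun p : ℝ × ℝ => oscIntegrand h m v ρ α p.1 p.2) polarMeasure) ∧
          ‖oscIntegral h m v ρ α‖ₑ ≤
            ENNReal.ofReal C *
              ((ENNReal.ofReal (ρ ^ (β - 1) * (1 + ρ⁻¹)) * kappaInf h m W β + kappaOne h m) *
                  ENNReal.ofReal (Real.log (ρ + 2)) +
                kappaOne h m *
                  ENNReal.ofReal
                    (Real.log (ρ⁻¹ + 2) + Real.log (2 + (kappaDollar h m).toReal))) *
              weightedNorm v β := by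
  refine ⟨oscConst δ₀ n, oscConst_pos δ₀ n, ?_⟩
  intro h m W β hh hm him hgδ hW hwind hcount hβ v hv ρ α hρ
  have hg0 : ∀ θ, deriv (gammaCurve h) θ ≠ 0 := fun θ =>
    norm_pos_iff.1 (hδ₀.trans_le (hgδ θ))
  refine ⟨fun hN => integrable_oscIntegrand hh hm him hv (s := 2 * β + 1) (by linarith)
    ENNReal.toReal_nonneg fun r hr θ hθ => norm_le_of_weightedNorm hv hN.ne hr hθ, ?_⟩
  have hC := (ENNReal.ofReal_pos.2 (oscConst_pos δ₀ n)).ne'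
  have hℓ : 0 < Real.log (ρ + 2) := Real.log_pos (by linarith)
  have hℓ' := (ENNReal.ofReal_pos.2 hℓ).ne'
  have hρβ : 0 < ρ ^ (β - 1) := Real.rpow_pos_of_pos hρ _
  have hρi : 0 < ρ⁻¹ := inv_pos.2 hρ
  -- Infinite norms are removed first. The right side is then `⊤` unless a factor `0` meets it, and
  -- in that case the integral itself vanishes.
  by_cases hN : weightedNorm v β = ⊤
  · by_cases hK : kappaOne h m = 0
    · rw [oscIntegral_eq_zero_of_kappaOne hh hm hg0 hK]; simp
    · refine le_of_le_of_eq le_top (Eq.symm ?_)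
      rw [hN, ENNReal.mul_top (mul_ne_zero hC ?_)]
      intro h0
      have h1 := (add_eq_zero.1 h0).1
      exact hK (add_eq_zero.1 ((mul_eq_zero.1 h1).resolve_right hℓ')).2
  have b0 := fun (r : ℝ) (hr : r > 0) (θ : ℝ) (hθ : θ ∈ Ioo 0 (2 * Real.pi)) =>
    norm_le_of_weightedNorm (β := β) hv hN hr hθ
  have b1 := fun (r : ℝ) (hr : r > 0) (θ : ℝ) (hθ : θ ∈ Ioo 0 (2 * Real.pi)) =>
    (norm_deriv_le_of_weightedNorm (β := β) hv hN hr hθ).1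
  have b2 := fun (r : ℝ) (hr : r > 0) (θ : ℝ) (hθ : θ ∈ Ioo 0 (2 * Real.pi)) =>
    (norm_deriv_le_of_weightedNorm (β := β) hv hN hr hθ).2
  by_cases hκ : kappaInf h m W β = ⊤
  · by_cases hN0 : weightedNorm v β = 0
    · rw [hN0, ENNReal.toReal_zero] at b0 b1 b2
      -- With `N = 0` the reduced integrand is zero, so any positive `lam` serves.
      refine (enorm_oscIntegral_le_lintegral (lam := 1) hh hm him hg0 hv hρ one_pos
        (by linarith) le_rfl b0 b1 b2).trans ?_
      simp
    · refine le_of_le_of_eq le_top (Eq.symm ?_)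
      rw [hκ, ENNReal.mul_top (ENNReal.ofReal_pos.2 (by positivity)).ne', top_add,
        ENNReal.top_mul hℓ', top_add, ENNReal.mul_top hC, ENNReal.top_mul hN0]
  have main := enorm_oscIntegral_le_of_bounds (α := α) hh hm him hδ₀ hgδ hW hwind hcount hβ hv hρ
    ENNReal.toReal_nonneg b0 b1 b2 ENNReal.toReal_nonneg (ae_le_of_kappaInf hg0 hκ)
    (fun θ hθ => norm_deriv_gammaCurve_le hh hm hθ) rfl
  refine main.trans ?_
  rw [kappaOne_eq hh hm hg0]
  set K := ∫ θ in 0..2 * Real.pi, ‖deriv (fun t => m t / deriv (gammaCurve h) t) θ +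
      (1 + ‖deriv (deriv (gammaCurve h)) θ / deriv (gammaCurve h) θ‖ +
        deriv (deriv (gammaCurve h)) θ / deriv (gammaCurve h) θ) *
          (m θ / deriv (gammaCurve h) θ)‖ with hKdef
  have hK0 : 0 ≤ K :=
    intervalIntegral.integral_nonneg Real.two_pi_pos.le fun _ _ => norm_nonneg _
  have hκ0 : 0 ≤ (kappaInf h m W β).toReal := ENNReal.toReal_nonneg
  have hN0 : 0 ≤ (weightedNorm v β).toReal := ENNReal.toReal_nonneg
  have hM0 : 0 ≤ (kappaDollar h m).toReal := ENNReal.toReal_nonneg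
  have hC0 := (oscConst_pos δ₀ n).le
  have hℓ₁ : 0 ≤ Real.log (ρ⁻¹ + 2) := Real.log_nonneg (by linarith)
  have hℓ₂ : 0 ≤ Real.log (2 + (kappaDollar h m).toReal) := Real.log_nonneg (by linarith)
  conv_rhs => rw [← ENNReal.ofReal_toReal hκ, ← ENNReal.ofReal_toReal hN]
  rw [← ENNReal.ofReal_mul (by positivity), ← ENNReal.ofReal_add (by positivity) hK0,
    ← ENNReal.ofReal_mul (by positivity), ← ENNReal.ofReal_mul hK0,
    ← ENNReal.ofReal_add (by positivity) (by positivity), ← ENNReal.ofReal_mul hC0,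
    ← ENNReal.ofReal_mul (by positivity)]
  refine ENNReal.ofReal_le_ofReal ?_
  rw [mul_comm]
  -- The estimate obtained has only `ρ^{β-1}` in front of `κ^{(∞)}`; inserting `1 + ρ⁻¹ ≥ 1` weakens
  -- it to the stated form.
  have : ρ ^ (β - 1) * (kappaInf h m W β).toReal ≤
      ρ ^ (β - 1) * (1 + ρ⁻¹) * (kappaInf h m W β).toReal := by
    gcongr
    exact le_mul_of_one_le_right hρβ.le (by linarith)
  gcongr
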